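/- Let $1\le a_1<\dots<a_r<b$ be integers with $r\ge 1$. Let $\mathbb{F}\ell(2a_\bullet,2b)$ be the manifold of partial flags $E\colon E_{2a_1}\subset\dots\subset E_{2a_r}\subset\mathbb{C}^{2b}$ with $\dim E_{2a_i}=2a_i$, and let $\mathbb{F}\ell(2b)$ be the manifold of complete flags in $\mathbb{C}^{2b}$. A Schubert problem on $\mathbb{F}\ell(2a_\bullet,2b)$ is a list of Schubert conditions whose codimensions add up to $\dim\mathbb{F}\ell(2a_\bullet,2b)$; an instance of it is given by one complete flag for each condition, and its solutions are the points in the intersection of the corresponding Schubert varieties. There is a Schubert problem on $\mathbb{F}\ell(2a_\bullet,2b)$, given by four Schubert conditions, such that the following hold. (1) For all complete flags $F^1,\dots,F^4$ in $\mathbb{C}^{2b}$ with $b$-dimensional members $K^j=F^j_b$, the solutions of the instance given by $F^1,\dots,F^4$ are exactly the flags $E\in\mathbb{F}\ell(2a_\bullet,2b)$ with $$\dim (E_{2a_i}\cap K^j)\ \ge\ a_i\qquad\text{for all } i=1,\dots,r \text{ and } j=1,\dots,4 .$$ (2) For all $(F^1,\dots,F^4)$ in some nonempty Zariski open subset of $\mathbb{F}\ell(2b)^4$: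 $K^i\oplus K^j=\mathbb{C}^{2b}$ for $i\ne j$; $K^3$ and $K^4$ are the graphs of linear isomorphisms $f_3,f_4\colon K^1\to K^2$; the map $\varphi=f_4^{-1}\circ f_3\colon K^1\to K^1$ has a basis of eigenvectors $v_1,\dots,v_b$ with distinct eigenvalues; the assignment $E_{2a_i}=L_i\oplus f_3(L_i)$ is a bijection from the flags $L_1\subset\dots\subset L_r\subset K^1$ of $\varphi$-stable subspaces with $\dim L_i=a_i$ to the solutions; and $L_i=\operatorname{span}\{v_t : t\in T_i\}$ is a bijection from $$\binom{[b]}{a_\bullet}=\{T_1\subset\dots\subset T_r\subset[b] : |T_i|=a_i\},\qquad [b]=\{1,\dots,b\},$$ to these flags of $\varphi$-stable subspaces. (3) Let $\Gamma\subset\mathbb{F}\ell(2a_\bullet,2b)\times\mathbb{F}\ell(2b)^4$ be the variety of all $(E,F^1,\dots,F^4)$ such that $E$ is a solution of the instance given by $F^1,\dots,F^4$. The projection $\pi\colon\Gamma\to\mathbb{F}\ell(2b)^4$ is a branched cover, that is, a dominant morphism of irreducible complex varieties of the same dimension. Its Galois group, which is the Galois group of the normal closure of the extension $\mathbb{C}(\Gamma)/\mathbb{C}(\mathbb{F}\ell(2b)^4)$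 of function fields, acting on the embeddings of $\mathbb{C}(\Gamma)$ over $\mathbb{C}(\mathbb{F}\ell(2b)^4)$ in the normal closure, is isomorphic as a permutation group to the symmetric group $S_b$ with its natural action on $\binom{[b]}{a_\bullet}$. -/

import Mathlib

open scoped Topology

noncomputable section

/-! ## Complex varieties, rational functions and branched covers -/

/-- A presentation of a complex algebraic variety `X` as a quotient of a set `frames` of points of
the affine space `ℂ^coord`.  Zariski topology and regular functions of `X` are the quotient ones,
defined below.  It is used for flag manifolds and closed subvarieties `Y` of products of them: there
the frames are the tuples of invertible matrices lying over `Y`, and since `frames → Y` is a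
Zariski-locally trivial principal bundle under a product of parabolic subgroups of `GL n`, the
quotient structure is the usual structure of a projective variety. -/
class VarietyPresentation (X : Type) where
  coord : Type
  frames : Set (coord → ℂ)
  point : frames → X

namespace VarietyPresentation

variable (X Z : Type) [VarietyPresentation X] [VarietyPresentation Z]

/-- Polynomial functions in the coordinates of the frames. -/
abbrev Poly : Type := MvPolynomial (coord X) ℂ

/-- The Zariski topology: `U` is open when its preimage in the set of frames is Zariski open, that
is, the locus in the set of frames where some polynomial of a family `F` does not vanish. -/
@[reducible] def zariski : TopologicalSpace X where
  IsOpen U := ∃ F : Set (Poly X), ∀ s : frames (X := X),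
    point s ∈ U ↔ ∃ p ∈ F, MvPolynomial.eval s.1 p ≠ 0
  isOpen_univ := ⟨{1}, by simp⟩
  isOpen_inter := by
    rintro U V ⟨F, hF⟩ ⟨G, hG⟩
    refine ⟨{r | ∃ p ∈ F, ∃ q ∈ G, r = p * q}, fun s => ?_⟩
    rw [Set.mem_inter_iff, hF, hG]
    constructor
    · rintro ⟨⟨p, hp, hp'⟩, q, hq, hq'⟩
      exact ⟨p * q, ⟨p, hp, q, hq, rfl⟩, by simp [hp', hq']⟩
    · rintro ⟨_, ⟨p, hp, q, hq, rfl⟩, h⟩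
      rw [map_mul] at h
      exact ⟨⟨p, hp, left_ne_zero_of_mul h⟩, q, hq, right_ne_zero_of_mul h⟩
  isOpen_sUnion := by
    intro S hS
    choose! F hF using hS
    refine ⟨{p | ∃ U ∈ S, p ∈ F U}, fun s => ?_⟩
    constructor
    · rintro ⟨U, hU, hs⟩
      obtain ⟨p, hp, hp'⟩ := (hF U hU s).1 hs
      exact ⟨p, ⟨U, hU, hp⟩, hp'⟩
    · rintro ⟨p, ⟨U, hU, hp⟩, hp'⟩
      exact ⟨U, hU, (hF U hU s).2 ⟨p, hp, hp'⟩⟩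

attribute [local instance] zariski

variable {X}

/-- `f` is a regular function on the open set `U`: its pullback to the frames over `U` is locally,
around each of these frames, a quotient of two polynomials. -/
def RegularOn (U : Set X) (f : X → ℂ) : Prop :=
  ∀ s : frames (X := X), point s ∈ U → ∃ P Q : Poly X, MvPolynomial.eval s.1 Q ≠ 0 ∧
    ∀ t : frames (X := X), point t ∈ U → MvPolynomial.eval t.1 Q ≠ 0 →
      f (point t) = MvPolynomial.eval t.1 P / MvPolynomial.eval t.1 Q

theorem RegularOn.mono {U V : Set X} {f : X → ℂ} (h : RegularOn U f) (hVU : V ⊆ U) :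
    RegularOn V f := by
  intro s hs
  obtain ⟨P, Q, hQ, hf⟩ := h s (hVU hs)
  exact ⟨P, Q, hQ, fun t ht => hf t (hVU ht)⟩

theorem RegularOn.const (U : Set X) (c : ℂ) : RegularOn U (fun _ => c) := fun s _ =>
  ⟨MvPolynomial.C c, 1, by simp, by simp⟩

theorem RegularOn.add {U : Set X} {f g : X → ℂ} (hf : RegularOn U f) (hg : RegularOn U g) :
    RegularOn U (f + g) := by
  intro s hs
  obtain ⟨P, Q, hQ, h⟩ := hf s hs
  obtain ⟨P', Q', hQ', h'⟩ := hg s hs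
  refine ⟨P * Q' + Q * P', Q * Q', by simp [hQ, hQ'], fun t ht hne => ?_⟩
  rw [map_mul] at hne
  have h1 := left_ne_zero_of_mul hne
  have h2 := right_ne_zero_of_mul hne
  simp only [Pi.add_apply, h t ht h1, h' t ht h2, map_add, map_mul, div_add_div _ _ h1 h2]

theorem RegularOn.mul {U : Set X} {f g : X → ℂ} (hf : RegularOn U f) (hg : RegularOn U g) :
    RegularOn U (f * g) := by
  intro s hs
  obtain ⟨P, Q, hQ, h⟩ := hf s hs
  obtain ⟨P', Q', hQ', h'⟩ := hg s hs
  refine ⟨P * P', Q * Q', by simp [hQ, hQ'], fun t ht hne => ?_⟩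
  rw [map_mul] at hne
  simp only [Pi.mul_apply, h t ht (left_ne_zero_of_mul hne), h' t ht (right_ne_zero_of_mul hne),
    map_mul, div_mul_div_comm]

theorem RegularOn.neg {U : Set X} {f : X → ℂ} (hf : RegularOn U f) : RegularOn U (-f) := by
  have h := (RegularOn.const U (-1)).mul hf
  have e : (fun _ : X => (-1 : ℂ)) * f = -f := by funext x; simp
  rwa [e] at h

theorem RegularOn.isOpen_ne_zero {U : Set X} {f : X → ℂ} (hU : IsOpen U) (hf : RegularOn U f) :
    IsOpen {x | x ∈ U ∧ f x ≠ 0} := by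
  obtain ⟨F, hF⟩ := hU
  refine ⟨{r | ∃ p ∈ F, ∃ P Q : Poly X, r = p * (P * Q) ∧
    ∀ t : frames (X := X), point t ∈ U → MvPolynomial.eval t.1 Q ≠ 0 →
      f (point t) = MvPolynomial.eval t.1 P / MvPolynomial.eval t.1 Q}, fun s => ?_⟩
  constructor
  · rintro ⟨hs, hne⟩
    obtain ⟨p, hp, hp'⟩ := (hF s).1 hs
    obtain ⟨P, Q, hQ, h⟩ := hf s hs
    refine ⟨_, ⟨p, hp, P, Q, rfl, h⟩, ?_⟩
    rw [h s hs hQ] at hne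
    have hP : MvPolynomial.eval s.1 P ≠ 0 := fun h0 => hne (by simp [h0])
    simp [hp', hP, hQ]
  · rintro ⟨_, ⟨p, hp, P, Q, rfl, h⟩, hne⟩
    rw [map_mul, map_mul] at hne
    have hs : point s ∈ U := (hF s).2 ⟨p, hp, left_ne_zero_of_mul hne⟩
    have h2 := right_ne_zero_of_mul hne
    refine ⟨hs, ?_⟩
    rw [h s hs (right_ne_zero_of_mul h2)]
    exact div_ne_zero (left_ne_zero_of_mul h2) (right_ne_zero_of_mul h2)

theorem RegularOn.inv {U : Set X} {f : X → ℂ} (hf : RegularOn U f) (h0 : ∀ x ∈ U, f x ≠ 0) :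
    RegularOn U f⁻¹ := by
  intro s hs
  obtain ⟨P, Q, hQ, h⟩ := hf s hs
  have hP : MvPolynomial.eval s.1 P ≠ 0 := fun hz => h0 _ hs (by rw [h s hs hQ, hz, zero_div])
  refine ⟨Q * Q, P * Q, by simp [hP, hQ], fun t ht hne => ?_⟩
  rw [map_mul] at hne
  have h2 := right_ne_zero_of_mul hne
  rw [Pi.inv_apply, h t ht h2, inv_div, map_mul, map_mul, mul_div_mul_right _ _ h2]

variable (X)

/-- The filter of the sets that contain a dense Zariski open set. -/
def generic : Filter X where
  sets := {A | ∃ U : Set X, IsOpen U ∧ Dense U ∧ U ⊆ A}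
  univ_sets := ⟨Set.univ, isOpen_univ, dense_univ, subset_rfl⟩
  sets_of_superset := fun ⟨U, h1, h2, h3⟩ h => ⟨U, h1, h2, h3.trans h⟩
  inter_sets := fun ⟨U, h1, h2, h3⟩ ⟨V, g1, g2, g3⟩ =>
    ⟨U ∩ V, h1.inter g1, h2.inter_of_isOpen_left g2 h1, Set.inter_subset_inter h3 g3⟩

/-- The ring of rational functions on `X`: functions that are regular on some dense open set, where
two are identified if they agree on a dense open set. -/
def rationalFunctions : Subring ((generic X).Germ ℂ) where
  carrier := {φ | ∃ (f : X → ℂ) (U : Set X), IsOpen U ∧ Dense U ∧ RegularOn U f ∧ φ = ↑f}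
  one_mem' := ⟨fun _ => 1, Set.univ, isOpen_univ, dense_univ, RegularOn.const _ _, rfl⟩
  zero_mem' := ⟨fun _ => 0, Set.univ, isOpen_univ, dense_univ, RegularOn.const _ _, rfl⟩
  mul_mem' := by
    rintro _ _ ⟨f, U, h1, h2, h3, rfl⟩ ⟨g, V, g1, g2, g3, rfl⟩
    exact ⟨f * g, U ∩ V, h1.inter g1, h2.inter_of_isOpen_left g2 h1,
      (h3.mono Set.inter_subset_left).mul (g3.mono Set.inter_subset_right), rfl⟩
  add_mem' := by
    rintro _ _ ⟨f, U, h1, h2, h3, rfl⟩ ⟨g, V, g1, g2, g3, rfl⟩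
    exact ⟨f + g, U ∩ V, h1.inter g1, h2.inter_of_isOpen_left g2 h1,
      (h3.mono Set.inter_subset_left).add (g3.mono Set.inter_subset_right), rfl⟩
  neg_mem' := by
    rintro _ ⟨f, U, h1, h2, h3, rfl⟩
    exact ⟨-f, U, h1, h2, h3.neg, rfl⟩

/-- `X` is irreducible in the Zariski topology. -/
abbrev Irreducible : Prop := IrreducibleSpace X

variable {X}

/-- The rational functions on an irreducible variety form a field. -/
theorem isField_rationalFunctions (hX : Irreducible X) : IsField (rationalFunctions X) := by
  have hne : (generic X).NeBot := by
    rw [Filter.neBot_iff, Ne, ← Filter.empty_mem_iff_bot]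
    rintro ⟨U, -, h2, h3⟩
    obtain ⟨x, hx⟩ := h2.nonempty
    exact h3 hx
  refine ⟨⟨0, 1, zero_ne_one⟩, mul_comm, ?_⟩
  rintro ⟨_, f, U, h1, h2, h3, rfl⟩ ha
  set V : Set X := {x | x ∈ U ∧ f x ≠ 0} with hV
  have hVo : IsOpen V := h3.isOpen_ne_zero h1
  have hVn : V.Nonempty := by
    by_contra hemp
    refine ha (Subtype.ext (Quotient.sound ?_))
    refine ⟨U, h1, h2, fun x hx => ?_⟩
    by_contra hfx
    exact hemp ⟨x, hx, hfx⟩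
  have hVd : Dense V := hVo.dense hVn
  refine ⟨⟨_, f⁻¹, V, hVo, hVd, (h3.mono fun x hx => hx.1).inv fun x hx => hx.2, rfl⟩,
    Subtype.ext (Quotient.sound ?_)⟩
  exact ⟨V, hVo, hVd, fun x hx => mul_inv_cancel₀ hx.2⟩

variable (X)

/-- A dominant morphism between irreducible varieties. -/
structure DominantMorphism where
  toFun : X → Z
  irreducible_source : Irreducible X
  irreducible_target : Irreducible Z
  continuous_toFun : Continuous toFun
  regular_comp : ∀ (U : Set Z) (f : Z → ℂ), IsOpen U → RegularOn U f →
    RegularOn (toFun ⁻¹' U) (f ∘ toFun)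
  dominant : DenseRange toFun

namespace DominantMorphism

variable {X Z} (π : DominantMorphism X Z)

theorem preimage_dense {U : Set Z} (hU : IsOpen U) (hd : Dense U) : Dense (π.toFun ⁻¹' U) := by
  have := π.irreducible_source
  have := π.irreducible_target
  obtain ⟨x, hx⟩ := π.dominant.exists_mem_open hU hd.nonempty
  exact (hU.preimage π.continuous_toFun).dense ⟨x, hx⟩

theorem tendsto : Filter.Tendsto π.toFun (generic X) (generic Z) := by
  rintro A ⟨U, h1, h2, h3⟩
  exact ⟨π.toFun ⁻¹' U, h1.preimage π.continuous_toFun, π.preimage_dense h1 h2,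
    Set.preimage_mono h3⟩

/-- Pullback `f ↦ f ∘ π` of rational functions along `π`. -/
def pullback : rationalFunctions Z →+* rationalFunctions X where
  toFun φ := ⟨φ.1.compTendsto π.toFun π.tendsto, by
    obtain ⟨_, f, U, h1, h2, h3, rfl⟩ := φ
    exact ⟨f ∘ π.toFun, π.toFun ⁻¹' U, h1.preimage π.continuous_toFun, π.preimage_dense h1 h2,
      π.regular_comp U f h1 h3, rfl⟩⟩
  map_one' := rfl
  map_zero' := rfl
  map_mul' := by
    rintro ⟨_, f, U, h1, h2, h3, rfl⟩ ⟨_, g, V, g1, g2, g3, rfl⟩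
    rfl
  map_add' := by
    rintro ⟨_, f, U, h1, h2, h3, rfl⟩ ⟨_, g, V, g1, g2, g3, rfl⟩
    rfl

/-- The function field `ℂ(Z)` of the target of `π`. -/
def BaseField (_ : DominantMorphism X Z) : Type := rationalFunctions Z

/-- The function field `ℂ(X)` of the source of `π`. -/
def TotalField (_ : DominantMorphism X Z) : Type := rationalFunctions X

/-- The ring structure of `ℂ(Z)`. -/
@[reducible] def baseRing : CommRing π.BaseField := inferInstanceAs (CommRing (rationalFunctions Z))

/-- The ring structure of `ℂ(X)`. -/
@[reducible] def totalRing : CommRing π.TotalField := inferInstanceAs (CommRing (rationalFunctions X))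

instance : Field π.BaseField :=
  @IsField.toField π.BaseField π.baseRing.toRing (isField_rationalFunctions π.irreducible_target)

instance : Field π.TotalField :=
  @IsField.toField π.TotalField π.totalRing.toRing (isField_rationalFunctions π.irreducible_source)

/-- `π` realizes `ℂ(X)` as an extension of `ℂ(Z)`. -/
instance : Algebra π.BaseField π.TotalField :=
  RingHom.toAlgebra (S := π.TotalField) (R := π.BaseField) (pullback π)

/-- `ℂ(X)` is a finite extension of `ℂ(Z)`. -/
def GenericallyFinite : Prop := FiniteDimensional π.BaseField π.TotalField

end DominantMorphism

/-- A branched cover: a dominant morphism of irreducible complex varieties of the same dimension.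
For a dominant morphism, equality of dimensions is finiteness of `ℂ(X)` over `ℂ(Z)`;
separability is automatic in characteristic zero. -/
structure BranchedCover extends DominantMorphism X Z where
  finite : toDominantMorphism.GenericallyFinite

namespace BranchedCover

variable {X Z} (π : BranchedCover X Z)

/-- The normal closure of `ℂ(X) / ℂ(Z)`. -/
abbrev GaloisClosure : Type :=
  IntermediateField.normalClosure π.BaseField π.TotalField (AlgebraicClosure π.TotalField)

/-- The Galois group of the branched cover: the Galois group of the normal closure. -/
abbrev Gal : Type := π.GaloisClosure ≃ₐ[π.BaseField] π.GaloisClosure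

/-- The set of `d = [ℂ(X) : ℂ(Z)]` elements permuted by the Galois group: the embeddings over
`ℂ(Z)` of `ℂ(X)` in its normal closure (equivalently the geometric points of the generic fibre; for
`ℂ(X) = ℂ(Z)(α)` these are the `d` conjugates of `α`). -/
abbrev Sheets : Type := π.TotalField →ₐ[π.BaseField] π.GaloisClosure

/-- The permutation action of the Galois group. -/
def act (σ : π.Gal) (x : π.Sheets) : π.Sheets := σ.toAlgHom.comp x

end BranchedCover

end VarietyPresentation

/-! ## Flag manifolds -/

/-- Dimensions `d 0 < d 1 < ⋯ ≤ n` of the subspaces of a partial flag in `ℂⁿ`. -/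
structure FlagType (n : ℕ) where
  len : ℕ
  d : Fin len → ℕ
  strictMono : StrictMono d
  le : ∀ i, d i ≤ n

/-- The type of complete flags `0 = F₀ ⊂ F₁ ⊂ ⋯ ⊂ Fₙ = ℂⁿ`. -/
def FlagType.complete (n : ℕ) : FlagType n where
  len := n + 1
  d := fun i => i
  strictMono := fun _ _ h => h
  le := fun i => Nat.lt_succ_iff.1 i.2

/-- The flag manifold of flags of subspaces of `ℂⁿ` of the given dimensions. -/
@[ext]
structure PartialFlag {n : ℕ} (D : FlagType n) where
  sub : Fin D.len → Submodule ℂ (Fin n → ℂ)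
  mono : Monotone sub
  finrank_sub : ∀ i, Module.finrank ℂ (sub i) = D.d i

/-- Complete flags in `ℂⁿ`; here `F.sub k` is the subspace `F_k` of dimension `k`, `0 ≤ k ≤ n`. -/
abbrev CompleteFlag (n : ℕ) : Type := PartialFlag (FlagType.complete n)

/-- The flag spanned by an invertible matrix: its member of dimension `m` is spanned by the first
`m` columns. -/
def PartialFlag.ofMatrix {n : ℕ} (D : FlagType n) (M : Matrix (Fin n) (Fin n) ℂ)
    (hM : IsUnit M.det) : PartialFlag D where
  sub i := Submodule.span ℂ (Set.range fun l : {l : Fin n // (l : ℕ) < D.d i} => M.col l.1)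
  mono i j hij := by
    refine Submodule.span_mono ?_
    rintro _ ⟨l, rfl⟩
    exact ⟨⟨l.1, l.2.trans_le (D.strictMono.monotone hij)⟩, rfl⟩
  finrank_sub i := by
    have hli : LinearIndependent ℂ M.col :=
      Matrix.linearIndependent_cols_of_isUnit ((Matrix.isUnit_iff_isUnit_det M).2 hM)
    have h := finrank_span_eq_card
      (hli.comp (fun l : {l : Fin n // (l : ℕ) < D.d i} => l.1) Subtype.val_injective)
    refine h.trans ?_
    rw [Fintype.card_subtype, Fin.card_filter_val_lt, min_eq_right (D.le i)]

/-- The space `Fl(n)^s` of `s`-tuples of complete flags. -/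
def FlagTuple (n s : ℕ) : Type := Fin s → CompleteFlag n

/-- `Fl(n)^s` as a quotient of `(GL n)^s`. -/
instance (n s : ℕ) : VarietyPresentation (FlagTuple n s) where
  coord := Fin s × Fin n × Fin n
  frames := {c | ∀ j, IsUnit (Matrix.of fun p q => c (j, p, q)).det}
  point c := fun j => PartialFlag.ofMatrix _ _ (c.2 j)

/-! ## Schubert problems -/

/-- The dimension of the manifold of flags of type `D`: the number of pairs `k < l` of positions
separated by one of the dimensions of `D`. -/
def FlagType.manifoldDim {n : ℕ} (D : FlagType n) : ℕ :=
  Fintype.card {p : Fin n × Fin n // ∃ i, (p.1 : ℕ) < D.d i ∧ D.d i ≤ (p.2 : ℕ)}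

/-- The number of inversions of a permutation. -/
def inversionNumber {n : ℕ} (w : Equiv.Perm (Fin n)) : ℕ :=
  Fintype.card {p : Fin n × Fin n // p.1 < p.2 ∧ w p.2 < w p.1}

/-- The Schubert variety `Ω_w F` of flags `E` of type `D` such that
`dim E_i ∩ F_q ≥ #{l ≤ d_i : w(l) > n - q}` for all `i` and `q` (here positions and values of `w`
are numbered from `0`).  Its codimension is the number of inversions of `w` if all descents of
`w` are at positions `d_i`. -/
def schubertVariety {n : ℕ} (D : FlagType n) (w : Equiv.Perm (Fin n)) (F : CompleteFlag n) :
    Set (PartialFlag D) :=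
  {E | ∀ (i : Fin D.len) (q : Fin (n + 1)),
    Fintype.card {l : Fin n // (l : ℕ) < D.d i ∧ n ≤ (w l : ℕ) + q} ≤
      Module.finrank ℂ ↥(E.sub i ⊓ F.sub q)}

/-- A Schubert problem on the manifold of flags of type `D`: a list of `s` Schubert conditions
whose codimensions add up to the dimension of the flag manifold.  A Schubert condition is a
permutation with descents only at the dimensions of `D`. -/
structure SchubertProblem {n : ℕ} (D : FlagType n) (s : ℕ) where
  w : Fin s → Equiv.Perm (Fin n)
  descents : ∀ (j : Fin s) (k l : Fin n), (l : ℕ) = k + 1 → w j l < w j k → ∃ i, D.d i = l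
  sum_codim : ∑ j, inversionNumber (w j) = D.manifoldDim

namespace SchubertProblem

variable {n : ℕ} {D : FlagType n} {s : ℕ} (P : SchubertProblem D s)

/-- The solutions of the instance given by the flags `F`: an intersection of Schubert varieties. -/
def solutions (F : FlagTuple n s) : Set (PartialFlag D) :=
  {E | ∀ j, E ∈ schubertVariety D (P.w j) (F j)}

/-- The total space of the Schubert problem, contained in the product of the flag manifold and
`Fl(n)^s`. -/
def Incidence : Type :=
  {x : PartialFlag D × FlagTuple n s // x.1 ∈ P.solutions x.2}

/-- The projection of the total space to `Fl(n)^s`; its fibres are the sets of solutions. -/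
def proj (x : P.Incidence) : FlagTuple n s := x.1.2

/-- The flags given by a tuple of invertible matrices; the matrix with index `none` gives the
partial flag. -/
def pointOfMatrices (c : Option (Fin s) × Fin n × Fin n → ℂ)
    (hc : ∀ j, IsUnit (Matrix.of fun p q => c (j, p, q)).det) : PartialFlag D × FlagTuple n s :=
  (PartialFlag.ofMatrix D _ (hc none), fun j => PartialFlag.ofMatrix _ _ (hc (some j)))

/-- The total space as a quotient of a subset of `(GL n)^(s+1)`. -/
instance : VarietyPresentation P.Incidence where
  coord := Option (Fin s) × Fin n × Fin n
  frames := {c | ∃ hc : ∀ j, IsUnit (Matrix.of fun p q => c (j, p, q)).det,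
    (pointOfMatrices (D := D) c hc).1 ∈ P.solutions (pointOfMatrices (D := D) c hc).2}
  point c := ⟨pointOfMatrices c.1 c.2.1, c.2.2⟩

end SchubertProblem

/-! ## Flags of subsets and stable flags -/

/-- The flag type `2a₁ < ⋯ < 2a_r` in `ℂ^{2b}`. -/
def doubledType {r b : ℕ} (a : Fin r → ℕ) (ha : StrictMono a) (hab : ∀ i, a i < b) :
    FlagType (2 * b) where
  len := r
  d := fun i => 2 * a i
  strictMono := fun _ _ h => Nat.mul_lt_mul_of_pos_left (ha h) two_pos
  le := fun i => Nat.mul_le_mul_left 2 (hab i).le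

/-- Flags of subsets `T₁ ⊂ ⋯ ⊂ T_r ⊂ [b]` with `|T_i| = a_i`. -/
def SubsetFlag {r : ℕ} (a : Fin r → ℕ) (b : ℕ) : Type :=
  {T : Fin r → Finset (Fin b) // Monotone T ∧ ∀ i, (T i).card = a i}

/-- The natural action of `S_b` on flags of subsets of `[b]`. -/
def SubsetFlag.act {r : ℕ} {a : Fin r → ℕ} {b : ℕ} (g : Equiv.Perm (Fin b)) (T : SubsetFlag a b) :
    SubsetFlag a b :=
  ⟨fun i => (T.1 i).map g.toEmbedding, fun _ _ h => Finset.map_subset_map.2 (T.2.1 h),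
    fun i => by rw [Finset.card_map, T.2.2 i]⟩

/-- The flags `L₁ ⊂ ⋯ ⊂ L_r ⊂ K` of `φ`-stable subspaces with `dim L_i = a_i`. -/
def StableFlag {r : ℕ} (a : Fin r → ℕ) {V : Type} [AddCommGroup V] [Module ℂ V]
    (φ : V ≃ₗ[ℂ] V) : Type :=
  {L : Fin r → Submodule ℂ V //
    Monotone L ∧ ∀ i, Module.finrank ℂ (L i) = a i ∧ (L i).map φ.toLinearMap = L i}

/-- The `b`-dimensional member `K^j = F^j_b` of the `j`-th of four complete flags in `ℂ^{2b}`. -/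
def middle {b : ℕ} (F : FlagTuple (2 * b) 4) (j : Fin 4) : Submodule ℂ (Fin (2 * b) → ℂ) :=
  (F j).sub ⟨b, by simp only [FlagType.complete]; omega⟩

/-- `K ⊂ V` is the graph `{x + f x : x ∈ K₁}` of the isomorphism `f : K₁ ≃ K₂`. -/
def IsGraphOf {V : Type} [AddCommGroup V] [Module ℂ V] {K₁ K₂ : Submodule ℂ V}
    (f : K₁ ≃ₗ[ℂ] K₂) (K : Submodule ℂ V) : Prop :=
  ∀ v, v ∈ K ↔ ∃ x : K₁, v = (x : V) + (f x : V)

end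

/-! Every one of the four Schubert conditions is dim(E_{2a_i} ∩ K) ≥ a_i for a b-plane K. Its
permutation is increasing on each block of positions between consecutive numbers 2a_i; there it
takes the values a_i, …, a_{i+1} − 1, followed by the same values shifted by b. Its inversions
number dim Fl(a_•, b), a quarter of dim Fl(2a_•, 2b), and among its rank conditions those with the
b-dimensional member imply all others (`DoubledSchubert.mem_solutions_iff`).

If K¹ ⊕ K² = ℂ^{2b}, a dimension count splits E_{2a_i} into its intersections L_i and L_i' with K¹
and K², both of dimension a_i. The conditions on the graphs K³ and K⁴ force f₃ L_i = L_i' = f₄ L_i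
(`solution_map_eq`), so L_i is stable under φ = f₄⁻¹ ∘ f₃. A stable subspace of an operator with
distinct eigenvalues is spanned by eigenvectors (`basis_mem_of_stable`). The general position needed
for this is the nonvanishing of `genericity`, a polynomial in the slopes of the four planes, which
is nonzero on a diagonal example.

For the Galois group, let K = ℂ(Fl(2b)⁴) and L = ℂ(Γ). An auxiliary variety, `CoverSpace`,
parametrizes eigenvectors v_t, their images w_t = f₃ v_t, the eigenvalues, and frames of four flags
built on them. It is a principal open set of an affine space, hence irreducible. Taking the spans of
the first v_t and w_t maps it dominantly to Γ, and S_b acts on it over Fl(2b)⁴ by renumbering the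
eigenvectors.

Its function field A is much larger than the Galois closure, but it contains the eigenvalues. They
are the distinct roots of the characteristic polynomial of φ, which has coefficients in K, so they
generate a Galois extension M of K; since S_b permutes them arbitrarily, Gal(M/K) = S_b. Ratios of
coordinates of an eigenvector lie in M (`eigenvector_ratio_mem`), and therefore L ⊂ M
(`algebraMap_mem_eigField`). A permutation fixes L exactly when it fixes the standard flag of
subsets (`permHom_fixes_iff`). Flags of subsets form a single orbit, so they correspond to the
embeddings of L; the action is faithful because 1 ≤ a_i < b, so M is the normal closure of L
(`exists_gal_equiv`). -/

noncomputable section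

/-! ## Regular and rational functions -/

namespace VarietyPresentation

attribute [local instance] zariski

set_option linter.unusedSectionVars false

variable {X Z : Type} [VarietyPresentation X] [VarietyPresentation Z]

theorem RegularOn.congr {U : Set X} {f g : X → ℂ} (hf : RegularOn U f) (h : Set.EqOn f g U) :
    RegularOn U g := by
  intro s hs
  obtain ⟨P, Q, hQ, hPQ⟩ := hf s hs
  exact ⟨P, Q, hQ, fun t ht hne => (h ht).symm.trans (hPQ t ht hne)⟩

open Classical in
/-- Extension of a function on `U` by zero. -/
def zeroExt {U : Set X} (g : U → ℂ) (x : X) : ℂ := if h : x ∈ U then g ⟨x, h⟩ else 0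

theorem zeroExt_apply {U : Set X} (g : U → ℂ) {x : X} (h : x ∈ U) : zeroExt g x = g ⟨x, h⟩ :=
  dif_pos h

theorem zeroExt_restrict_eqOn (U : Set X) (f : X → ℂ) :
    Set.EqOn f (zeroExt fun x : U => f x) U :=
  fun _ h => (zeroExt_apply (fun x : U => f x) h).symm

/-- The ring of regular functions on `U`. -/
def regularRing (U : Set X) : Subring (U → ℂ) where
  carrier := {g | RegularOn U (zeroExt g)}
  one_mem' := (RegularOn.const U 1).congr fun x hx => (zeroExt_apply (1 : U → ℂ) hx).symm
  zero_mem' := (RegularOn.const U 0).congr fun x hx => (zeroExt_apply (0 : U → ℂ) hx).symm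
  mul_mem' {f g} hf hg := (hf.mul hg).congr fun x hx => by
    simp [zeroExt_apply _ hx]
  add_mem' {f g} hf hg := (hf.add hg).congr fun x hx => by
    simp [zeroExt_apply _ hx]
  neg_mem' {f} hf := hf.neg.congr fun x hx => by
    simp [zeroExt_apply _ hx]

namespace regularRing

theorem mem_iff {U : Set X} {g : U → ℂ} : g ∈ regularRing U ↔ RegularOn U (zeroExt g) := Iff.rfl

theorem regularOn {U : Set X} (g : regularRing U) : RegularOn U (zeroExt g.1) := mem_iff.1 g.2

/-- The element of the ring of regular functions given by a function that is regular on `U`. -/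
def of {U : Set X} (f : X → ℂ) (hf : RegularOn U f) : regularRing U :=
  ⟨fun x => f x, mem_iff.2 (hf.congr (zeroExt_restrict_eqOn U f))⟩

/-- Evaluation at a point. -/
def evalAt {U : Set X} (x : U) : regularRing U →+* ℂ :=
  (Pi.evalRingHom (fun _ : U => ℂ) x).comp (regularRing U).subtype

theorem evalAt_apply {U : Set X} (x : U) (g : regularRing U) : evalAt x g = g.1 x := rfl

/-- Constant functions. -/
def const (U : Set X) : ℂ →+* regularRing U where
  toFun c := of _ (RegularOn.const U c)
  map_one' := rfl
  map_zero' := rfl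
  map_mul' _ _ := rfl
  map_add' _ _ := rfl

theorem ext_evalAt {U : Set X} {g h : regularRing U} (H : ∀ x, evalAt x g = evalAt x h) : g = h :=
  Subtype.ext (funext H)

/-- Restriction of regular functions. -/
def res {U V : Set X} (h : V ⊆ U) : regularRing U →+* regularRing V where
  toFun g := ⟨fun x => g.1 ⟨x, h x.2⟩, mem_iff.2 <| ((regularOn g).mono h).congr fun x hx => by
    rw [zeroExt_apply _ (h hx), zeroExt_apply _ hx]⟩
  map_one' := rfl
  map_zero' := rfl
  map_mul' _ _ := rfl
  map_add' _ _ := rfl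

theorem evalAt_res {U V : Set X} (h : V ⊆ U) (g : regularRing U) (x : V) :
    evalAt x (res h g) = evalAt (⟨x, h x.2⟩ : U) g := rfl

theorem isOpen_ne_zero {U : Set X} (hU : IsOpen U) (g : regularRing U) :
    IsOpen {x : X | ∃ h : x ∈ U, evalAt (⟨x, h⟩ : U) g ≠ 0} := by
  convert RegularOn.isOpen_ne_zero hU (regularOn g) using 1
  ext x
  constructor
  · rintro ⟨h, hne⟩
    exact ⟨h, by rwa [zeroExt_apply _ h]⟩
  · rintro ⟨h, hne⟩
    exact ⟨h, by rwa [zeroExt_apply _ h] at hne⟩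

end regularRing

theorem eventually_generic {p : X → Prop} :
    (∀ᶠ x in generic X, p x) ↔ ∃ U : Set X, IsOpen U ∧ Dense U ∧ ∀ x ∈ U, p x := Iff.rfl

theorem eventually_generic_mem {U : Set X} (hU : IsOpen U) (hd : Dense U) :
    ∀ᶠ x in generic X, x ∈ U := ⟨U, hU, hd, subset_rfl⟩

open regularRing in
/-- The rational function given by a regular function on a dense open set. -/
def toRat {U : Set X} (hU : IsOpen U) (hd : Dense U) : regularRing U →+* rationalFunctions X where
  toFun g := ⟨(zeroExt g.1 : X → ℂ), zeroExt g.1, U, hU, hd, regularOn g, rfl⟩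
  map_one' := Subtype.ext <| Filter.Germ.coe_eq.2 <|
    (eventually_generic_mem hU hd).mono fun x hx => zeroExt_apply _ hx
  map_zero' := Subtype.ext <| Filter.Germ.coe_eq.2 <|
    (eventually_generic_mem hU hd).mono fun x hx => zeroExt_apply _ hx
  map_mul' f g := Subtype.ext <| Filter.Germ.coe_eq.2 <|
    (eventually_generic_mem hU hd).mono fun x hx => by simp [zeroExt_apply _ hx]
  map_add' f g := Subtype.ext <| Filter.Germ.coe_eq.2 <|
    (eventually_generic_mem hU hd).mono fun x hx => by simp [zeroExt_apply _ hx]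

section toRat

variable {U V : Set X} (hU : IsOpen U) (hd : Dense U) (hV : IsOpen V) (hVd : Dense V)

/-- The arbitrary value 0 of `zeroExt` outside the domain plays no role, because both domains are
dense and open. -/
theorem toRat_eq_toRat_iff {g : regularRing U} {h : regularRing V} :
    toRat hU hd g = toRat hV hVd h ↔
      ∀ᶠ x in generic X, ∃ (hx : x ∈ U) (hx' : x ∈ V), g.1 ⟨x, hx⟩ = h.1 ⟨x, hx'⟩ := by
  rw [Subtype.ext_iff]
  change ((zeroExt g.1 : X → ℂ) : (generic X).Germ ℂ) = (zeroExt h.1 : X → ℂ) ↔ _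
  rw [Filter.Germ.coe_eq]
  constructor
  · intro H
    filter_upwards [H, eventually_generic_mem hU hd, eventually_generic_mem hV hVd] with x h1 h2 h3
    exact ⟨h2, h3, by rwa [zeroExt_apply _ h2, zeroExt_apply _ h3] at h1⟩
  · intro H
    filter_upwards [H] with x ⟨h2, h3, h1⟩
    rwa [zeroExt_apply _ h2, zeroExt_apply _ h3]

theorem toRat_res (h : V ⊆ U) (g : regularRing U) :
    toRat hV hVd (regularRing.res h g) = toRat hU hd g := by
  rw [toRat_eq_toRat_iff]
  filter_upwards [eventually_generic_mem hV hVd] with x hx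
  exact ⟨hx, h hx, rfl⟩

/-- Represents a rational function by a regular one on a dense open set, where it can be evaluated
at points. -/
theorem exists_toRat_eq (φ : rationalFunctions X) :
    ∃ (U : Set X) (hU : IsOpen U) (hd : Dense U) (g : regularRing U), toRat hU hd g = φ := by
  obtain ⟨_, f, U, h1, h2, h3, rfl⟩ := φ
  refine ⟨U, h1, h2, regularRing.of f h3, Subtype.ext (Filter.Germ.coe_eq.2 ?_)⟩
  filter_upwards [eventually_generic_mem h1 h2] with x hx
  exact zeroExt_apply _ hx

end toRat

theorem generic_neBot [Nonempty X] : (generic X).NeBot := by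
  rw [Filter.neBot_iff, Ne, ← Filter.empty_mem_iff_bot]
  rintro ⟨U, -, h2, h3⟩
  obtain ⟨x, hx⟩ := h2.nonempty
  exact h3 hx

/-! ### Morphisms -/

/-- The point of affine space given by a tuple of polynomials. -/
def polyMap {ι κ : Type} (θ : κ → MvPolynomial ι ℂ) (t : ι → ℂ) : κ → ℂ :=
  fun c => MvPolynomial.eval t (θ c)

theorem eval_polyMap {ι κ : Type} (θ : κ → MvPolynomial ι ℂ) (t : ι → ℂ) (p : MvPolynomial κ ℂ) :
    MvPolynomial.eval (polyMap θ t) p = MvPolynomial.eval t (MvPolynomial.bind₁ θ p) := by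
  have h := MvPolynomial.eval₂Hom_bind₁ (RingHom.id ℂ) t θ p
  exact h.symm

/-- `g` is induced by the polynomial map `θ` between the sets of frames. -/
def InducedBy (g : X → Z) (θ : coord Z → Poly X) : Prop :=
  ∀ s : frames (X := X), ∃ h : polyMap θ s.1 ∈ frames (X := Z), point ⟨_, h⟩ = g (point s)

/-- Substituting `θ` into the polynomials that define an open set gives polynomials that define its
preimage. -/
theorem InducedBy.continuous {g : X → Z} {θ : coord Z → Poly X} (hg : InducedBy g θ) :
    Continuous g := by
  refine ⟨fun U hU => ?_⟩
  obtain ⟨F, hF⟩ := hU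
  refine ⟨MvPolynomial.bind₁ θ '' F, fun s => ?_⟩
  obtain ⟨h, hs⟩ := hg s
  rw [Set.mem_preimage, ← hs, hF, Set.exists_mem_image]
  simp only [eval_polyMap]

theorem InducedBy.regular_comp {g : X → Z} {θ : coord Z → Poly X} (hg : InducedBy g θ)
    {U : Set Z} {f : Z → ℂ} (hf : RegularOn U f) : RegularOn (g ⁻¹' U) (f ∘ g) := by
  intro s hs
  obtain ⟨h, hs'⟩ := hg s
  obtain ⟨P, Q, hQ, hPQ⟩ := hf ⟨_, h⟩ (by rw [hs']; exact hs)
  refine ⟨MvPolynomial.bind₁ θ P, MvPolynomial.bind₁ θ Q, by rwa [← eval_polyMap], fun t ht => ?_⟩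
  obtain ⟨h', ht'⟩ := hg t
  rw [← eval_polyMap, ← eval_polyMap, Function.comp, ← ht']
  exact hPQ ⟨_, h'⟩ (by rw [ht']; exact ht)

/-- A map with dense image induced by a polynomial map of frames is a dominant morphism. -/
def InducedBy.dominantMorphism {g : X → Z} {θ : coord Z → Poly X} (hg : InducedBy g θ)
    (hX : Irreducible X) (hZ : Irreducible Z) (hd : DenseRange g) : DominantMorphism X Z where
  toFun := g
  irreducible_source := hX
  irreducible_target := hZ
  continuous_toFun := hg.continuous
  regular_comp _ _ _ hf := hg.regular_comp hf
  dominant := hd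

namespace DominantMorphism

variable (π : DominantMorphism X Z) {U : Set Z}

/-- Pullback of regular functions. -/
def comapRegular (hU : IsOpen U) : regularRing U →+* regularRing (π.toFun ⁻¹' U) where
  toFun g := ⟨fun x => g.1 ⟨π.toFun x, x.2⟩, regularRing.mem_iff.2 <|
    (π.regular_comp U _ hU (regularRing.regularOn g)).congr fun x hx => by
    rw [zeroExt_apply _ hx]
    exact zeroExt_apply g.1 hx⟩
  map_one' := rfl
  map_zero' := rfl
  map_mul' _ _ := rfl
  map_add' _ _ := rfl

theorem evalAt_comapRegular (hU : IsOpen U) (g : regularRing U) (x : π.toFun ⁻¹' U) :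
    regularRing.evalAt x (π.comapRegular hU g) = regularRing.evalAt ⟨π.toFun x, x.2⟩ g := rfl

theorem pullback_toRat (hU : IsOpen U) (hd : Dense U) (g : regularRing U) :
    π.pullback (toRat hU hd g) = toRat (hU.preimage π.continuous_toFun) (π.preimage_dense hU hd)
      (π.comapRegular hU g) := by
  refine Subtype.ext (Filter.Germ.coe_eq.2 ?_)
  filter_upwards [eventually_generic_mem (hU.preimage π.continuous_toFun)
    (π.preimage_dense hU hd)] with x hx
  rw [zeroExt_apply _ hx]
  exact zeroExt_apply g.1 hx

end DominantMorphism

/-! ### Irreducibility -/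

theorem exists_eval_ne_zero {ι : Type} {p : MvPolynomial ι ℂ} (hp : p ≠ 0) :
    ∃ t, MvPolynomial.eval t p ≠ 0 := by
  by_contra! h
  exact hp (MvPolynomial.funext fun t => by rw [h t, map_zero])

theorem ne_zero_of_eval {ι : Type} {p : MvPolynomial ι ℂ} {t : ι → ℂ}
    (h : MvPolynomial.eval t p ≠ 0) : p ≠ 0 := by
  rintro rfl
  exact h (map_zero _)

/-- A variety whose frames include a family, polynomially parametrized by a principal open set of
an affine space, over every point is irreducible. -/
theorem irreducible_of_parametrization [Nonempty X] {ι : Type} (θ : coord X → MvPolynomial ι ℂ)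
    (D : MvPolynomial ι ℂ) (h1 : ∀ t, MvPolynomial.eval t D ≠ 0 → polyMap θ t ∈ frames (X := X))
    (h2 : ∀ x : X, ∃ (t : ι → ℂ) (ht : MvPolynomial.eval t D ≠ 0), point ⟨_, h1 t ht⟩ = x) :
    Irreducible X := by
  have hD : D ≠ 0 := by
    obtain ⟨t, ht, -⟩ := h2 (Classical.arbitrary X)
    exact ne_zero_of_eval ht
  -- A nonempty open set contains the image of a nonempty principal open set of the parameter space.
  have key : ∀ U : Set X, IsOpen U → U.Nonempty → ∃ p : MvPolynomial ι ℂ, p ≠ 0 ∧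
      ∀ t (ht : MvPolynomial.eval t D ≠ 0), MvPolynomial.eval t p ≠ 0 → point ⟨_, h1 t ht⟩ ∈ U := by
    rintro U ⟨F, hF⟩ ⟨x, hx⟩
    obtain ⟨t, ht, rfl⟩ := h2 x
    obtain ⟨p, hp, hp'⟩ := (hF _).1 hx
    rw [eval_polyMap] at hp'
    refine ⟨_, ne_zero_of_eval hp', fun t ht hne => (hF _).2 ⟨p, hp, ?_⟩⟩
    rwa [eval_polyMap]
  have : PreirreducibleSpace X := by
    refine ⟨fun U V hU hV hUn hVn => ?_⟩
    rw [Set.univ_inter] at hUn hVn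
    obtain ⟨p, hp, hpU⟩ := key U hU hUn
    obtain ⟨q, hq, hqV⟩ := key V hV hVn
    -- Polynomials over ℂ form a domain, and a nonzero one has a point where it does not vanish;
    -- this point lies over both open sets.
    obtain ⟨t, ht⟩ := exists_eval_ne_zero (mul_ne_zero (mul_ne_zero hD hp) hq)
    rw [map_mul, map_mul] at ht
    have htD := left_ne_zero_of_mul (left_ne_zero_of_mul ht)
    exact ⟨_, trivial, hpU t htD (right_ne_zero_of_mul (left_ne_zero_of_mul ht)),
      hqV t htD (right_ne_zero_of_mul ht)⟩
  exact { toPreirreducibleSpace := this, toNonempty := inferInstance }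

end VarietyPresentation

end

noncomputable section

/-! ## Frames of flags -/

/-- Greedy choice: the `l` vectors already chosen span a space of dimension `l`, which cannot
contain `S l`. The spaces need not be nested. -/
theorem exists_linearIndependent_mem {K V : Type*} [Field K] [AddCommGroup V] [Module K V]
    [FiniteDimensional K V] {m : ℕ} (S : Fin m → Submodule K V)
    (hS : ∀ l : Fin m, (l : ℕ) + 1 ≤ Module.finrank K (S l)) :
    ∃ v : Fin m → V, LinearIndependent K v ∧ ∀ l, v l ∈ S l := by
  induction m with
  | zero => exact ⟨Fin.elim0, linearIndependent_empty_type, fun l => l.elim0⟩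
  | succ m ih =>
    obtain ⟨v, hv, hvS⟩ := ih (fun l => S l.castSucc) (fun l => hS l.castSucc)
    have hlt : ¬ S (Fin.last m) ≤ Submodule.span K (Set.range v) := by
      intro hle
      have h1 := Submodule.finrank_mono hle
      rw [finrank_span_eq_card hv, Fintype.card_fin] at h1
      have h2 := hS (Fin.last m)
      rw [Fin.val_last] at h2
      omega
    obtain ⟨x, hxS, hx⟩ := SetLike.not_le_iff_exists.1 hlt
    refine ⟨Fin.snoc v x, hv.finSnoc hx, Fin.lastCases ?_ fun l => ?_⟩
    · simpa using hxS
    · simpa using hvS l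

namespace PartialFlag

variable {n : ℕ} {D : FlagType n}

theorem mem_ofMatrix_sub {M : Matrix (Fin n) (Fin n) ℂ} {hM : IsUnit M.det} {i : Fin D.len}
    {v : Fin n → ℂ} : v ∈ (ofMatrix D M hM).sub i ↔
      ∃ c : {l : Fin n // (l : ℕ) < D.d i} → ℂ, ∑ l, c l • M.col l.1 = v :=
  Submodule.mem_span_range_iff_exists_fun ℂ

/-- A basis adapted to a flag is a frame of the flag. -/
theorem ofMatrix_eq_of_mem {M : Matrix (Fin n) (Fin n) ℂ} (hM : IsUnit M.det) (E : PartialFlag D)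
    (h : ∀ i (l : Fin n), (l : ℕ) < D.d i → M.col l ∈ E.sub i) : ofMatrix D M hM = E := by
  ext1
  funext i
  refine Submodule.eq_of_le_of_finrank_eq (Submodule.span_le.2 ?_)
    (((ofMatrix D M hM).finrank_sub i).trans (E.finrank_sub i).symm)
  rintro _ ⟨l, rfl⟩
  exact h i l.1 l.2

theorem col_mem_ofMatrix {M : Matrix (Fin n) (Fin n) ℂ} (hM : IsUnit M.det) {i : Fin D.len}
    {l : Fin n} (hl : (l : ℕ) < D.d i) : M.col l ∈ (ofMatrix D M hM).sub i :=
  Submodule.subset_span ⟨⟨l, hl⟩, rfl⟩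

theorem isUnit_det_of_linearIndependent {v : Fin n → Fin n → ℂ} (hv : LinearIndependent ℂ v) :
    IsUnit (Matrix.of fun p q => v q p).det := by
  rw [← Matrix.isUnit_iff_isUnit_det]
  exact Matrix.linearIndependent_cols_iff_isUnit.1 hv

/-- Column `l` is taken from the smallest member of dimension greater than `l`, written as the
infimum of all such members; if there is none, the infimum is the whole space. -/
theorem exists_ofMatrix_eq (E : PartialFlag D) :
    ∃ (M : Matrix (Fin n) (Fin n) ℂ) (hM : IsUnit M.det), ofMatrix D M hM = E := by
  classical
  obtain ⟨v, hv, hvE⟩ := exists_linearIndependent_mem (K := ℂ) (V := Fin n → ℂ)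
    (fun l : Fin n => ⨅ i : {i // (l : ℕ) < D.d i}, E.sub i.1) (fun l : Fin n => by
      by_cases h : ∃ i, (l : ℕ) < D.d i
      · obtain ⟨i, hi⟩ := h
        have hne : (Finset.univ.filter fun i => (l : ℕ) < D.d i).Nonempty := ⟨i, by simpa⟩
        set i₀ := Finset.min' _ hne with hi₀
        have hi₀l : (l : ℕ) < D.d i₀ := (Finset.mem_filter.1 (Finset.min'_mem _ hne)).2
        have hle : E.sub i₀ ≤ ⨅ i : {i // (l : ℕ) < D.d i}, E.sub i.1 :=
          le_iInf fun j => E.mono (Finset.min'_le _ _ (by simpa using j.2))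
        refine le_trans ?_ (Submodule.finrank_mono hle)
        rw [E.finrank_sub]
        exact hi₀l
      · have : IsEmpty {i // (l : ℕ) < D.d i} := ⟨fun i => h ⟨i.1, i.2⟩⟩
        rw [iInf_of_empty, finrank_top]
        simp only [Module.finrank_fin_fun]
        exact l.2)
  refine ⟨_, isUnit_det_of_linearIndependent hv, ofMatrix_eq_of_mem _ _ fun i l hl => ?_⟩
  exact (Submodule.mem_iInf _).1 (hvE l) ⟨i, hl⟩

/-! ### Affine charts -/

/-- The `i`-th member of `E` projects isomorphically to the space of the first coordinates. -/
def Chart (E : PartialFlag D) (i : Fin D.len) : Prop :=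
  ∀ v ∈ E.sub i, (∀ p : Fin n, (p : ℕ) < D.d i → v p = 0) → v = 0

/-- `v` is a vector in the `i`-th member of `E` whose first coordinates are those of the `l`-th
unit vector. -/
def IsCoordVec (E : PartialFlag D) (i : Fin D.len) (l : Fin n) (v : Fin n → ℂ) : Prop :=
  v ∈ E.sub i ∧ ∀ p : Fin n, (p : ℕ) < D.d i → v p = if p = l then 1 else 0

open Classical in
/-- The vector in the `i`-th member of `E` whose first coordinates are those of the `l`-th unit
vector. -/
def coordVec (E : PartialFlag D) (i : Fin D.len) (l : Fin n) : Fin n → ℂ :=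
  if h : ∃ v, E.IsCoordVec i l v then h.choose else 0

variable {E : PartialFlag D} {i : Fin D.len}

theorem Chart.eq_of_eq_on (hE : E.Chart i) {v w : Fin n → ℂ} (hv : v ∈ E.sub i) (hw : w ∈ E.sub i)
    (h : ∀ p : Fin n, (p : ℕ) < D.d i → v p = w p) : v = w :=
  sub_eq_zero.1 <| hE _ (sub_mem hv hw) fun p hp => sub_eq_zero.2 (h p hp)

theorem Chart.coordVec_eq (hE : E.Chart i) {l : Fin n} {v : Fin n → ℂ} (hv : E.IsCoordVec i l v) :
    E.coordVec i l = v := by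
  have hex : ∃ v, E.IsCoordVec i l v := ⟨v, hv⟩
  rw [coordVec, dif_pos hex]
  exact hE.eq_of_eq_on hex.choose_spec.1 hv.1 fun p hp =>
    (hex.choose_spec.2 p hp).trans (hv.2 p hp).symm

section frame

variable (M : Matrix (Fin n) (Fin n) ℂ) (hM : IsUnit M.det)

/-- The leading submatrix of size `d`. -/
abbrev _root_.Matrix.leading {n : ℕ} {R : Type*} (M : Matrix (Fin n) (Fin n) R) (d : ℕ) :
    Matrix {l : Fin n // (l : ℕ) < d} {l : Fin n // (l : ℕ) < d} R :=
  M.submatrix Subtype.val Subtype.val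

theorem sum_smul_col_apply {d : ℕ} (c : {l : Fin n // (l : ℕ) < d} → ℂ) (p : Fin n) :
    (∑ l, c l • M.col l.1) p = ∑ l, M p l.1 * c l := by
  simp [Finset.sum_apply, mul_comm]

/-- The first `D.d i` coordinates of a combination of the first `D.d i` columns are the leading
block applied to the coefficients. -/
theorem chart_ofMatrix_iff (i : Fin D.len) :
    (ofMatrix D M hM).Chart i ↔ (M.leading (D.d i)).det ≠ 0 := by
  have hli : LinearIndependent ℂ M.col :=
    Matrix.linearIndependent_cols_of_isUnit ((Matrix.isUnit_iff_isUnit_det M).2 hM)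
  have hli' : LinearIndependent ℂ fun l : {l : Fin n // (l : ℕ) < D.d i} => M.col l.1 :=
    hli.comp _ Subtype.val_injective
  constructor
  · intro h h0
    obtain ⟨c, hc, hc0⟩ := Matrix.exists_mulVec_eq_zero_iff.2 h0
    refine hc (funext fun l => ?_)
    refine Fintype.linearIndependent_iff.1 hli' c ?_ l
    refine h _ (mem_ofMatrix_sub.2 ⟨c, rfl⟩) fun p hp => ?_
    rw [sum_smul_col_apply]
    exact congrFun hc0 ⟨p, hp⟩
  · intro h v hv hv0
    obtain ⟨c, rfl⟩ := mem_ofMatrix_sub.1 hv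
    have hc : c = 0 := by
      by_contra hc
      refine h (Matrix.exists_mulVec_eq_zero_iff.1 ⟨c, hc, funext fun p => ?_⟩)
      refine Eq.trans ?_ (hv0 p.1 p.2)
      rw [sum_smul_col_apply]
      rfl
    simp [hc]

theorem isCoordVec_ofMatrix {l : Fin n} (hl : (l : ℕ) < D.d i)
    (h : (M.leading (D.d i)).det ≠ 0) :
    (ofMatrix D M hM).IsCoordVec i l
      (∑ q, ((M.leading (D.d i))⁻¹ q ⟨l, hl⟩) • M.col q.1) := by
  refine ⟨mem_ofMatrix_sub.2 ⟨_, rfl⟩, fun p hp => ?_⟩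
  rw [sum_smul_col_apply]
  have h1 := congrFun (congrFun (Matrix.mul_nonsing_inv _ (isUnit_iff_ne_zero.2 h)) ⟨p, hp⟩) ⟨l, hl⟩
  rw [Matrix.mul_apply, Matrix.one_apply] at h1
  simpa [Subtype.ext_iff] using h1

/-- Cramer's rule makes the chart coordinates quotients of polynomials in the entries of the frame;
this is the source of their regularity. -/
theorem coordVec_ofMatrix {l : Fin n} (hl : (l : ℕ) < D.d i)
    (h : (M.leading (D.d i)).det ≠ 0) (p : Fin n) :
    (ofMatrix D M hM).coordVec i l p =
      (∑ q, M p q.1 * (M.leading (D.d i)).adjugate q ⟨l, hl⟩) / (M.leading (D.d i)).det := by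
  rw [((chart_ofMatrix_iff M hM i).2 h).coordVec_eq (isCoordVec_ofMatrix M hM hl h),
    sum_smul_col_apply, Finset.sum_div]
  refine Finset.sum_congr rfl fun q _ => ?_
  rw [Matrix.inv_def, Matrix.smul_apply, Ring.inverse_eq_inv', smul_eq_mul]
  field_simp

end frame

theorem Chart.isCoordVec (hE : E.Chart i) {l : Fin n} (hl : (l : ℕ) < D.d i) :
    E.IsCoordVec i l (E.coordVec i l) := by
  obtain ⟨M, hM, rfl⟩ := E.exists_ofMatrix_eq
  have h := isCoordVec_ofMatrix M hM hl ((chart_ofMatrix_iff M hM i).1 hE)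
  rwa [hE.coordVec_eq h]

theorem Chart.eq_sum (hE : E.Chart i) {v : Fin n → ℂ} (hv : v ∈ E.sub i) :
    v = ∑ l : {l : Fin n // (l : ℕ) < D.d i}, v l.1 • E.coordVec i l.1 := by
  refine hE.eq_of_eq_on hv
    (sum_mem fun l _ => Submodule.smul_mem _ _ (hE.isCoordVec l.2).1) fun p hp => ?_
  rw [Finset.sum_apply, Finset.sum_eq_single ⟨p, hp⟩]
  · simp [(hE.isCoordVec hp).2 p hp]
  · intro l _ hl
    have : p ≠ l.1 := fun h => hl (Subtype.ext h.symm)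
    simp [(hE.isCoordVec l.2).2 p hp, this]
  · simp

/-- The coordinate vectors span the member, so a flag in the chart can be recovered from the values
of regular functions. -/
theorem Chart.sub_eq {E' : PartialFlag D} (hE : E.Chart i) (hE' : E'.Chart i)
    (h : ∀ l : Fin n, (l : ℕ) < D.d i → E.coordVec i l = E'.coordVec i l) :
    E.sub i = E'.sub i := by
  refine Submodule.eq_of_le_of_finrank_eq (fun v hv => ?_)
    ((E.finrank_sub i).trans (E'.finrank_sub i).symm)
  rw [hE.eq_sum hv]
  refine sum_mem fun l _ => Submodule.smul_mem _ _ ?_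
  rw [h l.1 l.2]
  exact (hE'.isCoordVec l.2).1

end PartialFlag

/-! ### Unitriangular frames of complete flags -/

namespace PartialFlag

variable {n : ℕ}

/-- The frame of a complete flag given by a lower unitriangular matrix. -/
def normalFrame (F : CompleteFlag n) : Matrix (Fin n) (Fin n) ℂ :=
  Matrix.of fun p q => F.coordVec ⟨(q : ℕ) + 1, Nat.succ_lt_succ q.2⟩ q p

variable {F : CompleteFlag n}

/-- Column `q` comes from the member of dimension `q + 1`, so its first `q + 1` coordinates are
those of a unit vector. The matrix is lower unitriangular. -/
theorem det_normalFrame (hF : ∀ i, F.Chart i) : F.normalFrame.det = 1 := by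
  rw [Matrix.det_of_isLowerTriangular]
  · refine Finset.prod_eq_one fun q _ => ?_
    have h := ((hF ⟨(q : ℕ) + 1, Nat.succ_lt_succ q.2⟩).isCoordVec (l := q) (Nat.lt_succ_self _)).2
      q (Nat.lt_succ_self _)
    exact h.trans (if_pos rfl)
  · intro p q hpq
    have hpq' : p < q := hpq
    have h := ((hF ⟨(q : ℕ) + 1, Nat.succ_lt_succ q.2⟩).isCoordVec (l := q) (Nat.lt_succ_self _)).2
      p (Nat.lt_succ_of_lt hpq')
    rw [if_neg hpq'.ne] at h
    exact h

theorem isUnit_det_normalFrame (hF : ∀ i, F.Chart i) : IsUnit F.normalFrame.det := by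
  rw [det_normalFrame hF]
  exact isUnit_one

/-- A section of the quotient map from matrices to flags over the big cell. It gives a frame whose
entries are functions of the flag alone. -/
theorem ofMatrix_normalFrame (hF : ∀ i, F.Chart i) :
    ofMatrix (FlagType.complete n) F.normalFrame (isUnit_det_normalFrame hF) = F := by
  refine ofMatrix_eq_of_mem _ _ fun i l hl => ?_
  have h := ((hF ⟨(l : ℕ) + 1, Nat.succ_lt_succ l.2⟩).isCoordVec (l := l) (Nat.lt_succ_self _)).1
  refine F.mono ?_ h
  exact Nat.succ_le_of_lt hl

end PartialFlag

/-! ### Regularity of the chart coordinates -/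

namespace VarietyPresentation

attribute [local instance] zariski

variable {X : Type} [VarietyPresentation X] {n : ℕ} {D : FlagType n}

/-- The matrix `m` of polynomials is a frame of the flag `E x`, for all points `x` of `X`. -/
def IsFrame (E : X → PartialFlag D) (m : Matrix (Fin n) (Fin n) (Poly X)) : Prop :=
  ∀ s : frames (X := X), ∃ h : IsUnit (m.map (MvPolynomial.eval s.1)).det,
    E (point s) = PartialFlag.ofMatrix D _ h

variable {E : X → PartialFlag D} {m : Matrix (Fin n) (Fin n) (Poly X)}

theorem eval_det_leading (s : coord X → ℂ) (d : ℕ) :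
    MvPolynomial.eval s (m.leading d).det =
      ((m.map (MvPolynomial.eval s)).leading d).det := by
  rw [RingHom.map_det]
  rfl

theorem IsFrame.chart_iff (hE : IsFrame E m) (s : frames (X := X)) (i : Fin D.len) :
    (E (point s)).Chart i ↔ MvPolynomial.eval s.1 (m.leading (D.d i)).det ≠ 0 := by
  obtain ⟨h, hs⟩ := hE s
  rw [hs, PartialFlag.chart_ofMatrix_iff, eval_det_leading]

theorem IsFrame.isOpen_chart (hE : IsFrame E m) (i : Fin D.len) : IsOpen {x | (E x).Chart i} :=
  ⟨{(m.leading (D.d i)).det}, fun s => by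
    rw [Set.mem_ofPred_eq, hE.chart_iff]
    simp⟩

theorem IsFrame.regularOn_coordVec (hE : IsFrame E m) (i : Fin D.len) {l : Fin n}
    (hl : (l : ℕ) < D.d i) (p : Fin n) :
    RegularOn {x | (E x).Chart i} fun x => (E x).coordVec i l p := by
  intro s hs
  rw [Set.mem_ofPred_eq, hE.chart_iff] at hs
  refine ⟨∑ q, m p q.1 * (m.leading (D.d i)).adjugate q ⟨l, hl⟩, (m.leading (D.d i)).det, hs,
    fun t _ ht => ?_⟩
  obtain ⟨h, hs'⟩ := hE t
  rw [eval_det_leading] at ht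
  have hadj : ∀ q, MvPolynomial.eval t.1 ((m.leading (D.d i)).adjugate q ⟨l, hl⟩) =
      ((m.map (MvPolynomial.eval t.1)).leading (D.d i)).adjugate q ⟨l, hl⟩ := fun q => by
    have := RingHom.map_adjugate (MvPolynomial.eval t.1) (m.leading (D.d i))
    exact congrFun (congrFun this q) ⟨l, hl⟩
  change (E (point t)).coordVec i l p = _
  rw [hs', PartialFlag.coordVec_ofMatrix _ h hl ht, eval_det_leading, map_sum]
  simp only [map_mul, hadj, Matrix.map_apply]

end VarietyPresentation

end

noncomputable section

/-! ## The Schubert problem -/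

namespace DoubledSchubert

variable {r : ℕ} (a : Fin r → ℕ) (b : ℕ)

/-- The largest of `0` and the `a i` that is at most `v`. -/
def lo (v : ℕ) : ℕ := (insert 0 ((Finset.univ.filter fun i => a i ≤ v).image a)).max' (by simp)

/-- The smallest of `b` and the `a i` that is larger than `v`. -/
def hi (v : ℕ) : ℕ := (insert b ((Finset.univ.filter fun i => v < a i).image a)).min' (by simp)

variable {a b}

theorem le_lo {v : ℕ} {i : Fin r} (h : a i ≤ v) : a i ≤ lo a v := by
  refine Finset.le_max' _ _ (Finset.mem_insert_of_mem (Finset.mem_image_of_mem _ ?_))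
  simpa using h

theorem lo_eq (v : ℕ) : lo a v = 0 ∨ ∃ i, a i ≤ v ∧ lo a v = a i := by
  have h := Finset.max'_mem (insert 0 ((Finset.univ.filter fun i => a i ≤ v).image a)) (by simp)
  rcases Finset.mem_insert.1 h with h | h
  · exact Or.inl h
  · obtain ⟨i, hi, h⟩ := Finset.mem_image.1 h
    exact Or.inr ⟨i, by simpa using hi, h.symm⟩

theorem lo_le (v : ℕ) : lo a v ≤ v := by
  rcases lo_eq (a := a) v with h | ⟨i, hi, h⟩
  · omega
  · omega

theorem lo_mono {v v' : ℕ} (h : v ≤ v') : lo a v ≤ lo a v' := by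
  rcases lo_eq (a := a) v with h' | ⟨i, hi, h'⟩
  · omega
  · rw [h']
    exact le_lo (hi.trans h)

theorem hi_le {v : ℕ} {i : Fin r} (h : v < a i) : hi a b v ≤ a i := by
  refine Finset.min'_le _ _ (Finset.mem_insert_of_mem (Finset.mem_image_of_mem _ ?_))
  simpa using h

theorem hi_eq (v : ℕ) : hi a b v = b ∨ ∃ i, v < a i ∧ hi a b v = a i := by
  have h := Finset.min'_mem (insert b ((Finset.univ.filter fun i => v < a i).image a)) (by simp)
  rcases Finset.mem_insert.1 h with h | h
  · exact Or.inl h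
  · obtain ⟨i, hi, h⟩ := Finset.mem_image.1 h
    exact Or.inr ⟨i, by simpa using hi, h.symm⟩

theorem hi_le_right (v : ℕ) : hi a b v ≤ b := Finset.min'_le _ _ (by simp)

theorem lt_hi {v : ℕ} (h : v < b) : v < hi a b v := by
  rcases hi_eq (a := a) (b := b) v with h' | ⟨i, hi, h'⟩
  · omega
  · omega

theorem hi_mono {v v' : ℕ} (h : v ≤ v') : hi a b v ≤ hi a b v' := by
  rcases hi_eq (a := a) (b := b) v' with h' | ⟨i, hi, h'⟩
  · rw [h']
    exact hi_le_right v
  · rw [h']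
    exact hi_le (h.trans_lt hi)

/-- Together with `low_lt_high`, this says that the large value `b + v` precedes the small value
`v'` exactly when some `a i` separates `v` from `v'`. -/
theorem high_lt_low {v v' : ℕ} {i : Fin r} (h : v < a i) (h' : a i ≤ v') :
    v + hi a b v < v' + lo a v' := by
  have := hi_le (b := b) h
  have := le_lo h'
  omega

theorem low_lt_high {v v' : ℕ} (hv : v < b) (hv' : v' < b) (h : ¬ ∃ i, v < a i ∧ a i ≤ v') :
    v' + lo a v' < v + hi a b v := by
  have h3 := lt_hi (a := a) hv
  have h4 := lo_le (a := a) v'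
  rcases le_or_gt v' v with hle | hlt
  · omega
  · have h1 : v' < hi a b v := by
      rcases hi_eq (a := a) (b := b) v with h' | ⟨i, hi, h'⟩
      · omega
      · by_contra hc
        exact h ⟨i, hi, by omega⟩
    have h2 : lo a v' ≤ v := by
      rcases lo_eq (a := a) v' with h' | ⟨i, hi, h'⟩
      · omega
      · by_contra hc
        exact h ⟨i, by omega, hi⟩
    omega

/-- The splitting of `2b` positions into the first `b` and the last `b`. -/
def _root_.halves (b : ℕ) : Fin b ⊕ Fin b ≃ Fin (2 * b) :=
  finSumFinEquiv.trans (finCongr (two_mul b).symm)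

@[simp] theorem _root_.halves_inl (b : ℕ) (v : Fin b) : (halves b (Sum.inl v) : ℕ) = v := by
  simp [halves]

@[simp] theorem _root_.halves_inr (b : ℕ) (v : Fin b) : (halves b (Sum.inr v) : ℕ) = b + v := by
  simp [halves, add_comm]

variable (a b)

/-- The positions of the values of the Schubert condition. -/
def position : Fin b ⊕ Fin b → Fin (2 * b)
  | Sum.inl v => ⟨v + lo a v, by have := lo_le (a := a) v; omega⟩
  | Sum.inr v => ⟨v + hi a b v, by have := hi_le_right (a := a) (b := b) v; omega⟩

variable {a b}

/-- Small values occur in increasing order, and so do large ones; a small and a large value are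
compared by `high_lt_low` and `low_lt_high`. -/
theorem position_injective : Function.Injective (position a b) := by
  have hlow : ∀ v v' : Fin b, v < v' → (v : ℕ) + lo a v < v' + lo a v' := fun v v' h => by
    have := lo_mono (a := a) (Fin.val_fin_le.2 h.le)
    have : (v : ℕ) < v' := h
    omega
  have hhigh : ∀ v v' : Fin b, v < v' → (v : ℕ) + hi a b v < v' + hi a b v' := fun v v' h => by
    have := hi_mono (a := a) (b := b) (Fin.val_fin_le.2 h.le)
    have : (v : ℕ) < v' := h
    omega
  have hmix : ∀ v v' : Fin b, (v : ℕ) + hi a b v ≠ v' + lo a v' := fun v v' => by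
    by_cases h : ∃ i, (v : ℕ) < a i ∧ a i ≤ v'
    · obtain ⟨i, h1, h2⟩ := h
      exact (high_lt_low h1 h2).ne
    · exact (low_lt_high v.2 v'.2 h).ne'
  rintro (v | v) (v' | v') h <;> simp only [position, Fin.mk.injEq] at h
  · rcases lt_trichotomy v v' with h1 | h1 | h1
    · exact absurd h (hlow _ _ h1).ne
    · rw [h1]
    · exact absurd h (hlow _ _ h1).ne'
  · exact absurd h.symm (hmix _ _)
  · exact absurd h (hmix _ _)
  · rcases lt_trichotomy v v' with h1 | h1 | h1
    · exact absurd h (hhigh _ _ h1).ne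
    · rw [h1]
    · exact absurd h (hhigh _ _ h1).ne'

variable (a b)

/-- The positions as a bijection. -/
def positionEquiv : Fin b ⊕ Fin b ≃ Fin (2 * b) :=
  Equiv.ofBijective (position a b) <|
    (Fintype.bijective_iff_injective_and_card _).2 ⟨position_injective, by simp [two_mul]⟩

/-- The permutation defining the Schubert condition. -/
def perm : Equiv.Perm (Fin (2 * b)) := (positionEquiv a b).symm.trans (halves b)

variable {a b}

@[simp] theorem perm_position (x : Fin b ⊕ Fin b) :
    perm a b (position a b x) = halves b x := by
  have : (positionEquiv a b).symm (position a b x) = x := (positionEquiv a b).symm_apply_apply x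
  simp [perm, this]

theorem exists_position (p : Fin (2 * b)) : ∃ x, position a b x = p :=
  (positionEquiv a b).surjective p

/-- Values in the same half occur in increasing order, so an inversion can only be a large value
before a small one. -/
theorem inversion_iff (x y : Fin b ⊕ Fin b) :
    (position a b x < position a b y ∧ halves b y < halves b x) ↔
      ∃ v v', x = Sum.inr v ∧ y = Sum.inl v' ∧ ∃ i, (v : ℕ) < a i ∧ a i ≤ v' := by
  constructor
  · rintro ⟨h1, h2⟩
    rw [Fin.lt_def] at h1 h2
    rcases x with v | v <;> rcases y with v' | v' <;>
      simp only [position, halves_inl, halves_inr] at h1 h2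
    · have := lo_mono (a := a) h2.le
      omega
    · omega
    · refine ⟨v, v', rfl, rfl, ?_⟩
      by_contra hc
      have := low_lt_high v.2 v'.2 hc
      omega
    · have := hi_mono (a := a) (b := b) (Nat.add_lt_add_iff_left.1 h2).le
      omega
  · rintro ⟨v, v', rfl, rfl, i, h1, h2⟩
    rw [Fin.lt_def, Fin.lt_def]
    have := high_lt_low (b := b) h1 h2
    simp only [position, halves_inl, halves_inr]
    omega

/-- The right-hand side is the dimension of the manifold of flags of type `a` in ℂ^b. -/
theorem inversionNumber_perm : inversionNumber (perm a b) =
    Fintype.card {p : Fin b × Fin b // ∃ i, (p.1 : ℕ) < a i ∧ a i ≤ (p.2 : ℕ)} := by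
  refine (Fintype.card_congr (Equiv.ofBijective (fun p => ⟨(position a b (Sum.inr p.1.1),
    position a b (Sum.inl p.1.2)), by
      simpa using (inversion_iff (Sum.inr p.1.1) (Sum.inl p.1.2)).2 ⟨_, _, rfl, rfl, p.2⟩⟩)
    ⟨?_, ?_⟩)).symm
  · rintro ⟨⟨v, v'⟩, h⟩ ⟨⟨u, u'⟩, h'⟩ heq
    simp only [Subtype.mk.injEq, Prod.mk.injEq] at heq ⊢
    exact ⟨Sum.inr_injective (position_injective heq.1),
      Sum.inl_injective (position_injective heq.2)⟩
  · rintro ⟨⟨p, p'⟩, h⟩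
    obtain ⟨x, rfl⟩ := exists_position (a := a) p
    obtain ⟨y, rfl⟩ := exists_position (a := a) p'
    simp only [perm_position] at h
    obtain ⟨v, v', rfl, rfl, h3⟩ := (inversion_iff x y).1 h
    exact ⟨⟨(v, v'), h3⟩, rfl⟩

/-- Halving both entries of a separated pair in [2b] gives a separated pair in [b], and the two
parities are free. This is the factor 4. -/
theorem manifoldDim_doubledType (ha : StrictMono a) (hab : ∀ i, a i < b) :
    (doubledType a ha hab).manifoldDim =
      4 * Fintype.card {p : Fin b × Fin b // ∃ i, (p.1 : ℕ) < a i ∧ a i ≤ (p.2 : ℕ)} := by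
  have hc : Fintype.card ({p : Fin b × Fin b // ∃ i, (p.1 : ℕ) < a i ∧ a i ≤ (p.2 : ℕ)} ×
      (Fin 2 × Fin 2)) =
      4 * Fintype.card {p : Fin b × Fin b // ∃ i, (p.1 : ℕ) < a i ∧ a i ≤ (p.2 : ℕ)} := by
    rw [Fintype.card_prod, Fintype.card_prod, Fintype.card_fin, mul_comm]
  rw [← hc]
  refine (Fintype.card_congr (Equiv.ofBijective (fun p =>
    ⟨(⟨2 * p.1.1.1 + p.2.1, by omega⟩, ⟨2 * p.1.1.2 + p.2.2, by omega⟩), by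
      obtain ⟨i, h1, h2⟩ := p.1.2
      refine ⟨i, ?_, ?_⟩ <;> simp only [doubledType] <;> omega⟩) ⟨?_, ?_⟩)).symm
  · rintro ⟨⟨⟨v, v'⟩, h⟩, x, x'⟩ ⟨⟨⟨u, u'⟩, h'⟩, y, y'⟩ heq
    simp only [Subtype.mk.injEq, Prod.mk.injEq, Fin.ext_iff] at heq ⊢
    omega
  · rintro ⟨⟨p, p'⟩, i, h1, h2⟩
    simp only [doubledType] at h1 h2
    refine ⟨⟨⟨(⟨p / 2, by omega⟩, ⟨p' / 2, by omega⟩), i, ?_, ?_⟩, ⟨p % 2, by omega⟩,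
      ⟨p' % 2, by omega⟩⟩, ?_⟩
    · change (p : ℕ) / 2 < a i
      omega
    · change a i ≤ (p' : ℕ) / 2
      omega
    · simp only [Subtype.mk.injEq, Prod.mk.injEq, Fin.ext_iff]
      omega

/-- A descent is an inversion at adjacent positions. The separating `a i` puts the large value
before position `2 * a i` and the small value at or after it, so the second position equals `2 * a
i`. -/
theorem perm_descents (ha : StrictMono a) (hab : ∀ i, a i < b) (k l : Fin (2 * b))
    (hl : (l : ℕ) = k + 1) (hw : perm a b l < perm a b k) :
    ∃ i, (doubledType a ha hab).d i = l := by
  obtain ⟨x, rfl⟩ := exists_position (a := a) k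
  obtain ⟨y, rfl⟩ := exists_position (a := a) l
  rw [perm_position, perm_position] at hw
  obtain ⟨v, v', rfl, rfl, i, h1, h2⟩ :=
    (inversion_iff (a := a) x y).1 ⟨by rw [Fin.lt_def]; omega, hw⟩
  simp only [position] at hl
  have h3 := lt_hi (a := a) v.2
  have h4 := hi_le (b := b) h1
  have h5 := le_lo h2
  have h6 := lo_le (a := a) v'
  refine ⟨i, ?_⟩
  simp only [doubledType, position]
  omega

variable (b) in
/-- The Schubert problem given by four copies of the Schubert condition. -/
def problem (ha : StrictMono a) (hab : ∀ i, a i < b) :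
    SchubertProblem (doubledType a ha hab) 4 where
  w _ := perm a b
  descents _ := perm_descents ha hab
  sum_codim := by
    rw [manifoldDim_doubledType, Finset.sum_const, inversionNumber_perm]
    simp

theorem position_lt_iff (i : Fin r) (x : Fin b ⊕ Fin b) :
    (position a b x : ℕ) < 2 * a i ↔ (Sum.elim Fin.val Fin.val x : ℕ) < a i := by
  rcases x with v | v <;> simp only [position, Sum.elim_inl, Sum.elim_inr]
  · constructor
    · intro h
      by_contra hc
      have := le_lo (not_lt.1 hc)
      omega
    · intro h
      have := lo_le (a := a) v
      omega
  · constructor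
    · intro h
      have := lt_hi (a := a) v.2
      omega
    · intro h
      have := hi_le (b := b) h
      omega

theorem card_between (c d : ℕ) (hd : d ≤ b) :
    Fintype.card {v : Fin b // (v : ℕ) < d ∧ c ≤ v} = d - c := by
  rw [← Nat.card_Ico, ← Fintype.card_coe]
  refine Fintype.card_congr ⟨fun v => ⟨v.1, by simp [v.2.1, v.2.2]⟩,
    fun v => ⟨⟨v.1, (Finset.mem_Ico.1 v.2).2.trans_le hd⟩, (Finset.mem_Ico.1 v.2).2,
      (Finset.mem_Ico.1 v.2).1⟩, fun _ => rfl, fun _ => rfl⟩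

/-- The two summands count small and large values, with truncated subtraction. At `q = b` the first
is 0 and the second is `a i`. -/
theorem card_condition (i : Fin r) (hab : a i < b) (q : ℕ) :
    Fintype.card {l : Fin (2 * b) // (l : ℕ) < 2 * a i ∧ 2 * b ≤ (perm a b l : ℕ) + q} =
      (a i - (2 * b - q)) + (a i - (b - q)) := by
  rw [← card_between (b := b) (2 * b - q) (a i) hab.le,
    ← card_between (b := b) (b - q) (a i) hab.le,
    ← Fintype.card_sum]
  refine Fintype.card_congr ?_
  refine Equiv.trans ?_ (Equiv.subtypeSum (p := fun x : Fin b ⊕ Fin b =>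
    (Sum.elim Fin.val Fin.val x : ℕ) < a i ∧ Sum.elim (fun v : Fin b => 2 * b - q ≤ v)
      (fun v : Fin b => b - q ≤ v) x))
  refine ((positionEquiv a b).subtypeEquiv fun x => ?_).symm
  have hx : positionEquiv a b x = position a b x := rfl
  rw [hx, position_lt_iff i, perm_position]
  refine and_congr_right fun _ => ?_
  rcases x with v | v <;> simp only [Sum.elim_inl, Sum.elim_inr, halves_inl, halves_inr] <;> omega

/-- The rank conditions at `q = b` are the stated inequalities; all the others follow from them by
dimension counts. -/
theorem mem_solutions_iff (ha : StrictMono a) (hab : ∀ i, a i < b) (F : FlagTuple (2 * b) 4)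
    (E : PartialFlag (doubledType a ha hab)) :
    E ∈ (problem b ha hab).solutions F ↔
      ∀ (i : Fin r) (j : Fin 4), a i ≤ Module.finrank ℂ ↥(E.sub i ⊓ middle F j) := by
  constructor
  · intro h i j
    refine le_trans ?_ (h j i ⟨b, by omega⟩)
    refine le_of_le_of_eq ?_ (card_condition (b := b) i (hab i) b).symm
    omega
  · intro h j i q
    refine le_of_eq_of_le (card_condition (b := b) i (hab i) q) ?_
    have hE : Module.finrank ℂ (E.sub i) = 2 * a i := E.finrank_sub i
    have hFq : Module.finrank ℂ ((F j).sub q) = q := (F j).finrank_sub q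
    have hFb : Module.finrank ℂ (middle F j) = b := (F j).finrank_sub _
    have hq := q.2
    have hi := h i j
    have hai := hab i
    -- For `q ≤ b`, passing from K^j to its subspace of codimension `b - q` lowers the intersection
    -- by at most `b - q`. For `q ≥ b`, one uses either the intersection with K^j or the dimension
    -- formula in ℂ^{2b}.
    rcases le_total (q : ℕ) b with hqb | hqb
    · have hle : (F j).sub q ≤ middle F j := (F j).mono hqb
      have h1 := Submodule.finrank_sup_add_finrank_inf_eq (E.sub i ⊓ middle F j) ((F j).sub q)
      have h2 : Module.finrank ℂ ↥((E.sub i ⊓ middle F j) ⊔ (F j).sub q) ≤ b :=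
        (Submodule.finrank_mono (sup_le inf_le_right hle)).trans_eq hFb
      rw [inf_assoc, inf_eq_right.2 hle] at h1
      omega
    · have hle : middle F j ≤ (F j).sub q := (F j).mono hqb
      have h1 := Submodule.finrank_sup_add_finrank_inf_eq (E.sub i) ((F j).sub q)
      have h2 : Module.finrank ℂ ↥(E.sub i ⊔ (F j).sub q) ≤ 2 * b :=
        (Submodule.finrank_le _).trans_eq (Module.finrank_fin_fun ℂ)
      have h3 := Submodule.finrank_mono (inf_le_inf_left (E.sub i) hle)
      omega

end DoubledSchubert

end

noncomputable section

/-! ## Subspaces meeting a graph -/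

section graph

variable {V : Type} [AddCommGroup V] [Module ℂ V] {K₁ K₂ : Submodule ℂ V}

/-- The map `x ↦ x + f x` onto the graph of `f`. -/
def graphMap (f : K₁ ≃ₗ[ℂ] K₂) : K₁ →ₗ[ℂ] V := K₁.subtype + K₂.subtype ∘ₗ f.toLinearMap

@[simp] theorem graphMap_apply (f : K₁ ≃ₗ[ℂ] K₂) (x : K₁) : graphMap f x = (x : V) + f x := rfl

theorem eq_and_eq_of_add_eq (h : Disjoint K₁ K₂) {x x' : K₁} {y y' : K₂}
    (e : (x : V) + y = x' + y') : x = x' ∧ y = y' := by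
  have e1 : ((x - x' : K₁) : V) = ((y' - y : K₂) : V) := by
    rw [AddSubgroupClass.coe_sub, AddSubgroupClass.coe_sub, sub_eq_sub_iff_add_eq_add, e, add_comm]
  have h0 : ((x - x' : K₁) : V) = 0 :=
    Submodule.disjoint_def.1 h _ (x - x').2 (by rw [e1]; exact (y' - y).2)
  have h1 := h0
  rw [e1] at h1
  exact ⟨sub_eq_zero.1 (Subtype.ext h0), (sub_eq_zero.1 (Subtype.ext h1)).symm⟩

theorem graphMap_injective (h : Disjoint K₁ K₂) (f : K₁ ≃ₗ[ℂ] K₂) :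
    Function.Injective (graphMap f) := fun _ _ e => (eq_and_eq_of_add_eq h e).1

theorem IsGraphOf.eq_range {f : K₁ ≃ₗ[ℂ] K₂} {K : Submodule ℂ V} (hK : IsGraphOf f K) :
    K = LinearMap.range (graphMap f) := by
  ext v
  rw [hK v, LinearMap.mem_range]
  exact ⟨fun ⟨x, h⟩ => ⟨x, h.symm⟩, fun ⟨x, h⟩ => ⟨x, h.symm⟩⟩

theorem isGraphOf_range (f : K₁ ≃ₗ[ℂ] K₂) : IsGraphOf f (LinearMap.range (graphMap f)) :=
  fun _ => ⟨fun ⟨x, h⟩ => ⟨x, h.symm⟩, fun ⟨x, h⟩ => ⟨x, h.symm⟩⟩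

/-- The subspace `L ⊕ f L`. -/
def directSum (f : K₁ ≃ₗ[ℂ] K₂) (L : Submodule ℂ K₁) : Submodule ℂ V :=
  L.map K₁.subtype ⊔ (L.map f.toLinearMap).map K₂.subtype

theorem mem_directSum {f : K₁ ≃ₗ[ℂ] K₂} {L : Submodule ℂ K₁} {v : V} :
    v ∈ directSum f L ↔ ∃ x ∈ L, ∃ y ∈ L, (x : V) + f y = v := by
  simp only [directSum, Submodule.mem_sup, Submodule.mem_map]
  constructor
  · rintro ⟨_, ⟨x, hx, rfl⟩, _, ⟨_, ⟨y, hy, rfl⟩, rfl⟩, rfl⟩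
    exact ⟨x, hx, y, hy, rfl⟩
  · rintro ⟨x, hx, y, hy, rfl⟩
    exact ⟨_, ⟨x, hx, rfl⟩, _, ⟨_, ⟨y, hy, rfl⟩, rfl⟩, rfl⟩

theorem comap_directSum (h : Disjoint K₁ K₂) (f : K₁ ≃ₗ[ℂ] K₂) (L : Submodule ℂ K₁) :
    (directSum f L).comap K₁.subtype = L := by
  ext x
  rw [Submodule.mem_comap, mem_directSum]
  constructor
  · rintro ⟨y, hy, z, hz, e⟩
    have e' : (y : V) + f z = (x : V) + (0 : K₂) := by simpa using e
    rwa [← (eq_and_eq_of_add_eq h e').1]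
  · intro hx
    exact ⟨x, hx, 0, L.zero_mem, by simp⟩

set_option linter.unusedSectionVars false

variable [FiniteDimensional ℂ V]

theorem finrank_directSum (h : Disjoint K₁ K₂) (f : K₁ ≃ₗ[ℂ] K₂) (L : Submodule ℂ K₁) :
    Module.finrank ℂ (directSum f L) = 2 * Module.finrank ℂ L := by
  have h1 := Submodule.finrank_sup_add_finrank_inf_eq (L.map K₁.subtype)
    ((L.map f.toLinearMap).map K₂.subtype)
  have h2 : L.map K₁.subtype ⊓ (L.map f.toLinearMap).map K₂.subtype = ⊥ :=
    (h.mono (Submodule.map_subtype_le _ _) (Submodule.map_subtype_le _ _)).eq_bot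
  rw [h2, finrank_bot, Submodule.finrank_map_subtype_eq, Submodule.finrank_map_subtype_eq,
    LinearEquiv.finrank_map_eq] at h1
  change Module.finrank ℂ ↥(L.map K₁.subtype ⊔ (L.map f.toLinearMap).map K₂.subtype) = _
  omega

theorem finrank_le_directSum_inf_left (f : K₁ ≃ₗ[ℂ] K₂) (L : Submodule ℂ K₁) :
    Module.finrank ℂ L ≤ Module.finrank ℂ ↥(directSum f L ⊓ K₁) := by
  rw [← Submodule.finrank_map_subtype_eq K₁ L]
  exact Submodule.finrank_mono (le_inf le_sup_left (Submodule.map_subtype_le _ _))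

theorem finrank_le_directSum_inf_right (f : K₁ ≃ₗ[ℂ] K₂) (L : Submodule ℂ K₁) :
    Module.finrank ℂ L ≤ Module.finrank ℂ ↥(directSum f L ⊓ K₂) := by
  rw [← LinearEquiv.finrank_map_eq f L, ← Submodule.finrank_map_subtype_eq K₂ (L.map _)]
  exact Submodule.finrank_mono (le_inf le_sup_right (Submodule.map_subtype_le _ _))

/-- The injective map `x ↦ x + g x` carries `L` into the intersection, because `g x` lies in `f L`.
-/
theorem finrank_le_directSum_inf_graph (h : Disjoint K₁ K₂) {f g : K₁ ≃ₗ[ℂ] K₂}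
    {K : Submodule ℂ V} (hK : IsGraphOf g K) (L : Submodule ℂ K₁)
    (hL : L.map g.toLinearMap = L.map f.toLinearMap) :
    Module.finrank ℂ L ≤ Module.finrank ℂ ↥(directSum f L ⊓ K) := by
  rw [LinearEquiv.finrank_eq (Submodule.equivMapOfInjective _ (graphMap_injective h g) L)]
  refine Submodule.finrank_mono (le_inf ?_ ?_)
  · rintro _ ⟨x, hx, rfl⟩
    have : g x ∈ L.map f.toLinearMap := hL ▸ Submodule.mem_map_of_mem hx
    obtain ⟨y, hy, e⟩ := this
    exact mem_directSum.2 ⟨x, hx, y, hy, by rw [graphMap_apply, ← e]; rfl⟩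
  · rw [hK.eq_range]
    exact LinearMap.map_le_range

/-! ### Subspaces with large intersections with two complements and a graph -/

section solution

variable {E : Submodule ℂ V} {a : ℕ}

theorem finrank_comap_subtype (E K : Submodule ℂ V) :
    Module.finrank ℂ (E.comap K.subtype) = Module.finrank ℂ ↥(E ⊓ K) := by
  rw [← Submodule.finrank_map_subtype_eq K, Submodule.map_comap_subtype, inf_comm]

/-- The two intersections are independent inside `E`, and their dimensions add up to at least `2 *
a`; hence they fill `E`. -/
theorem solution_decomposition (h : Disjoint K₁ K₂) (hE : Module.finrank ℂ E = 2 * a)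
    (h₁ : a ≤ Module.finrank ℂ ↥(E ⊓ K₁)) (h₂ : a ≤ Module.finrank ℂ ↥(E ⊓ K₂)) :
    Module.finrank ℂ (E.comap K₁.subtype) = a ∧ Module.finrank ℂ (E.comap K₂.subtype) = a ∧
      E = E ⊓ K₁ ⊔ E ⊓ K₂ := by
  have h3 := Submodule.finrank_sup_add_finrank_inf_eq (E ⊓ K₁) (E ⊓ K₂)
  rw [(h.mono inf_le_right inf_le_right).eq_bot, finrank_bot] at h3
  have hle : E ⊓ K₁ ⊔ E ⊓ K₂ ≤ E := sup_le inf_le_left inf_le_left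
  have h4 := Submodule.finrank_mono hle
  rw [finrank_comap_subtype, finrank_comap_subtype]
  refine ⟨by omega, by omega, (Submodule.eq_of_le_of_finrank_eq hle (by omega)).symm⟩

/-- A vector `x + f x` of `E` has both components in `E`, by uniqueness of the decomposition. Thus
`E ⊓ K` is at most as large as `L ⊓ f⁻¹ L₂`, and dimension `a` leaves no room for a proper subspace
of `L`. -/
theorem solution_map_eq (h : Disjoint K₁ K₂) (hE : Module.finrank ℂ E = 2 * a)
    (h₁ : a ≤ Module.finrank ℂ ↥(E ⊓ K₁)) (h₂ : a ≤ Module.finrank ℂ ↥(E ⊓ K₂))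
    {f : K₁ ≃ₗ[ℂ] K₂} {K : Submodule ℂ V} (hK : IsGraphOf f K)
    (h₃ : a ≤ Module.finrank ℂ ↥(E ⊓ K)) :
    (E.comap K₁.subtype).map f.toLinearMap = E.comap K₂.subtype := by
  obtain ⟨d1, d2, hsup⟩ := solution_decomposition h hE h₁ h₂
  set L := E.comap K₁.subtype with hL
  set L₂ := E.comap K₂.subtype with hL₂
  have hle : E ⊓ K ≤ (L ⊓ L₂.comap f.toLinearMap).map (graphMap f) := by
    rintro v ⟨hvE, hvK⟩
    obtain ⟨x, rfl⟩ := (hK v).1 hvK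
    rw [SetLike.mem_coe, hsup] at hvE
    obtain ⟨y, hy, z, hz, e⟩ := Submodule.mem_sup.1 hvE
    obtain ⟨e1, e2⟩ := eq_and_eq_of_add_eq h (x := ⟨y, hy.2⟩) (y := ⟨z, hz.2⟩) e
    refine ⟨x, ⟨?_, ?_⟩, rfl⟩
    · rw [← e1]
      exact hy.1
    · change K₂.subtype (f x) ∈ E
      rw [← e2]
      exact hz.1
  have h5 := h₃.trans (Submodule.finrank_mono hle)
  rw [← LinearEquiv.finrank_eq (Submodule.equivMapOfInjective _ (graphMap_injective h f) _)] at h5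
  have h6 : L ⊓ L₂.comap f.toLinearMap = L :=
    Submodule.eq_of_le_of_finrank_le inf_le_left (by rw [d1]; exact h5)
  refine Submodule.eq_of_le_of_finrank_eq (Submodule.map_le_iff_le_comap.2 (inf_eq_left.1 h6)) ?_
  rw [LinearEquiv.finrank_map_eq, d1, d2]

theorem solution_eq_directSum (h : Disjoint K₁ K₂) (hE : Module.finrank ℂ E = 2 * a)
    (h₁ : a ≤ Module.finrank ℂ ↥(E ⊓ K₁)) (h₂ : a ≤ Module.finrank ℂ ↥(E ⊓ K₂))
    {f : K₁ ≃ₗ[ℂ] K₂} {K : Submodule ℂ V} (hK : IsGraphOf f K)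
    (h₃ : a ≤ Module.finrank ℂ ↥(E ⊓ K)) : directSum f (E.comap K₁.subtype) = E := by
  obtain ⟨-, -, hsup⟩ := solution_decomposition h hE h₁ h₂
  rw [directSum, solution_map_eq h hE h₁ h₂ hK h₃, Submodule.map_comap_subtype,
    Submodule.map_comap_subtype, inf_comm K₁, inf_comm K₂, ← hsup]

end solution

end graph

/-! ## Stable subspaces of an operator with distinct eigenvalues -/

section stable

variable {K : Type*} [AddCommGroup K] [Module ℂ K] {b : ℕ} (v : Module.Basis (Fin b) ℂ K)

theorem map_aeval_mem {φ : K →ₗ[ℂ] K} {L : Submodule ℂ K} (hL : ∀ x ∈ L, φ x ∈ L)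
    (p : Polynomial ℂ) {x : K} (hx : x ∈ L) : Polynomial.aeval φ p x ∈ L := by
  induction p using Polynomial.induction_on' with
  | add p q hp hq => rw [map_add]; exact L.add_mem hp hq
  | monomial n c =>
    rw [Polynomial.aeval_monomial]
    refine L.smul_mem c ?_
    induction n with
    | zero => exact hx
    | succ n ih => rw [pow_succ']; exact hL _ ih

/-- The Lagrange polynomial at `μ t`, evaluated at `φ`, is the projection to the line of `v t`, and
it preserves every stable subspace. -/
theorem basis_mem_of_stable {φ : K →ₗ[ℂ] K} {μ : Fin b → ℂ} (hμ : Function.Injective μ)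
    (hφ : ∀ t, φ (v t) = μ t • v t) {L : Submodule ℂ K} (hL : ∀ x ∈ L, φ x ∈ L) {x : K}
    (hx : x ∈ L) {t : Fin b} (ht : v.repr x t ≠ 0) : v t ∈ L := by
  have heig : ∀ (p : Polynomial ℂ) s, Polynomial.aeval φ p (v s) = p.eval (μ s) • v s :=
    fun p s => Module.End.aeval_apply_of_hasEigenvector
      ⟨Module.End.mem_eigenspace_iff.2 (hφ s), v.ne_zero s⟩
  have h := map_aeval_mem hL (Lagrange.basis Finset.univ μ t) hx
  rw [← v.sum_repr x, map_sum] at h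
  rw [Finset.sum_eq_single t] at h
  · rw [map_smul, heig, Lagrange.eval_basis_self hμ.injOn (Finset.mem_univ t), one_smul] at h
    exact (L.smul_mem_iff ht).1 h
  · intro s _ hs
    rw [map_smul, heig, Lagrange.eval_basis_of_ne hs.symm (Finset.mem_univ s), zero_smul, smul_zero]
  · simp

theorem basis_mem_span_image_iff {T : Set (Fin b)} {t : Fin b} :
    v t ∈ Submodule.span ℂ (v '' T) ↔ t ∈ T :=
  ⟨fun h => by
    by_contra ht
    exact v.linearIndependent.notMem_span_image ht h,
    fun h => Submodule.subset_span ⟨t, h, rfl⟩⟩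

theorem span_basis_of_stable {φ : K →ₗ[ℂ] K} {μ : Fin b → ℂ} (hμ : Function.Injective μ)
    (hφ : ∀ t, φ (v t) = μ t • v t) {L : Submodule ℂ K} (hL : ∀ x ∈ L, φ x ∈ L) :
    Submodule.span ℂ (v '' {t | v t ∈ L}) = L := by
  refine le_antisymm (Submodule.span_le.2 ?_) fun x hx => ?_
  · rintro _ ⟨t, ht, rfl⟩
    exact ht
  · rw [← v.sum_repr x]
    refine sum_mem fun t _ => ?_
    by_cases ht : v.repr x t = 0
    · rw [ht, zero_smul]
      exact Submodule.zero_mem _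
    · exact Submodule.smul_mem _ _
        (Submodule.subset_span ⟨t, basis_mem_of_stable v hμ hφ hL hx ht, rfl⟩)

theorem finrank_span_basis_image (T : Finset (Fin b)) :
    Module.finrank ℂ (Submodule.span ℂ (v '' (T : Set (Fin b)))) = T.card := by
  classical
  rw [← Finset.coe_image, finrank_span_finset_eq_card, Finset.card_image_of_injective _ v.injective]
  rw [Finset.coe_image]
  exact v.linearIndependent.linearIndepOn_id.mono (Set.image_subset_range _ _)

end stable

/-- Flags of subsets correspond to stable flags. -/
theorem exists_subsetFlag_equiv {r b : ℕ} (a : Fin r → ℕ) {K : Type} [AddCommGroup K] [Module ℂ K]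
    (v : Module.Basis (Fin b) ℂ K) (φ : K ≃ₗ[ℂ] K) {μ : Fin b → ℂ} (hμ : Function.Injective μ)
    (hφ : ∀ t, φ (v t) = μ t • v t) :
    ∃ Ψ : SubsetFlag a b ≃ StableFlag a φ,
      ∀ T i, (Ψ T).1 i = Submodule.span ℂ (v '' (T.1 i : Set (Fin b))) := by
  classical
  have hfin : FiniteDimensional ℂ K := v.finiteDimensional_of_finite
  have hmap : ∀ T : Set (Fin b), (Submodule.span ℂ (v '' T)).map φ.toLinearMap =
      Submodule.span ℂ (v '' T) := fun T => by
    refine Submodule.eq_of_le_of_finrank_eq ?_ (LinearEquiv.finrank_map_eq φ _)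
    rw [Submodule.map_span, Submodule.span_le]
    rintro _ ⟨_, ⟨t, ht, rfl⟩, rfl⟩
    have : φ.toLinearMap (v t) = μ t • v t := hφ t
    rw [SetLike.mem_coe, this]
    exact Submodule.smul_mem _ _ (Submodule.subset_span ⟨t, ht, rfl⟩)
  refine ⟨Equiv.ofBijective (fun T => ⟨fun i => Submodule.span ℂ (v '' (T.1 i : Set (Fin b))),
    fun i j hij => Submodule.span_mono (Set.image_mono (Finset.coe_subset.2 (T.2.1 hij))),
    fun i => ⟨(finrank_span_basis_image v _).trans (T.2.2 i), hmap _⟩⟩) ⟨?_, ?_⟩, fun _ _ => rfl⟩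
  · intro T T' h
    refine Subtype.ext (funext fun i => Finset.ext fun t => ?_)
    have h' := congrFun (congrArg Subtype.val h) i
    dsimp only at h'
    rw [← Finset.mem_coe, ← basis_mem_span_image_iff v, h', basis_mem_span_image_iff v,
      Finset.mem_coe]
  · rintro ⟨L, hL, hL'⟩
    have hspan : ∀ i, Submodule.span ℂ
        (v '' ((Finset.univ.filter fun t => v t ∈ L i : Finset (Fin b)) : Set (Fin b))) = L i := by
      intro i
      rw [Finset.coe_filter_univ]
      refine span_basis_of_stable (φ := φ.toLinearMap) v hμ hφ fun x hx => ?_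
      have := Submodule.mem_map_of_mem (f := φ.toLinearMap) hx
      rwa [(hL' i).2] at this
    refine ⟨⟨fun i => Finset.univ.filter fun t => v t ∈ L i, fun i j hij t ht => ?_, fun i => ?_⟩,
      Subtype.ext (funext hspan)⟩
    · rw [Finset.mem_filter] at ht ⊢
      exact ⟨ht.1, hL hij ht.2⟩
    · rw [← finrank_span_basis_image v, hspan i, (hL' i).1]

/-! ## Four subspaces in normal form -/

/-- Bases `v` of `K¹` and `w` of `K²`, and numbers `μ`, such that `v t + w t` lies in `K³` and
`μ t • v t + w t` lies in `K⁴`. -/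
structure IsEigenFrame {b : ℕ} (F : FlagTuple (2 * b) 4) (v w : Fin b → Fin (2 * b) → ℂ)
    (μ : Fin b → ℂ) : Prop where
  mem_zero : ∀ t, v t ∈ middle F 0
  mem_one : ∀ t, w t ∈ middle F 1
  mem_two : ∀ t, v t + w t ∈ middle F 2
  mem_three : ∀ t, μ t • v t + w t ∈ middle F 3
  linearIndependent : LinearIndependent ℂ (Sum.elim v w)
  injective : Function.Injective μ
  ne_zero : ∀ t, μ t ≠ 0

theorem finrank_middle {b : ℕ} (F : FlagTuple (2 * b) 4) (j : Fin 4) :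
    Module.finrank ℂ (middle F j) = b := (F j).finrank_sub _

theorem exists_basis_middle {b : ℕ} {F : FlagTuple (2 * b) 4} {j : Fin 4}
    {v : Fin b → Fin (2 * b) → ℂ} (h : ∀ t, v t ∈ middle F j) (hv : LinearIndependent ℂ v) :
    ∃ B : Module.Basis (Fin b) ℂ (middle F j), ∀ t, (B t : Fin (2 * b) → ℂ) = v t := by
  have hli : LinearIndependent ℂ fun t => (⟨v t, h t⟩ : middle F j) :=
    LinearIndependent.of_comp (middle F j).subtype hv
  refine ⟨Module.Basis.mk hli ?_, fun t => by rw [Module.Basis.mk_apply]⟩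
  rw [hli.span_eq_top_of_card_eq_finrank' (by rw [finrank_middle, Fintype.card_fin])]

theorem isGraphOf_middle {b : ℕ} {F : FlagTuple (2 * b) 4} {j : Fin 4}
    {K₁ K₂ : Submodule ℂ (Fin (2 * b) → ℂ)} (hd : Disjoint K₁ K₂) (f : K₁ ≃ₗ[ℂ] K₂)
    (B : Module.Basis (Fin b) ℂ K₁) (h : ∀ t, (B t : Fin (2 * b) → ℂ) + f (B t) ∈ middle F j) :
    IsGraphOf f (middle F j) := by
  have : LinearMap.range (graphMap f) = middle F j := by
    refine Submodule.eq_of_le_of_finrank_eq ?_ ?_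
    · rintro _ ⟨x, rfl⟩
      rw [← B.sum_repr x, map_sum]
      refine sum_mem fun t _ => ?_
      rw [map_smul]
      exact Submodule.smul_mem _ _ (h t)
    · rw [LinearMap.finrank_range_of_inj (graphMap_injective hd f), finrank_middle,
        Module.finrank_eq_card_basis B, Fintype.card_fin]
  rw [← this]
  exact isGraphOf_range f

/-! ### Solutions of an instance with an eigenframe -/

section solutions

variable {r b : ℕ} {a : Fin r → ℕ} {ha : StrictMono a} {hab : ∀ i, a i < b}
  {P : SchubertProblem (doubledType a ha hab) 4}

/-- Stable flags correspond to solutions. -/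
theorem exists_stableFlag_equiv {F : FlagTuple (2 * b) 4}
    (hP : ∀ E : PartialFlag (doubledType a ha hab), E ∈ P.solutions F ↔
      ∀ (i : Fin r) (j : Fin 4), a i ≤ Module.finrank ℂ ↥(E.sub i ⊓ middle F j))
    (hd : Disjoint (middle F 0) (middle F 1)) {f₃ f₄ : middle F 0 ≃ₗ[ℂ] middle F 1}
    (h₃ : IsGraphOf f₃ (middle F 2)) (h₄ : IsGraphOf f₄ (middle F 3)) :
    ∃ Φ : StableFlag a (f₃.trans f₄.symm) ≃ P.solutions F,
      ∀ L i, (Φ L).1.sub i = directSum f₃ (L.1 i) := by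
  have hmap : ∀ L : Submodule ℂ (middle F 0), L.map (f₃.trans f₄.symm).toLinearMap = L →
      L.map f₄.toLinearMap = L.map f₃.toLinearMap := fun L hL => by
    conv_lhs => rw [← hL]
    ext x
    simp
  let flag : StableFlag a (f₃.trans f₄.symm) → PartialFlag (doubledType a ha hab) := fun L =>
    { sub := fun i => directSum f₃ (L.1 i)
      mono := fun i j hij => sup_le_sup (Submodule.map_mono (L.2.1 hij))
        (Submodule.map_mono (Submodule.map_mono (L.2.1 hij)))
      finrank_sub := fun i => by
        rw [finrank_directSum hd, (L.2.2 i).1]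
        rfl }
  have hflag : ∀ L, flag L ∈ P.solutions F := fun L => (hP _).2 fun i j => by
    rw [← (L.2.2 i).1]
    fin_cases j
    · exact finrank_le_directSum_inf_left f₃ _
    · exact finrank_le_directSum_inf_right f₃ _
    · exact finrank_le_directSum_inf_graph hd h₃ _ rfl
    · exact finrank_le_directSum_inf_graph hd h₄ _ (hmap _ (L.2.2 i).2)
  refine ⟨Equiv.ofBijective (fun L => ⟨flag L, hflag L⟩) ⟨fun L L' h => ?_, ?_⟩, fun _ _ => rfl⟩
  · refine Subtype.ext (funext fun i => ?_)
    have h' : directSum f₃ (L.1 i) = directSum f₃ (L'.1 i) :=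
      congrArg (fun E : P.solutions F => E.1.sub i) h
    rw [← comap_directSum hd f₃ (L.1 i), h', comap_directSum hd]
  · rintro ⟨E, hE⟩
    have hE' := (hP E).1 hE
    have hdim : ∀ i : Fin r, Module.finrank ℂ (E.sub i) = 2 * a i := fun i => E.finrank_sub i
    refine ⟨⟨fun i => (E.sub i).comap (middle F 0).subtype,
      fun i j hij => Submodule.comap_mono (E.mono hij), fun i =>
      ⟨(solution_decomposition hd (hdim i) (hE' i 0) (hE' i 1)).1, ?_⟩⟩,
      Subtype.ext (PartialFlag.ext (funext fun i =>
        solution_eq_directSum hd (hdim i) (hE' i 0) (hE' i 1) h₃ (hE' i 2)))⟩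
    have e3 := solution_map_eq hd (hdim i) (hE' i 0) (hE' i 1) h₃ (hE' i 2)
    have e4 := solution_map_eq hd (hdim i) (hE' i 0) (hE' i 1) h₄ (hE' i 3)
    rw [← e4] at e3
    have : (f₃.trans f₄.symm).toLinearMap = f₄.symm.toLinearMap ∘ₗ f₃.toLinearMap := rfl
    rw [this, Submodule.map_comp, e3, ← Submodule.map_comp]
    simp

/-- The description of the solutions of an instance with an eigenframe. -/
theorem IsEigenFrame.solutions {F : FlagTuple (2 * b) 4} {v w : Fin b → Fin (2 * b) → ℂ}
    {μ : Fin b → ℂ} (h : IsEigenFrame F v w μ)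
    (hP : ∀ E : PartialFlag (doubledType a ha hab), E ∈ P.solutions F ↔
      ∀ (i : Fin r) (j : Fin 4), a i ≤ Module.finrank ℂ ↥(E.sub i ⊓ middle F j))
    (hd : Disjoint (middle F 0) (middle F 1)) :
    ∃ f₃ f₄ : middle F 0 ≃ₗ[ℂ] middle F 1,
      IsGraphOf f₃ (middle F 2) ∧ IsGraphOf f₄ (middle F 3) ∧
      ∃ (Φ : StableFlag a (f₃.trans f₄.symm) ≃ P.solutions F)
        (B : Module.Basis (Fin b) ℂ (middle F 0))
        (Ψ : SubsetFlag a b ≃ StableFlag a (f₃.trans f₄.symm)),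
        (∀ L i, (Φ L).1.sub i = directSum f₃ (L.1 i)) ∧
        (∀ t, f₄.symm (f₃ (B t)) = μ t • B t) ∧
        (∀ T i, (Ψ T).1 i = Submodule.span ℂ (B '' (T.1 i : Set (Fin b)))) ∧
        (∀ t, (B t : Fin (2 * b) → ℂ) = v t) ∧ ∀ t, (f₃ (B t) : Fin (2 * b) → ℂ) = w t := by
  have hv : LinearIndependent ℂ v := h.linearIndependent.comp Sum.inl Sum.inl_injective
  have hw : LinearIndependent ℂ w := h.linearIndependent.comp Sum.inr Sum.inr_injective
  obtain ⟨B, hB⟩ := exists_basis_middle h.mem_zero hv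
  obtain ⟨C, hC⟩ := exists_basis_middle h.mem_one hw
  set f₃ := B.equiv C (Equiv.refl _) with hf₃
  -- Since `μ t • v t + w t` lies in K⁴, the map `f₄` has to send `v t` to `(μ t)⁻¹ • w t`.
  set f₄ := B.equiv (C.unitsSMul fun t => (Units.mk0 (μ t) (h.ne_zero t))⁻¹) (Equiv.refl _) with hf₄
  have e₃ : ∀ t, f₃ (B t) = C t := fun t => by simp [hf₃]
  have e₄ : ∀ t, f₄ (B t) = (μ t)⁻¹ • C t := fun t => by
    simp [hf₄, Module.Basis.unitsSMul_apply, Units.smul_def]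
  have h₃ : IsGraphOf f₃ (middle F 2) := isGraphOf_middle hd f₃ B fun t => by
    rw [e₃, hB, hC]
    exact h.mem_two t
  have h₄ : IsGraphOf f₄ (middle F 3) := isGraphOf_middle hd f₄ B fun t => by
    have := (middle F 3).smul_mem (μ t)⁻¹ (h.mem_three t)
    rw [smul_add, smul_smul, inv_mul_cancel₀ (h.ne_zero t), one_smul] at this
    rw [e₄, hB, Submodule.coe_smul, hC]
    exact this
  have heig : ∀ t, f₄.symm (f₃ (B t)) = μ t • B t := fun t => by
    rw [LinearEquiv.symm_apply_eq, map_smul, e₃, e₄, smul_smul, mul_inv_cancel₀ (h.ne_zero t),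
      one_smul]
  obtain ⟨Φ, hΦ⟩ := exists_stableFlag_equiv hP hd h₃ h₄
  obtain ⟨Ψ, hΨ⟩ := exists_subsetFlag_equiv a B (f₃.trans f₄.symm) h.injective heig
  exact ⟨f₃, f₄, h₃, h₄, Φ, B, Ψ, hΦ, heig, hΨ, hB, fun t => by rw [e₃, hC]⟩

/-- Reads off from a solution which eigenvectors span it; needed to lift solutions to the space of
numbered eigenvectors. -/
theorem IsEigenFrame.exists_subsetFlag {F : FlagTuple (2 * b) 4} {v w : Fin b → Fin (2 * b) → ℂ}
    {μ : Fin b → ℂ} (h : IsEigenFrame F v w μ)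
    (hP : ∀ E : PartialFlag (doubledType a ha hab), E ∈ P.solutions F ↔
      ∀ (i : Fin r) (j : Fin 4), a i ≤ Module.finrank ℂ ↥(E.sub i ⊓ middle F j))
    (hd : Disjoint (middle F 0) (middle F 1)) {E : PartialFlag (doubledType a ha hab)}
    (hE : E ∈ P.solutions F) :
    ∃ T : SubsetFlag a b, ∀ i, ∀ t ∈ T.1 i, v t ∈ E.sub i ∧ w t ∈ E.sub i := by
  obtain ⟨f₃, f₄, -, -, Φ, B, Ψ, hΦ, -, hΨ, hB, hC⟩ := h.solutions hP hd
  refine ⟨Ψ.symm (Φ.symm ⟨E, hE⟩), fun i t ht => ?_⟩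
  have hEi : E.sub i = directSum f₃ ((Φ.symm ⟨E, hE⟩).1 i) := by
    have := hΦ (Φ.symm ⟨E, hE⟩) i
    rw [Equiv.apply_symm_apply] at this
    exact this
  have hL : B t ∈ (Φ.symm ⟨E, hE⟩).1 i := by
    rw [← Ψ.apply_symm_apply (Φ.symm ⟨E, hE⟩), hΨ]
    exact Submodule.subset_span ⟨t, ht, rfl⟩
  rw [hEi, ← hB, ← hC]
  exact ⟨mem_directSum.2 ⟨B t, hL, 0, Submodule.zero_mem _, by simp⟩,
    mem_directSum.2 ⟨0, Submodule.zero_mem _, B t, hL, by simp⟩⟩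

end solutions

end

noncomputable section

/-! ## Slopes of the middle members -/

section slope

variable {b : ℕ}

/-- The vector of `ℂ^{2b}` with given halves. -/
def joinVec {R : Type*} (x z : Fin b → R) : Fin (2 * b) → R := Sum.elim x z ∘ (halves b).symm

@[simp] theorem joinVec_inl {R : Type*} (x z : Fin b → R) (q : Fin b) :
    joinVec x z (halves b (Sum.inl q)) = x q := by simp [joinVec]

@[simp] theorem joinVec_inr {R : Type*} (x z : Fin b → R) (q : Fin b) :
    joinVec x z (halves b (Sum.inr q)) = z q := by simp [joinVec]

theorem halves_ext {R : Type*} {v w : Fin (2 * b) → R}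
    (h₁ : ∀ q, v (halves b (Sum.inl q)) = w (halves b (Sum.inl q)))
    (h₂ : ∀ q, v (halves b (Sum.inr q)) = w (halves b (Sum.inr q))) : v = w := by
  funext p
  obtain ⟨x | x, rfl⟩ := (halves b).surjective p
  · exact h₁ x
  · exact h₂ x

theorem joinVec_add {R : Type*} [Add R] (x z x' z' : Fin b → R) :
    joinVec (x + x') (z + z') = joinVec x z + joinVec x' z' := halves_ext (by simp) (by simp)

theorem joinVec_smul {R : Type*} [Mul R] (c : R) (x z : Fin b → R) :
    joinVec (c • x) (c • z) = c • joinVec x z := halves_ext (by simp) (by simp)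

/-- The index of the member of dimension `b` of a complete flag in `ℂ^{2b}`. -/
def midIndex (b : ℕ) : Fin (FlagType.complete (2 * b)).len :=
  ⟨b, by simp only [FlagType.complete]; omega⟩

/-- The matrix `Z` with `F_b = {(x, Z x)}`. -/
def midSlope (F : FlagTuple (2 * b) 4) (j : Fin 4) : Matrix (Fin b) (Fin b) ℂ :=
  Matrix.of fun p q => (F j).coordVec (midIndex b) (halves b (Sum.inl q)) (halves b (Sum.inr p))

theorem halves_lt_iff (x : Fin b ⊕ Fin b) :
    (halves b x : ℕ) < (FlagType.complete (2 * b)).d (midIndex b) ↔ ∃ q, x = Sum.inl q := by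
  change (halves b x : ℕ) < b ↔ _
  rcases x with q | q <;> simp

theorem isCoordVec_slope {F : FlagTuple (2 * b) 4} {j : Fin 4} (hF : (F j).Chart (midIndex b))
    (q : Fin b) : (F j).coordVec (midIndex b) (halves b (Sum.inl q)) =
      joinVec (Pi.single q 1) ((midSlope F j).col q) := by
  refine halves_ext (fun p => ?_) (fun p => ?_)
  · rw [(hF.isCoordVec ((halves_lt_iff _).2 ⟨q, rfl⟩)).2 _ ((halves_lt_iff _).2 ⟨p, rfl⟩)]
    simp [Pi.single_apply]
  · simp [midSlope]

theorem joinVec_slope_mem {F : FlagTuple (2 * b) 4} {j : Fin 4} (hF : (F j).Chart (midIndex b))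
    (x : Fin b → ℂ) : joinVec x ((midSlope F j).mulVec x) ∈ middle F j := by
  have : joinVec x ((midSlope F j).mulVec x) =
      ∑ q, x q • (F j).coordVec (midIndex b) (halves b (Sum.inl q)) := by
    simp only [isCoordVec_slope hF]
    refine halves_ext (fun p => ?_) (fun p => ?_)
    · simp [Finset.sum_apply, Pi.single_apply]
    · simp [Finset.sum_apply, Matrix.mulVec, dotProduct, mul_comm]
  rw [this]
  exact sum_mem fun q _ => Submodule.smul_mem _ _
    (hF.isCoordVec ((halves_lt_iff _).2 ⟨q, rfl⟩)).1

theorem mem_middle_iff {F : FlagTuple (2 * b) 4} {j : Fin 4} (hF : (F j).Chart (midIndex b))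
    {v : Fin (2 * b) → ℂ} : v ∈ middle F j ↔
      ∀ p, v (halves b (Sum.inr p)) =
        (midSlope F j).mulVec (fun q => v (halves b (Sum.inl q))) p := by
  have hmem := joinVec_slope_mem hF fun q => v (halves b (Sum.inl q))
  constructor
  · intro hv p
    have : v = joinVec _ _ := hF.eq_of_eq_on hv hmem fun p hp => by
      obtain ⟨x, rfl⟩ := (halves b).surjective p
      obtain ⟨q, rfl⟩ := (halves_lt_iff x).1 hp
      simp
    conv_lhs => rw [this]
    simp
  · intro h
    convert hmem using 1
    refine halves_ext (fun p => ?_) (fun p => ?_)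
    · simp
    · simp [h]

theorem joinVec_mem_middle_iff {F : FlagTuple (2 * b) 4} {j : Fin 4}
    (hF : (F j).Chart (midIndex b)) {x z : Fin b → ℂ} :
    joinVec x z ∈ middle F j ↔ z = (midSlope F j).mulVec x := by
  rw [mem_middle_iff hF, funext_iff]
  simp

/-- A common vector `(x, Z x)` of the two planes has `x` in the kernel of the difference of the
slopes. -/
theorem middle_isCompl {F : FlagTuple (2 * b) 4} {i j : Fin 4} (hi : (F i).Chart (midIndex b))
    (hj : (F j).Chart (midIndex b)) (h : (midSlope F i - midSlope F j).det ≠ 0) :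
    IsCompl (middle F i) (middle F j) := by
  have hd : Disjoint (middle F i) (middle F j) := by
    rw [Submodule.disjoint_def]
    intro v hvi hvj
    have h1 := (mem_middle_iff hi).1 hvi
    have h2 := (mem_middle_iff hj).1 hvj
    have h3 : (fun q => v (halves b (Sum.inl q))) = 0 := by
      by_contra hne
      refine h (Matrix.exists_mulVec_eq_zero_iff.1 ⟨_, hne, ?_⟩)
      rw [Matrix.sub_mulVec, sub_eq_zero]
      funext p
      rw [← h1, ← h2]
    refine halves_ext (fun p => congrFun h3 p) fun p => ?_
    rw [h1, h3, Matrix.mulVec_zero]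
    rfl
  refine IsCompl.of_eq hd.eq_bot (Submodule.eq_top_of_finrank_eq ?_)
  have := Submodule.finrank_sup_add_finrank_inf_eq (middle F i) (middle F j)
  rw [hd.eq_bot, finrank_bot, finrank_middle, finrank_middle] at this
  rw [Module.finrank_fin_fun]
  omega

end slope

/-! ## Genericity -/

section generic

variable {b : ℕ} {R S : Type*} [CommRing R] [CommRing S]

/-- A multiple of the matrix of the operator `φ` in terms of the slopes of the four subspaces. -/
def crossMatrix (Z : Fin 4 → Matrix (Fin b) (Fin b) R) : Matrix (Fin b) (Fin b) R :=
  (Z 3 - Z 0).adjugate * (Z 1 - Z 3) * (Z 1 - Z 2).adjugate * (Z 2 - Z 0)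

/-- This does not vanish if the four subspaces are in general position. -/
def genericity (Z : Fin 4 → Matrix (Fin b) (Fin b) R) : R :=
  (∏ p : {p : Fin 4 × Fin 4 // p.1 < p.2}, (Z p.1.1 - Z p.1.2).det) *
    Polynomial.resultant (crossMatrix Z).charpoly (crossMatrix Z).charpoly.derivative b (b - 1)

theorem map_crossMatrix (f : R →+* S) (Z : Fin 4 → Matrix (Fin b) (Fin b) R) :
    (crossMatrix Z).map f = crossMatrix fun j => (Z j).map f := by
  simp only [crossMatrix, ← RingHom.mapMatrix_apply, map_mul, map_sub, RingHom.map_adjugate]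

theorem map_genericity (f : R →+* S) (Z : Fin 4 → Matrix (Fin b) (Fin b) R) :
    f (genericity Z) = genericity fun j => (Z j).map f := by
  simp only [genericity, map_mul, map_prod, RingHom.map_det, RingHom.mapMatrix_apply]
  congr 1
  · simp only [← RingHom.mapMatrix_apply, map_sub]
  · rw [← Polynomial.resultant_map_map, ← Matrix.charpoly_map, ← Polynomial.derivative_map,
      ← Matrix.charpoly_map, map_crossMatrix]

/-- The degree arguments `b` and `b - 1` are the true degrees, the second because the characteristic
is zero, so the resultant detects coprimality with the derivative. -/
theorem resultant_charpoly_ne_zero_iff (M : Matrix (Fin b) (Fin b) ℂ) :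
    Polynomial.resultant M.charpoly M.charpoly.derivative b (b - 1) ≠ 0 ↔ M.charpoly.Separable := by
  have hd : M.charpoly.natDegree = b := by rw [Matrix.charpoly_natDegree_eq_dim, Fintype.card_fin]
  have hd' : M.charpoly.derivative.natDegree = b - 1 := by rw [Polynomial.natDegree_derivative, hd]
  have h := Polynomial.isUnit_resultant_iff_isCoprime (g := M.charpoly.derivative) M.charpoly_monic
  rw [hd, hd', isUnit_iff_ne_zero] at h
  exact h

theorem det_sub_ne_zero {Z : Fin 4 → Matrix (Fin b) (Fin b) ℂ} (h : genericity Z ≠ 0)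
    {i j : Fin 4} (hij : i ≠ j) : (Z i - Z j).det ≠ 0 := by
  have h1 := Finset.prod_ne_zero_iff.1 (left_ne_zero_of_mul h)
  rcases hij.lt_or_gt with hlt | hlt
  · exact h1 ⟨(i, j), hlt⟩ (Finset.mem_univ _)
  · have := h1 ⟨(j, i), hlt⟩ (Finset.mem_univ _)
    rw [← neg_sub, Matrix.det_neg]
    exact mul_ne_zero (pow_ne_zero _ (by simp)) this

theorem exists_eigenvectors {M : Matrix (Fin b) (Fin b) ℂ} (hM : M.charpoly.Separable) :
    ∃ (ρ : Fin b → ℂ) (x : Fin b → Fin b → ℂ), Function.Injective ρ ∧ LinearIndependent ℂ x ∧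
      ∀ t, M.mulVec (x t) = ρ t • x t := by
  classical
  have hcard : M.charpoly.roots.toFinset.card = b := by
    rw [Multiset.toFinset_card_of_nodup (Polynomial.nodup_roots hM),
      IsAlgClosed.card_roots_eq_natDegree, Matrix.charpoly_natDegree_eq_dim, Fintype.card_fin]
  let e := (M.charpoly.roots.toFinset.equivFinOfCardEq hcard).symm
  have hinj : Function.Injective fun t => (e t : ℂ) := Subtype.val_injective.comp e.injective
  have hex : ∀ t, ∃ x, Module.End.HasEigenvector (Matrix.toLin' M) (e t : ℂ) x := fun t => by
    refine Module.End.HasEigenvalue.exists_hasEigenvector ?_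
    rw [Module.End.hasEigenvalue_iff_isRoot_charpoly, ← Matrix.toLin_eq_toLin',
      Matrix.charpoly_toLin]
    exact Polynomial.isRoot_of_mem_roots (Multiset.mem_toFinset.1 (e t).2)
  choose x hx using hex
  refine ⟨_, x, hinj, Module.End.eigenvectors_linearIndependent' _ _ hinj x hx, fun t => ?_⟩
  have := (hx t).apply_eq_smul
  rwa [Matrix.toLin'_apply] at this

/-- Identify K¹ and K² with ℂ^b by the first `b` coordinates. Then `y = f₃ x` means `(Z 1 - Z 2) y =
(Z 2 - Z 0) x`, and `y = f₄ x'` means `(Z 3 - Z 0) x' = (Z 1 - Z 3) y`. So `f₃` is the matrix `N`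
below, φ is `A⁻¹ * B * N`, and `crossMatrix` is φ with its denominators cleared. -/
theorem exists_eigenFrame {F : FlagTuple (2 * b) 4} (hF : ∀ j, (F j).Chart (midIndex b))
    (h : genericity (midSlope F) ≠ 0) : ∃ v w μ, IsEigenFrame F v w μ := by
  have hA := det_sub_ne_zero h (show (3 : Fin 4) ≠ 0 by decide)
  have hB := det_sub_ne_zero h (show (1 : Fin 4) ≠ 3 by decide)
  have hC := det_sub_ne_zero h (show (1 : Fin 4) ≠ 2 by decide)
  have hD := det_sub_ne_zero h (show (2 : Fin 4) ≠ 0 by decide)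
  have hcompl := middle_isCompl (hF 0) (hF 1) (det_sub_ne_zero h (show (0 : Fin 4) ≠ 1 by decide))
  obtain ⟨ρ, x, hρ, hx, hM⟩ :=
    exists_eigenvectors ((resultant_charpoly_ne_zero_iff _).1 (right_ne_zero_of_mul h))
  rw [crossMatrix] at hM
  set Z := midSlope F
  set A := Z 3 - Z 0 with hA'
  set B := Z 1 - Z 3 with hB'
  set C := Z 1 - Z 2 with hC'
  set D := Z 2 - Z 0 with hD'
  set N : Matrix (Fin b) (Fin b) ℂ := (C.det)⁻¹ • (C.adjugate * D) with hN
  have hCN : C * N = D := by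
    rw [hN, Matrix.mul_smul, ← Matrix.mul_assoc, Matrix.mul_adjugate, Matrix.smul_mul,
      Matrix.one_mul, smul_smul, inv_mul_cancel₀ hC, one_smul]
  have hdetN : N.det ≠ 0 := fun h0 => hD (by rw [← hCN, Matrix.det_mul, h0, mul_zero])
  -- Replacing the two inverses by adjugates multiplied φ by `A.det * C.det`, so the eigenvalue of φ
  -- is `ρ t` divided by this product.
  have hBN : ∀ t, (B * N).mulVec (x t) = (ρ t * (A.det * C.det)⁻¹) • A.mulVec (x t) := fun t => by
    have h1 := congrArg A.mulVec (hM t)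
    rw [Matrix.mulVec_mulVec, Matrix.mul_assoc, Matrix.mul_assoc, ← Matrix.mul_assoc A,
      Matrix.mul_adjugate, Matrix.smul_mul, Matrix.one_mul, Matrix.smul_mulVec, Matrix.mulVec_smul]
      at h1
    have e : ρ t * (A.det * C.det)⁻¹ = C.det⁻¹ * (A.det⁻¹ * ρ t) := by rw [mul_inv]; ring
    rw [hN, Matrix.mul_smul, Matrix.smul_mulVec, e, mul_smul, mul_smul, ← h1, smul_smul A.det⁻¹,
      inv_mul_cancel₀ hA, one_smul]
  have hv : LinearIndependent ℂ fun t => joinVec (x t) ((Z 0).mulVec (x t)) :=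
    LinearIndependent.of_comp (LinearMap.funLeft ℂ ℂ fun q => halves b (Sum.inl q)) <| by
      convert hx using 1
      funext t q
      simp [LinearMap.funLeft_apply]
  have hNx : LinearIndependent ℂ fun t => N.mulVec (x t) :=
    hx.map' N.mulVecLin (LinearMap.ker_eq_bot.2 (Matrix.mulVec_injective_iff_isUnit.2
      ((Matrix.isUnit_iff_isUnit_det _).2 (isUnit_iff_ne_zero.2 hdetN))))
  have hw : LinearIndependent ℂ fun t => joinVec (N.mulVec (x t)) ((Z 1).mulVec (N.mulVec (x t))) :=
    LinearIndependent.of_comp (LinearMap.funLeft ℂ ℂ fun q => halves b (Sum.inl q)) <| by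
      convert hNx using 1
      funext t q
      simp [LinearMap.funLeft_apply]
  refine ⟨fun t => joinVec (x t) ((Z 0).mulVec (x t)),
    fun t => joinVec (N.mulVec (x t)) ((Z 1).mulVec (N.mulVec (x t))),
    fun t => ρ t * (A.det * C.det)⁻¹, fun t => joinVec_slope_mem (hF 0) _,
    fun t => joinVec_slope_mem (hF 1) _, fun t => ?_, fun t => ?_, ?_, ?_, fun t => ?_⟩
  · rw [← joinVec_add, joinVec_mem_middle_iff (hF 2)]
    change _ = (Z 2).mulVec _
    have h1 : C.mulVec (N.mulVec (x t)) = D.mulVec (x t) := by rw [Matrix.mulVec_mulVec, hCN]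
    rw [hC', hD', Matrix.sub_mulVec, Matrix.sub_mulVec, sub_eq_sub_iff_add_eq_add] at h1
    rw [Matrix.mulVec_add, add_comm ((Z 0).mulVec _), h1]
  · rw [← joinVec_smul, ← joinVec_add, joinVec_mem_middle_iff (hF 3)]
    change _ = (Z 3).mulVec _
    have h1 := hBN t
    rw [← Matrix.mulVec_mulVec, hB', Matrix.sub_mulVec, sub_eq_iff_eq_add] at h1
    rw [h1, Matrix.mulVec_add, Matrix.mulVec_smul, hA', Matrix.sub_mulVec, smul_sub]
    abel
  · refine hv.sum_type hw (hcompl.disjoint.mono (Submodule.span_le.2 ?_) (Submodule.span_le.2 ?_))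
    · rintro _ ⟨t, rfl⟩
      exact joinVec_slope_mem (hF 0) _
    · rintro _ ⟨t, rfl⟩
      exact joinVec_slope_mem (hF 1) _
  · intro s t hst
    exact hρ (mul_right_cancel₀ (inv_ne_zero (mul_ne_zero hA hC)) hst)
  -- A zero eigenvalue would put `x t` in the kernel of the invertible matrix `B * N`.
  · intro h0
    have h1 := hBN t
    rw [h0, zero_smul] at h1
    refine hx.ne_zero t ?_
    by_contra hne
    have := Matrix.exists_mulVec_eq_zero_iff.1 ⟨_, hne, h1⟩
    rw [Matrix.det_mul] at this
    exact mul_ne_zero hB hdetN this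

/-! ### The general instances -/

open VarietyPresentation

attribute [local instance] zariski

theorem isFrame_flagTuple (n s : ℕ) (j : Fin s) :
    IsFrame (fun F : FlagTuple n s => F j)
      (Matrix.of fun p q =>
        (MvPolynomial.X (j, p, q) : MvPolynomial (Fin s × Fin n × Fin n) ℂ)) := by
  intro c
  have h : (Matrix.of fun p q => (MvPolynomial.X (j, p, q) :
      MvPolynomial (Fin s × Fin n × Fin n) ℂ)).map (MvPolynomial.eval c.1) =
      Matrix.of fun p q => c.1 (j, p, q) := by
    ext p q
    simp
  refine ⟨by rw [h]; exact c.2 j, ?_⟩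
  simp only [h]
  rfl

/-- The tuples of flags all of whose members lie in the first affine chart. -/
def chartTuples (n s : ℕ) : Set (FlagTuple n s) := {F | ∀ j i, (F j).Chart i}

theorem isOpen_chartTuples (n s : ℕ) : IsOpen (chartTuples n s) := by
  have : chartTuples n s = ⋂ j, ⋂ i, {F | (F j).Chart i} := by
    ext F
    simp [chartTuples]
  rw [this]
  exact isOpen_iInter_of_finite fun j => isOpen_iInter_of_finite fun i =>
    (isFrame_flagTuple n s j).isOpen_chart i

/-- The coordinates of vectors of a tuple of flags, as regular functions. -/
def coordFun {n s : ℕ} (j : Fin s) (i : Fin (FlagType.complete n).len) (l : Fin n)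
    (hl : (l : ℕ) < (FlagType.complete n).d i) (p : Fin n) : regularRing (chartTuples n s) :=
  regularRing.of (fun F => (F j).coordVec i l p)
    (((isFrame_flagTuple n s j).regularOn_coordVec i hl p).mono fun _ hF => hF j i)

/-- The slopes as matrices of regular functions. -/
def slopeFun (b : ℕ) (j : Fin 4) : Matrix (Fin b) (Fin b) (regularRing (chartTuples (2 * b) 4)) :=
  Matrix.of fun p q => coordFun j (midIndex b) (halves b (Sum.inl q))
    ((halves_lt_iff _).2 ⟨q, rfl⟩) (halves b (Sum.inr p))

/-- The open set of general instances. -/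
def generalTuples (b : ℕ) : Set (FlagTuple (2 * b) 4) :=
  {F | F ∈ chartTuples (2 * b) 4 ∧ genericity (midSlope F) ≠ 0}

/-- Since `genericity` commutes with ring homomorphisms, its value at the slopes is itself a regular
function on the chart. -/
theorem isOpen_generalTuples (b : ℕ) : IsOpen (generalTuples b) := by
  convert regularRing.isOpen_ne_zero (isOpen_chartTuples (2 * b) 4)
    (genericity (slopeFun b)) using 1
  ext F
  refine ⟨fun h => ⟨h.1, ?_⟩, fun h => ⟨h.choose, ?_⟩⟩
  · rw [map_genericity]
    exact h.2
  · have := h.choose_spec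
    rw [map_genericity] at this
    exact this

end generic

end

noncomputable section

/-! ## Existence of general instances -/

section exists_general

variable {n b : ℕ}

theorem det_leading_of_unitriangular {M : Matrix (Fin n) (Fin n) ℂ}
    (h0 : ∀ p q, p < q → M p q = 0) (h1 : ∀ p, M p p = 1) (d : ℕ) : (M.leading d).det = 1 := by
  rw [Matrix.det_of_isLowerTriangular]
  · exact Finset.prod_eq_one fun q _ => h1 q.1
  · intro p q hpq
    exact h0 p.1 q.1 hpq

theorem det_of_unitriangular {M : Matrix (Fin n) (Fin n) ℂ}
    (h0 : ∀ p q, p < q → M p q = 0) (h1 : ∀ p, M p p = 1) : M.det = 1 := by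
  rw [Matrix.det_of_isLowerTriangular]
  · exact Finset.prod_eq_one fun q _ => h1 q
  · intro p q hpq
    exact h0 p q hpq

/-- The unitriangular frame of a complete flag with given slope. -/
def slopeFrame (Z : Matrix (Fin b) (Fin b) ℂ) : Matrix (Fin (2 * b)) (Fin (2 * b)) ℂ :=
  (Matrix.fromBlocks 1 0 Z 1).submatrix (halves b).symm (halves b).symm

theorem slopeFrame_diag (Z : Matrix (Fin b) (Fin b) ℂ) (p : Fin (2 * b)) :
    slopeFrame Z p p = 1 := by
  obtain ⟨x | x, rfl⟩ := (halves b).surjective p <;> simp [slopeFrame]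

theorem slopeFrame_of_lt (Z : Matrix (Fin b) (Fin b) ℂ) (p q : Fin (2 * b)) (h : p < q) :
    slopeFrame Z p q = 0 := by
  obtain ⟨x | x, rfl⟩ := (halves b).surjective p <;>
    obtain ⟨y | y, rfl⟩ := (halves b).surjective q <;> rw [Fin.lt_def] at h <;>
    simp only [halves_inl, halves_inr] at h <;> simp [slopeFrame]
  · exact Matrix.one_apply_ne (Fin.ne_of_lt h)
  · omega
  · exact Matrix.one_apply_ne (Fin.ne_of_lt (Nat.add_lt_add_iff_left.1 h))

theorem exists_flagTuple_midSlope (Z : Fin 4 → Matrix (Fin b) (Fin b) ℂ) :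
    ∃ F ∈ chartTuples (2 * b) 4, midSlope F = Z := by
  have hM : ∀ j, IsUnit (slopeFrame (Z j)).det := fun j => by
    rw [det_of_unitriangular (slopeFrame_of_lt _) (slopeFrame_diag _)]
    exact isUnit_one
  have hF : ∀ j i, (PartialFlag.ofMatrix (FlagType.complete (2 * b)) _ (hM j)).Chart i :=
    fun j i => by
    rw [PartialFlag.chart_ofMatrix_iff,
      det_leading_of_unitriangular (slopeFrame_of_lt _) (slopeFrame_diag _)]
    exact one_ne_zero
  refine ⟨fun j => PartialFlag.ofMatrix _ _ (hM j), hF, funext fun j => ?_⟩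
  ext p q
  change (PartialFlag.ofMatrix _ _ (hM j)).coordVec _ _ _ = _
  rw [(hF j (midIndex b)).coordVec_eq (v := (slopeFrame (Z j)).col (halves b (Sum.inl q)))]
  · simp [slopeFrame]
  · refine ⟨PartialFlag.col_mem_ofMatrix _ ((halves_lt_iff _).2 ⟨q, rfl⟩), fun p' hp' => ?_⟩
    obtain ⟨x, rfl⟩ := (halves b).surjective p'
    obtain ⟨p', rfl⟩ := (halves_lt_iff x).1 hp'
    simp [slopeFrame, Matrix.one_apply]

/-- With scalar slopes 0, 1, −1 and a diagonal slope with entries z, the operator φ is diagonal with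
entries (z − 1)/(2z), which is injective in z. The entries z = t + 2 are distinct and avoid 0, 1 and
−1. -/
theorem exists_genericity_ne_zero (b : ℕ) :
    ∃ Z : Fin 4 → Matrix (Fin b) (Fin b) ℂ, genericity Z ≠ 0 := by
  have hz : ∀ t : Fin b, ((t : ℕ) + 2 : ℂ) ≠ 0 := fun t => by
    exact_mod_cast Nat.succ_ne_zero ((t : ℕ) + 1)
  have hz1 : ∀ t : Fin b, (1 - ((t : ℕ) + 2 : ℂ)) ≠ 0 := fun t h => by
    have : (((t : ℕ) + 1 : ℕ) : ℂ) = 0 := by push_cast; linear_combination -h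
    exact Nat.succ_ne_zero _ (Nat.cast_eq_zero.1 this)
  have hz3 : ∀ t : Fin b, (-1 - ((t : ℕ) + 2 : ℂ)) ≠ 0 := fun t h => by
    have : (((t : ℕ) + 3 : ℕ) : ℂ) = 0 := by push_cast; linear_combination -h
    exact Nat.succ_ne_zero _ (Nat.cast_eq_zero.1 this)
  let Z : Fin 4 → Matrix (Fin b) (Fin b) ℂ :=
    ![0, Matrix.diagonal fun _ => 1, Matrix.diagonal fun _ => -1,
      Matrix.diagonal fun t => (t : ℕ) + 2]
  refine ⟨Z, mul_ne_zero (Finset.prod_ne_zero_iff.2 ?_) ((resultant_charpoly_ne_zero_iff _).2 ?_)⟩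
  · rintro ⟨⟨i, j⟩, hij⟩ -
    fin_cases i <;> fin_cases j <;> first
      | exact absurd hij (by decide)
      | (simp only [Z, Fin.zero_eta, Fin.mk_one, Fin.reduceFinMk, Matrix.cons_val,
          Matrix.cons_val_zero, Matrix.cons_val_one, zero_sub, Matrix.diagonal_neg,
          Matrix.diagonal_sub, Matrix.det_diagonal, Finset.prod_ne_zero_iff]
         intro t _
         first
          | exact hz1 t
          | exact hz3 t
          | exact neg_ne_zero.2 (hz t)
          | norm_num)
  · have hc : ∀ t : Fin b, ∏ j ∈ Finset.univ.erase t, ((j : ℕ) + 2 : ℂ) =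
        (∏ j : Fin b, ((j : ℕ) + 2 : ℂ)) / ((t : ℕ) + 2) := fun t => by
      rw [eq_div_iff (hz t), Finset.prod_erase_mul _ _ (Finset.mem_univ t)]
    have hP : (∏ j : Fin b, ((j : ℕ) + 2 : ℂ)) ≠ 0 := Finset.prod_ne_zero_iff.2 fun t _ => hz t
    have hR : crossMatrix Z = Matrix.diagonal fun t : Fin b =>
        (∏ j ∈ Finset.univ.erase t, ((j : ℕ) + 2 : ℂ)) * (1 - ((t : ℕ) + 2)) *
          (∏ j ∈ Finset.univ.erase t, (1 - (-1))) * (-1) := by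
      simp only [crossMatrix, Z, Matrix.cons_val, Matrix.cons_val_zero, Matrix.cons_val_one,
        sub_zero, Matrix.diagonal_sub, Matrix.adjugate_diagonal, Matrix.diagonal_mul_diagonal]
    rw [hR, Matrix.charpoly_diagonal, Polynomial.separable_prod_X_sub_C_iff]
    intro s t hst
    simp only [Finset.prod_const, Finset.card_erase_of_mem (Finset.mem_univ _), Finset.card_univ,
      hc] at hst
    have h2 : ((1 : ℂ) - (-1)) ^ (Fintype.card (Fin b) - 1) ≠ 0 := pow_ne_zero _ (by norm_num)
    have h3 := mul_right_cancel₀ h2 (mul_right_cancel₀ (by norm_num) hst)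
    have hs := hz s
    have ht := hz t
    field_simp at h3
    have h4 : ((s : ℕ) : ℂ) = (t : ℕ) := by linear_combination -h3
    exact Fin.ext (Nat.cast_injective h4)

theorem nonempty_generalTuples (b : ℕ) : (generalTuples b).Nonempty := by
  obtain ⟨Z, hZ⟩ := exists_genericity_ne_zero b
  obtain ⟨F, hF, rfl⟩ := exists_flagTuple_midSlope Z
  exact ⟨F, hF, hZ⟩

end exists_general

/-! ## Frames of the middle members -/

section frames

set_option linter.unusedSectionVars false

variable {n b : ℕ} {R S : Type*} [CommRing R] [CommRing S]

/-- The matrix with given left and right halves. -/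
def joinCols (A C : Matrix (Fin n) (Fin b) R) : Matrix (Fin n) (Fin (2 * b)) R :=
  (Matrix.fromCols A C).submatrix id (halves b).symm

/-- The left half of a matrix. -/
def leftCols (M : Matrix (Fin n) (Fin (2 * b)) R) : Matrix (Fin n) (Fin b) R :=
  M.submatrix id fun q => halves b (Sum.inl q)

/-- The right half of a matrix. -/
def rightCols (M : Matrix (Fin n) (Fin (2 * b)) R) : Matrix (Fin n) (Fin b) R :=
  M.submatrix id fun q => halves b (Sum.inr q)

@[simp] theorem leftCols_joinCols (A C : Matrix (Fin n) (Fin b) R) :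
    leftCols (joinCols A C) = A := by
  ext p q
  simp [leftCols, joinCols]

theorem joinCols_leftCols_rightCols (M : Matrix (Fin n) (Fin (2 * b)) R) :
    joinCols (leftCols M) (rightCols M) = M := by
  ext p q
  obtain ⟨x | x, rfl⟩ := (halves b).surjective q <;> simp [leftCols, rightCols, joinCols]

theorem joinCols_map (A C : Matrix (Fin n) (Fin b) R) (f : R →+* S) :
    (joinCols A C).map f = joinCols (A.map f) (C.map f) := by
  ext p q
  obtain ⟨x | x, rfl⟩ := (halves b).surjective q <;> simp [joinCols]

theorem mem_mid_ofMatrix {M : Matrix (Fin (2 * b)) (Fin (2 * b)) ℂ} (hM : IsUnit M.det)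
    {v : Fin (2 * b) → ℂ} : v ∈ (PartialFlag.ofMatrix (FlagType.complete (2 * b)) M hM).sub
      (midIndex b) ↔ ∃ c, (leftCols M).mulVec c = v := by
  let e : Fin b ≃ {l : Fin (2 * b) // (l : ℕ) < (FlagType.complete (2 * b)).d (midIndex b)} :=
    Equiv.ofBijective (fun q => ⟨halves b (Sum.inl q), (halves_lt_iff _).2 ⟨q, rfl⟩⟩)
      ⟨fun q q' h => Sum.inl_injective ((halves b).injective (congrArg Subtype.val h)), fun l => by
        obtain ⟨x, hx⟩ := (halves b).surjective l.1
        obtain ⟨q, rfl⟩ := (halves_lt_iff x).1 (by rw [hx]; exact l.2)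
        exact ⟨q, Subtype.ext hx⟩⟩
  have he : ∀ c : _ → ℂ, ∑ l, c l • M.col l.1 = (leftCols M).mulVec (c ∘ e) := fun c => by
    rw [← e.sum_comp, Matrix.mulVec_eq_sum]
    simp [e, leftCols, Matrix.col]
    rfl
  rw [PartialFlag.mem_ofMatrix_sub]
  constructor
  · rintro ⟨c, rfl⟩
    exact ⟨c ∘ e, (he c).symm⟩
  · rintro ⟨c, rfl⟩
    refine ⟨c ∘ e.symm, ?_⟩
    rw [he, Function.comp_assoc, e.symm_comp_self, Function.comp_id]

theorem mem_ofMatrix_sub_iff {D : FlagType n} {M : Matrix (Fin n) (Fin n) ℂ} (hM : IsUnit M.det)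
    {i : Fin D.len} {v : Fin n → ℂ} : v ∈ (PartialFlag.ofMatrix D M hM).sub i ↔
      ∃ c, (∀ p : Fin n, D.d i ≤ p → c p = 0) ∧ M.mulVec c = v := by
  classical
  rw [PartialFlag.mem_ofMatrix_sub]
  constructor
  · rintro ⟨c, rfl⟩
    refine ⟨fun p => if h : (p : ℕ) < D.d i then c ⟨p, h⟩ else 0,
      fun p hp => dif_neg (not_lt.2 hp), ?_⟩
    rw [Matrix.mulVec_eq_sum, ← Finset.sum_subset (Finset.subset_univ
      (Finset.univ.filter fun p : Fin n => (p : ℕ) < D.d i)), Finset.sum_subtype _ (p := fun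
      p : Fin n => (p : ℕ) < D.d i) (by simp)]
    · exact Finset.sum_congr rfl fun l _ => by simp [l.2, Matrix.col]
    · intro p _ hp
      have hp' : ¬ (p : ℕ) < D.d i := by simpa using hp
      simp [hp']
  · rintro ⟨c, hc, rfl⟩
    refine ⟨fun l => c l.1, ?_⟩
    rw [Matrix.mulVec_eq_sum, ← Finset.sum_subset (Finset.subset_univ
      (Finset.univ.filter fun p : Fin n => (p : ℕ) < D.d i)), Finset.sum_subtype _ (p := fun
      p : Fin n => (p : ℕ) < D.d i) (by simp)]
    · exact Finset.sum_congr rfl fun l _ => by simp [Matrix.col]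
    · intro p _ hp
      have hp' : ¬ (p : ℕ) < D.d i := by simpa using hp
      simp [hc p (not_lt.1 hp')]

theorem leftCols_mulVec_injective {M : Matrix (Fin (2 * b)) (Fin (2 * b)) ℂ} (hM : IsUnit M.det)
    {c : Fin b → ℂ} (h : (leftCols M).mulVec c = 0) : c = 0 := by
  have hli : LinearIndependent ℂ M.col :=
    Matrix.linearIndependent_cols_of_isUnit ((Matrix.isUnit_iff_isUnit_det M).2 hM)
  have hli' : LinearIndependent ℂ fun q : Fin b => M.col (halves b (Sum.inl q)) :=
    hli.comp _ ((halves b).injective.comp Sum.inl_injective)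
  refine funext (Fintype.linearIndependent_iff.1 hli' c ?_)
  rw [← h, Matrix.mulVec_eq_sum]
  exact Finset.sum_congr rfl fun q _ => by simp [leftCols]; rfl

end frames

end

noncomputable section

open VarietyPresentation

attribute [local instance] zariski

theorem eval_comp_X {ι : Type} (t : ι → ℂ) :
    (MvPolynomial.eval t ∘ MvPolynomial.X : ι → ℂ) = t := funext fun c => MvPolynomial.eval_X c

/-! ## Irreducibility of the base -/

/-- Tuples of invertible matrices form a principal open set of affine space and reach every tuple of
flags. -/
theorem irreducible_flagTuple (n s : ℕ) : Irreducible (FlagTuple n s) := by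
  have : Nonempty (FlagTuple n s) := ⟨fun _ => PartialFlag.ofMatrix _ 1 (by simp)⟩
  have hdet : ∀ (t : Fin s × Fin n × Fin n → ℂ) j,
      MvPolynomial.eval t (Matrix.of fun p q => (MvPolynomial.X (j, p, q) :
        MvPolynomial (Fin s × Fin n × Fin n) ℂ)).det = (Matrix.of fun p q => t (j, p, q)).det := by
    intro t j
    rw [RingHom.map_det]
    congr 1
    ext p q
    simp
  have hD : ∀ t : Fin s × Fin n × Fin n → ℂ,
      MvPolynomial.eval t (∏ j, (Matrix.of fun p q => (MvPolynomial.X (j, p, q) :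
        MvPolynomial (Fin s × Fin n × Fin n) ℂ)).det) ≠ 0 ↔
        ∀ j, IsUnit (Matrix.of fun p q => t (j, p, q)).det := by
    intro t
    simp only [map_prod, hdet, Finset.prod_ne_zero_iff, Finset.mem_univ, true_implies,
      isUnit_iff_ne_zero]
  have hX : ∀ t : Fin s × Fin n × Fin n → ℂ, polyMap MvPolynomial.X t = t := fun t =>
    funext fun c => MvPolynomial.eval_X c
  refine irreducible_of_parametrization (X := FlagTuple n s) MvPolynomial.X
    (∏ j, (Matrix.of fun p q => (MvPolynomial.X (j, p, q) :
      MvPolynomial (Fin s × Fin n × Fin n) ℂ)).det) (fun t ht => ?_) fun F => ?_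
  · rw [hX]
    exact (hD t).1 ht
  · choose M hM hF using fun j => PartialFlag.exists_ofMatrix_eq (F j)
    refine ⟨fun c => M c.1 c.2.1 c.2.2, (hD _).2 hM, ?_⟩
    simp only [hX]
    exact funext hF

/-! ## Irreducibility of the total space -/

section total

variable {r b : ℕ} (a : Fin r → ℕ) {R S : Type*} [CommRing R] [CommRing S]

/-- Parameters for the frames of the total space. -/
abbrev IncidenceParam (b : ℕ) : Type :=
  (Fin (2 * b) × Fin (2 * b)) ⊕
    (Fin 4 × ((Fin (2 * b) × Fin b) ⊕ (Fin b × Fin b) ⊕ (Fin (2 * b) × Fin b)))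

namespace IncidenceParam

variable (t : IncidenceParam b → R)

/-- The frame of the partial flag. -/
def flagMatrix : Matrix (Fin (2 * b)) (Fin (2 * b)) R := Matrix.of fun p q => t (Sum.inl (p, q))

/-- The coefficients of an adapted basis of the `b`-plane of the `j`-th flag. -/
def coeffs (j : Fin 4) : Matrix (Fin (2 * b)) (Fin b) R :=
  Matrix.of fun p l => if ∃ i, (l : ℕ) < a i ∧ 2 * a i ≤ p then 0
    else t (Sum.inr (j, Sum.inl (p, l)))

/-- The change of basis of the `b`-plane of the `j`-th flag. -/
def change (j : Fin 4) : Matrix (Fin b) (Fin b) R :=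
  Matrix.of fun p q => t (Sum.inr (j, Sum.inr (Sum.inl (p, q))))

/-- The remaining vectors of the frame of the `j`-th flag. -/
def rest (j : Fin 4) : Matrix (Fin (2 * b)) (Fin b) R :=
  Matrix.of fun p q => t (Sum.inr (j, Sum.inr (Sum.inr (p, q))))

/-- The frames with given parameters. -/
def frame : Option (Fin 4) → Matrix (Fin (2 * b)) (Fin (2 * b)) R
  | none => flagMatrix t
  | some j => joinCols (flagMatrix t * coeffs a t j * change t j) (rest t j)

/-- The product of the determinants that have to be invertible. -/
def disc : R := ∏ o, (frame a t o).det

theorem frame_map (f : R →+* S) (o : Option (Fin 4)) :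
    (frame a t o).map f = frame a (f ∘ t) o := by
  rcases o with _ | j
  · rfl
  · have h : (coeffs a t j).map f = coeffs a (f ∘ t) j := by
      ext p l
      simp only [coeffs, Matrix.map_apply, Matrix.of_apply, apply_ite f, map_zero]
      rfl
    simp only [frame, joinCols_map, Matrix.map_mul, h]
    rfl

theorem map_disc (f : R →+* S) : f (disc a t) = disc a (f ∘ t) := by
  simp only [disc, map_prod, RingHom.map_det, RingHom.mapMatrix_apply, frame_map]

end IncidenceParam

open IncidenceParam

variable {a} {ha : StrictMono a} {hab : ∀ i, a i < b}

/-- The left half of an invertible matrix has independent columns, which forces `H` to be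
invertible. Hence `B` is another basis of the same `b`-plane. -/
theorem linearIndependent_col_of_leftCols_eq {M : Matrix (Fin (2 * b)) (Fin (2 * b)) ℂ}
    (hM : IsUnit M.det) {B : Matrix (Fin (2 * b)) (Fin b) ℂ} {H : Matrix (Fin b) (Fin b) ℂ}
    (h : leftCols M = B * H) : LinearIndependent ℂ B.col ∧ ∀ l, B.col l ∈
      (PartialFlag.ofMatrix (FlagType.complete (2 * b)) M hM).sub (midIndex b) := by
  have hH : IsUnit H.det := by
    rw [isUnit_iff_ne_zero]
    intro h0
    obtain ⟨c, hc, hc0⟩ := Matrix.exists_mulVec_eq_zero_iff.2 h0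
    refine hc (leftCols_mulVec_injective hM ?_)
    rw [h, ← Matrix.mulVec_mulVec, hc0, Matrix.mulVec_zero]
  have hHinv : H * H⁻¹ = 1 := Matrix.mul_nonsing_inv _ hH
  have hBeq : ∀ c, B.mulVec c = (leftCols M).mulVec (H⁻¹.mulVec c) := by
    intro c
    rw [h, Matrix.mulVec_mulVec, Matrix.mul_assoc, hHinv, Matrix.mul_one]
  refine ⟨Matrix.mulVec_injective_iff.1 fun c c' h => ?_, fun l => (mem_mid_ofMatrix hM).2
    ⟨H⁻¹.mulVec (Pi.single l 1), by rw [← hBeq, Matrix.mulVec_single_one]⟩⟩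
  rw [← sub_eq_zero, ← Matrix.mulVec_sub, hBeq] at h
  have h0 := leftCols_mulVec_injective hM h
  have h1 := congrArg H.mulVec h0
  rw [Matrix.mulVec_mulVec, hHinv, Matrix.one_mulVec, Matrix.mulVec_zero] at h1
  exact sub_eq_zero.1 h1

theorem le_finrank_inf_of_leftCols_eq {M : Matrix (Fin (2 * b)) (Fin (2 * b)) ℂ}
    (hM : IsUnit M.det) {B : Matrix (Fin (2 * b)) (Fin b) ℂ} {H : Matrix (Fin b) (Fin b) ℂ}
    (h : leftCols M = B * H) {E : Submodule ℂ (Fin (2 * b) → ℂ)} {d : ℕ} (hd : d ≤ b)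
    (hE : ∀ l : Fin b, (l : ℕ) < d → B.col l ∈ E) :
    d ≤ Module.finrank ℂ
      ↥(E ⊓ (PartialFlag.ofMatrix (FlagType.complete (2 * b)) M hM).sub (midIndex b)) := by
  obtain ⟨hli, hmid⟩ := linearIndependent_col_of_leftCols_eq hM h
  have hc : LinearIndependent ℂ fun l : Fin d => B.col (Fin.castLE hd l) :=
    hli.comp _ (Fin.castLE_injective hd)
  have hmem : Submodule.span ℂ (Set.range fun l : Fin d => B.col (Fin.castLE hd l)) ≤
      E ⊓ (PartialFlag.ofMatrix (FlagType.complete (2 * b)) M hM).sub (midIndex b) := by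
    rw [Submodule.span_le]
    rintro _ ⟨l, rfl⟩
    exact ⟨hE _ l.2, hmid _⟩
  have := Submodule.finrank_mono hmem
  rwa [finrank_span_eq_card hc, Fintype.card_fin] at this

theorem exists_leftCols_eq {F : FlagTuple (2 * b) 4} {j : Fin 4}
    {M : Matrix (Fin (2 * b)) (Fin (2 * b)) ℂ} (hM : IsUnit M.det)
    (hF : PartialFlag.ofMatrix _ M hM = F j) {B : Matrix (Fin (2 * b)) (Fin b) ℂ}
    (hB : LinearIndependent ℂ B.col) (hmid : ∀ l, B.col l ∈ middle F j) :
    ∃ H : Matrix (Fin b) (Fin b) ℂ, leftCols M = B * H := by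
  have hchange : ∀ q, ∃ c : Fin b → ℂ, B.mulVec c = (leftCols M).col q := by
    intro q
    have hspan : Submodule.span ℂ (Set.range B.col) = middle F j := by
      refine Submodule.eq_of_le_of_finrank_eq (Submodule.span_le.2 ?_) ?_
      · rintro _ ⟨l, rfl⟩
        exact hmid l
      · rw [finrank_span_eq_card hB, Fintype.card_fin, finrank_middle]
    have hmem : (leftCols M).col q ∈ middle F j := by
      change _ ∈ (F j).sub (midIndex b)
      rw [← hF, mem_mid_ofMatrix]
      exact ⟨Pi.single q 1, Matrix.mulVec_single_one _ _⟩
    rw [← hspan, Submodule.mem_span_range_iff_exists_fun] at hmem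
    obtain ⟨c, hc⟩ := hmem
    refine ⟨c, ?_⟩
    rw [← hc]
    funext p
    simp [Matrix.mulVec, dotProduct, mul_comm]
  choose H hH using hchange
  refine ⟨(Matrix.of H).transpose, ?_⟩
  ext p q
  exact (congrFun (hH q) p).symm

/-- For `l < a i` the zeros in `coeffs` make column `l` of `flagMatrix * coeffs` a combination of
the first `2 * a i` columns of the flag frame. So `a i` independent vectors of the `b`-plane lie in
the `i`-th member. -/
theorem frame_solution {t : IncidenceParam b → ℂ} (hG : IsUnit (frame a t none).det) {j : Fin 4}
    (hM : IsUnit (frame a t (some j)).det) (i : Fin r) :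
    a i ≤ Module.finrank ℂ ↥((PartialFlag.ofMatrix (doubledType a ha hab) _ hG).sub i ⊓
      (PartialFlag.ofMatrix (FlagType.complete (2 * b)) _ hM).sub (midIndex b)) := by
  refine le_finrank_inf_of_leftCols_eq hM (leftCols_joinCols _ _) (hab i).le fun l hl =>
    (mem_ofMatrix_sub_iff hG).2 ⟨(coeffs a t j).col l, fun p hp => if_pos ⟨i, hl, hp⟩, ?_⟩
  rw [← Matrix.mulVec_single_one, Matrix.mulVec_mulVec, ← Matrix.mulVec_single_one]
  rfl

/-- Greedy choice again: vector `l` is taken from the intersection of `K` with the smallest `E.sub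
i` such that `l < a i`, which has dimension greater than `l` by hypothesis. -/
theorem exists_adapted_basis (E : PartialFlag (doubledType a ha hab))
    {K : Submodule ℂ (Fin (2 * b) → ℂ)} (hK : Module.finrank ℂ K = b)
    (h : ∀ i : Fin r, a i ≤ Module.finrank ℂ ↥(E.sub i ⊓ K)) :
    ∃ k : Fin b → Fin (2 * b) → ℂ, LinearIndependent ℂ k ∧ (∀ l, k l ∈ K) ∧
      ∀ (i : Fin r) (l : Fin b), (l : ℕ) < a i → k l ∈ E.sub i := by
  classical
  obtain ⟨k, hk, hkS⟩ := exists_linearIndependent_mem (K := ℂ) (V := Fin (2 * b) → ℂ)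
    (fun l : Fin b => K ⊓ ⨅ i : {i : Fin r // (l : ℕ) < a i}, E.sub i.1) (fun l : Fin b => by
      by_cases hl : ∃ i : Fin r, (l : ℕ) < a i
      · obtain ⟨i, hi⟩ := hl
        have hne : (Finset.univ.filter fun i => (l : ℕ) < a i).Nonempty := ⟨i, by simpa⟩
        set i₀ := Finset.min' _ hne with hi₀
        have hi₀l : (l : ℕ) < a i₀ := (Finset.mem_filter.1 (Finset.min'_mem _ hne)).2
        have hmin : ∀ j : {i : Fin r // (l : ℕ) < a i}, i₀ ≤ j.1 := fun j =>
          Finset.min'_le _ _ (by simpa using j.2)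
        have hle : E.sub i₀ ⊓ K ≤ K ⊓ ⨅ i : {i : Fin r // (l : ℕ) < a i}, E.sub i.1 :=
          le_inf inf_le_right (inf_le_left.trans
            (le_iInf fun j => E.mono (hmin j)))
        exact (Nat.succ_le_of_lt hi₀l).trans ((h i₀).trans (Submodule.finrank_mono hle))
      · have : IsEmpty {i : Fin r // (l : ℕ) < a i} := ⟨fun i => hl ⟨i.1, i.2⟩⟩
        rw [iInf_of_empty, inf_top_eq, hK]
        exact l.2)
  exact ⟨k, hk, fun l => (hkS l).1, fun i l hl =>
    (Submodule.mem_iInf _).1 (hkS l).2 ⟨i, hl⟩⟩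

/-- Surjectivity of the parametrization. In the frame `G` of `E`, the coefficients of an adapted
basis vector of K^j vanish wherever `coeffs` prescribes zeros, because the vector lies in the
corresponding member of `E`. -/
theorem exists_frame_eq {E : PartialFlag (doubledType a ha hab)} {F : FlagTuple (2 * b) 4}
    (h : ∀ (i : Fin r) (j : Fin 4), a i ≤ Module.finrank ℂ ↥(E.sub i ⊓ middle F j)) :
    ∃ (t : IncidenceParam b → ℂ) (hG : ∀ o, IsUnit (frame a t o).det),
      PartialFlag.ofMatrix _ _ (hG none) = E ∧
        ∀ j, PartialFlag.ofMatrix _ _ (hG (some j)) = F j := by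
  obtain ⟨G, hG, hGE⟩ := E.exists_ofMatrix_eq
  choose M hM hMF using fun j => PartialFlag.exists_ofMatrix_eq (F j)
  choose k hk hkK hkE using fun j => exists_adapted_basis E (finrank_middle F j) fun i => h i j
  have hGinv : G * G⁻¹ = 1 := Matrix.mul_nonsing_inv _ hG
  have hGinv' : G⁻¹ * G = 1 := Matrix.nonsing_inv_mul _ hG
  choose H hHl using fun j => exists_leftCols_eq (hM j) (hMF j)
    (B := Matrix.of fun p l => k j l p) (hk j) (hkK j)
  let t : IncidenceParam b → ℂ := Sum.elim (fun p => G p.1 p.2) fun p =>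
    Sum.elim (fun q => (G⁻¹.mulVec (k p.1 q.2)) q.1)
      (Sum.elim (fun q => H p.1 q.1 q.2) fun q => rightCols (M p.1) q.1 q.2) p.2
  have hN : ∀ j, G * coeffs a t j = Matrix.of fun p l => k j l p := by
    intro j
    have h1 : coeffs a t j = G⁻¹ * Matrix.of fun p l => k j l p := by
      ext p l
      have hcol : (G⁻¹ * Matrix.of fun p l => k j l p) p l = (G⁻¹.mulVec (k j l)) p := rfl
      rw [hcol]
      simp only [coeffs, Matrix.of_apply]
      split_ifs with hp
      · obtain ⟨i, hl, hp⟩ := hp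
        have hmem := hkE j i l hl
        rw [← hGE] at hmem
        obtain ⟨c, hc, hc'⟩ := (mem_ofMatrix_sub_iff hG).1 hmem
        rw [← hc', Matrix.mulVec_mulVec, hGinv', Matrix.one_mulVec, hc p hp]
      · rfl
    rw [h1, ← Matrix.mul_assoc, hGinv, Matrix.one_mul]
  have hframe : ∀ j, frame a t (some j) = M j := by
    intro j
    have h2 : frame a t (some j) = joinCols (G * coeffs a t j * H j) (rightCols (M j)) := rfl
    rw [h2, hN, ← hHl, joinCols_leftCols_rightCols]
  have hframe0 : frame a t none = G := rfl
  have hGt : ∀ o, IsUnit (frame a t o).det := by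
    rintro (_ | j)
    · exact hG
    · rw [hframe]
      exact hM j
  refine ⟨t, hGt, hGE, fun j => ?_⟩
  rw [← hMF j]
  simp only [hframe]

variable {P : SchubertProblem (doubledType a ha hab) 4}

/-- The solutions are those of the Schubert problem `DoubledSchubert.problem`. -/
def IsDoubled (P : SchubertProblem (doubledType a ha hab) 4) : Prop :=
  ∀ (F : FlagTuple (2 * b) 4) (E : PartialFlag (doubledType a ha hab)), E ∈ P.solutions F ↔
    ∀ (i : Fin r) (j : Fin 4), a i ≤ Module.finrank ℂ ↥(E.sub i ⊓ middle F j)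

/-- The parameters are free apart from the invertibility of finitely many determinants, so the
parameter space is a principal open set mapping onto the total space. -/
theorem irreducible_incidence (hP : IsDoubled P) (hne : Nonempty P.Incidence) :
    Irreducible P.Incidence := by
  have hD : ∀ t : IncidenceParam b → ℂ, MvPolynomial.eval t (disc a MvPolynomial.X) ≠ 0 ↔
      ∀ o, IsUnit (frame a t o).det := by
    intro t
    rw [map_disc, eval_comp_X, disc, Finset.prod_ne_zero_iff]
    simp [isUnit_iff_ne_zero]
  let θ : Option (Fin 4) × Fin (2 * b) × Fin (2 * b) → MvPolynomial (IncidenceParam b) ℂ :=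
    fun c => frame a MvPolynomial.X c.1 c.2.1 c.2.2
  have hθ : ∀ t, polyMap θ t = fun c => frame a t c.1 c.2.1 c.2.2 := by
    intro t
    funext c
    have := congrFun (congrFun (frame_map a MvPolynomial.X (MvPolynomial.eval t) c.1) c.2.1) c.2.2
    rw [eval_comp_X] at this
    exact this
  refine irreducible_of_parametrization (X := P.Incidence) θ
    (disc a MvPolynomial.X) (fun t ht => ?_) fun x => ?_
  · have h1 := (hD t).1 ht
    rw [hθ]
    exact ⟨h1, (hP _ _).2 fun i j => frame_solution (h1 none) (h1 (some j)) i⟩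
  · obtain ⟨t, h1, hE, hF⟩ := exists_frame_eq ((hP _ _).1 x.2)
    refine ⟨t, (hD t).2 h1, ?_⟩
    simp only [hθ]
    exact Subtype.ext (Prod.ext hE (funext hF))

/-! ## The projection -/

theorem proj_inducedBy (P : SchubertProblem (doubledType a ha hab) 4) :
    InducedBy (X := P.Incidence) (Z := FlagTuple (2 * b) 4) P.proj
      fun c : Fin 4 × Fin (2 * b) × Fin (2 * b) =>
        (MvPolynomial.X (some c.1, c.2) : VarietyPresentation.Poly P.Incidence) := by
  intro s
  have hs : polyMap (fun c : Fin 4 × Fin (2 * b) × Fin (2 * b) =>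
      (MvPolynomial.X (some c.1, c.2) : VarietyPresentation.Poly P.Incidence)) s.1 =
      fun c => s.1 (some c.1, c.2) :=
    funext fun c => MvPolynomial.eval_X _
  refine ⟨?_, ?_⟩
  · have := s.2.1
    rw [hs]
    exact fun j => this (some j)
  · simp only [hs]
    rfl

/-- The standard flag of subsets. -/
def stdFlag {r : ℕ} (a : Fin r → ℕ) (b : ℕ) (ha : StrictMono a) (hab : ∀ i, a i < b) :
    SubsetFlag a b :=
  ⟨fun i => Finset.univ.filter fun t : Fin b => (t : ℕ) < a i,
    fun i j hij t ht => by
      simp only [Finset.mem_filter, Finset.mem_univ, true_and] at ht ⊢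
      exact ht.trans_le (ha.monotone hij),
    fun i => by rw [Fin.card_filter_val_lt, min_eq_right (hab i).le]⟩

theorem mem_stdFlag {i : Fin r} {t : Fin b} : t ∈ (stdFlag a b ha hab).1 i ↔ (t : ℕ) < a i := by
  simp [stdFlag]

theorem exists_eigenFrame_of_general {F : FlagTuple (2 * b) 4} (hF : F ∈ generalTuples b) :
    ∃ v w μ, IsEigenFrame F v w μ := exists_eigenFrame (fun j => hF.1 j _) hF.2

theorem isCompl_of_general {F : FlagTuple (2 * b) 4} (hF : F ∈ generalTuples b) {i j : Fin 4}
    (hij : i ≠ j) : IsCompl (middle F i) (middle F j) :=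
  middle_isCompl (hF.1 i _) (hF.1 j _) (det_sub_ne_zero hF.2 hij)

/-- Every general instance has a solution, for example the one of the standard flag of subsets; this
yields dominance. -/
theorem generalTuples_subset_range (hP : IsDoubled P) : generalTuples b ⊆ Set.range P.proj := by
  intro F hF
  obtain ⟨v, w, μ, h⟩ := exists_eigenFrame_of_general hF
  obtain ⟨f₃, f₄, -, -, Φ, B, Ψ, -⟩ := h.solutions (hP F)
    (isCompl_of_general hF (show (0 : Fin 4) ≠ 1 by decide)).disjoint
  let E := Φ (Ψ (stdFlag a b ha hab))
  exact ⟨⟨(E.1, F), E.2⟩, rfl⟩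

theorem dense_generalTuples (b : ℕ) : Dense (generalTuples b) := by
  have := irreducible_flagTuple (2 * b) 4
  exact (isOpen_generalTuples b).dense (nonempty_generalTuples b)

/-- The projection of the total space as a dominant morphism. -/
def projMorphism (hP : IsDoubled P) : DominantMorphism P.Incidence (FlagTuple (2 * b) 4) :=
  (proj_inducedBy P).dominantMorphism
    (irreducible_incidence hP <| by
      obtain ⟨F, hF⟩ := nonempty_generalTuples b
      obtain ⟨x, -⟩ := generalTuples_subset_range hP hF
      exact ⟨x⟩)
    (irreducible_flagTuple _ _)
    ((dense_generalTuples b).mono (generalTuples_subset_range hP))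

end total

end

noncomputable section

open VarietyPresentation

attribute [local instance] zariski

/-! ## The space of instances with a numbering of the eigenvectors -/

/-- Coordinates on the space of instances with numbered eigenvectors. -/
inductive CoverParam (b : ℕ) : Type
  | v (p : Fin (2 * b)) (t : Fin b)
  | w (p : Fin (2 * b)) (t : Fin b)
  | eig (t : Fin b)
  | change (j : Fin 4) (s t : Fin b)
  | rest (j : Fin 4) (p : Fin (2 * b)) (t : Fin b)

/-- The positions `2t` and `2t+1`. -/
def interleave (b : ℕ) : Fin b ⊕ Fin b ≃ Fin (2 * b) where
  toFun := Sum.elim (fun t => ⟨2 * t, by omega⟩) fun t => ⟨2 * t + 1, by omega⟩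
  invFun p := if (p : ℕ) % 2 = 0 then Sum.inl ⟨p / 2, by omega⟩ else Sum.inr ⟨p / 2, by omega⟩
  left_inv := by
    rintro (t | t)
    · simp
    · have h1 : (2 * (t : ℕ) + 1) % 2 ≠ 0 := by omega
      have h2 : (2 * (t : ℕ) + 1) / 2 = t := by omega
      simp [h2, Nat.add_mod]
  right_inv p := by
    dsimp only
    split_ifs with h
    · simp only [Sum.elim_inl, Fin.ext_iff]
      omega
    · simp only [Sum.elim_inr, Fin.ext_iff]
      omega

/-- The interleaved order makes the first `2 * d` columns of the flag frame the vectors `v t` and `w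
t` with `t < d`. -/
theorem interleave_lt_iff {b : ℕ} (x : Fin b ⊕ Fin b) (d : ℕ) :
    (interleave b x : ℕ) < 2 * d ↔ (Sum.elim Fin.val Fin.val x : ℕ) < d := by
  rcases x with t | t
  · change 2 * (t : ℕ) < 2 * d ↔ (t : ℕ) < d
    omega
  · change 2 * (t : ℕ) + 1 < 2 * d ↔ (t : ℕ) < d
    omega

set_option linter.unusedSectionVars false

namespace CoverParam

variable {b : ℕ} {R S : Type*} [CommRing R] [CommRing S] (y : CoverParam b → R)

/-- The vectors in the first `b`-plane. -/
def vMat : Matrix (Fin (2 * b)) (Fin b) R := Matrix.of fun p t => y (v p t)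

/-- The vectors in the second `b`-plane. -/
def wMat : Matrix (Fin (2 * b)) (Fin b) R := Matrix.of fun p t => y (w p t)

/-- The adapted bases of the four `b`-planes. -/
def base (j : Fin 4) : Matrix (Fin (2 * b)) (Fin b) R :=
  ![vMat y, wMat y, vMat y + wMat y, vMat y * Matrix.diagonal (fun t => y (eig t)) + wMat y] j

/-- The frame whose columns are the vectors of the first two `b`-planes. -/
def flagMatrix : Matrix (Fin (2 * b)) (Fin (2 * b)) R :=
  (Matrix.fromCols (vMat y) (wMat y)).submatrix id (interleave b).symm

/-- The frames of the flags. -/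
def frame : Option (Fin 4) → Matrix (Fin (2 * b)) (Fin (2 * b)) R
  | none => flagMatrix y
  | some j => joinCols (base y j * Matrix.of fun s t => y (change j s t))
      (Matrix.of fun p t => y (rest j p t))

/-- The product of the determinants of the frames and the differences of the eigenvalues. -/
def disc : R := (∏ o, (frame y o).det) *
  ∏ p : {p : Fin b × Fin b // p.1 ≠ p.2}, (y (eig p.1.1) - y (eig p.1.2))

theorem base_map (f : R →+* S) (j : Fin 4) : (base y j).map f = base (f ∘ y) j := by
  fin_cases j
  · rfl
  · rfl
  · ext p q
    simp [base, vMat, wMat]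
  · ext p q
    simp [base, vMat, wMat]

theorem frame_map (f : R →+* S) (o : Option (Fin 4)) : (frame y o).map f = frame (f ∘ y) o := by
  rcases o with _ | j
  · ext p q
    obtain ⟨x | x, rfl⟩ := (interleave b).surjective q <;>
      simp [frame, flagMatrix, vMat, wMat]
  · simp only [frame, joinCols_map, Matrix.map_mul, base_map]
    rfl

theorem map_disc (f : R →+* S) : f (disc y) = disc (f ∘ y) := by
  simp only [disc, map_mul, map_prod, RingHom.map_det, RingHom.mapMatrix_apply, frame_map, map_sub]
  rfl

theorem flagMatrix_col_inl (t : Fin b) :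
    (flagMatrix y).col (interleave b (Sum.inl t)) = (vMat y).col t := by
  ext p
  simp [flagMatrix]

theorem flagMatrix_col_inr (t : Fin b) :
    (flagMatrix y).col (interleave b (Sum.inr t)) = (wMat y).col t := by
  ext p
  simp [flagMatrix]

/-- Renumbering of the eigenvectors. -/
def rename (σ : Equiv.Perm (Fin b)) : CoverParam b → CoverParam b
  | v p t => v p (σ t)
  | w p t => w p (σ t)
  | eig t => eig (σ t)
  | change j s t => change j (σ s) t
  | rest j p t => rest j p t

/-- The rows of the change of basis are permuted together with the columns of the basis, so their
product is unchanged. Hence renumbering does not move the four flags. -/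
theorem frame_some_comp_rename (σ : Equiv.Perm (Fin b)) (j : Fin 4) :
    frame (y ∘ rename σ) (some j) = frame y (some j) := by
  have h : ∀ p s, base (y ∘ rename σ) j p s = base y j p (σ s) := by
    intro p s
    fin_cases j
    · rfl
    · rfl
    · rfl
    · simp [base, vMat, wMat, rename]
  simp only [frame]
  congr 1
  ext p t
  simp only [Matrix.mul_apply, h]
  exact Equiv.sum_comp σ fun s => base y j p s * y (change j s t)

theorem flagMatrix_comp_rename (σ : Equiv.Perm (Fin b)) :
    flagMatrix (y ∘ rename σ) = (flagMatrix y).submatrix id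
      (((interleave b).symm.trans (Equiv.sumCongr σ σ)).trans (interleave b)) := by
  ext p q
  obtain ⟨x | x, rfl⟩ := (interleave b).surjective q <;>
    simp [flagMatrix, vMat, wMat, rename]

/-- The conditions that define the space of instances with numbered eigenvectors. -/
def Good (y : CoverParam b → ℂ) : Prop :=
  (∀ o, IsUnit (frame y o).det) ∧ Function.Injective fun t => y (eig t)

theorem disc_ne_zero_iff (y : CoverParam b → ℂ) : disc y ≠ 0 ↔ Good y := by
  rw [disc, mul_ne_zero_iff, Finset.prod_ne_zero_iff, Finset.prod_ne_zero_iff, Good]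
  simp only [isUnit_iff_ne_zero, Finset.mem_univ, true_implies, sub_ne_zero]
  refine and_congr_right fun _ => ⟨fun h s t hst => ?_, fun h p hp => p.2 (h hp)⟩
  by_contra hne
  exact h ⟨(s, t), hne⟩ hst

/-- Only the frame of the partial flag changes; its columns are permuted, so its determinant changes
by a sign. -/
theorem Good.comp_rename {y : CoverParam b → ℂ} (hy : Good y) (σ : Equiv.Perm (Fin b)) :
    Good (y ∘ rename σ) := by
  refine ⟨?_, fun s t h => σ.injective (hy.2 h)⟩
  rintro (_ | j)
  · change IsUnit (flagMatrix _).det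
    rw [flagMatrix_comp_rename, Matrix.det_permute']
    have h1 : IsUnit (flagMatrix y).det := hy.1 none
    rw [isUnit_iff_ne_zero] at h1 ⊢
    refine mul_ne_zero ?_ h1
    rcases Int.units_eq_one_or (Equiv.Perm.sign
      (((interleave b).symm.trans (Equiv.sumCongr σ σ)).trans (interleave b))) with h | h <;>
      rw [h] <;> simp
  · rw [frame_some_comp_rename]
    exact hy.1 (some j)

end CoverParam

open CoverParam

/-- The space of instances with numbered eigenvectors. -/
def CoverSpace (b : ℕ) : Type := {y : CoverParam b → ℂ // Good y}

instance (b : ℕ) : VarietyPresentation (CoverSpace b) where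
  coord := CoverParam b
  frames := {y | Good y}
  point y := ⟨y.1, y.2⟩

section cover

variable {r b : ℕ} {a : Fin r → ℕ} {ha : StrictMono a} {hab : ∀ i, a i < b}
  {P : SchubertProblem (doubledType a ha hab) 4}

theorem base_mem_sub {y : CoverParam b → ℂ} (hG : IsUnit (frame y none).det) (i : Fin r)
    (j : Fin 4) {l : Fin b} (hl : (l : ℕ) < a i) :
    (base y j).col l ∈ (PartialFlag.ofMatrix (doubledType a ha hab) _ hG).sub i := by
  have hv : (vMat y).col l ∈ (PartialFlag.ofMatrix (doubledType a ha hab) _ hG).sub i := by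
    rw [← flagMatrix_col_inl]
    exact PartialFlag.col_mem_ofMatrix hG ((interleave_lt_iff (Sum.inl l) _).2 hl)
  have hw : (wMat y).col l ∈ (PartialFlag.ofMatrix (doubledType a ha hab) _ hG).sub i := by
    rw [← flagMatrix_col_inr]
    exact PartialFlag.col_mem_ofMatrix hG ((interleave_lt_iff (Sum.inr l) _).2 hl)
  fin_cases j
  · exact hv
  · exact hw
  · exact Submodule.add_mem _ hv hw
  · convert Submodule.add_mem _ (Submodule.smul_mem _ (y (eig l)) hv) hw using 1
    ext p
    simp [base, mul_comm]

/-- The solution and the instance with given parameters. -/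
def coverMap (hP : IsDoubled P) (y : CoverSpace b) : P.Incidence :=
  ⟨(PartialFlag.ofMatrix _ _ (y.2.1 none), fun j => PartialFlag.ofMatrix _ _ (y.2.1 (some j))),
    (hP _ _).2 fun i j => le_finrank_inf_of_leftCols_eq (y.2.1 (some j)) (leftCols_joinCols _ _)
      (hab i).le fun _ hl => base_mem_sub (y.2.1 none) i j hl⟩

theorem eval_frame_X {y : CoverParam b → ℂ} :
    polyMap (fun c : Option (Fin 4) × Fin (2 * b) × Fin (2 * b) =>
      (frame MvPolynomial.X c.1 c.2.1 c.2.2 : MvPolynomial (CoverParam b) ℂ)) y =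
      fun c => frame y c.1 c.2.1 c.2.2 := by
  funext c
  have := congrFun (congrFun (CoverParam.frame_map MvPolynomial.X (MvPolynomial.eval y) c.1) c.2.1)
    c.2.2
  rw [eval_comp_X] at this
  exact this

theorem coverMap_inducedBy (hP : IsDoubled P) :
    InducedBy (X := CoverSpace b) (Z := P.Incidence) (coverMap hP)
      fun c : Option (Fin 4) × Fin (2 * b) × Fin (2 * b) =>
        (frame MvPolynomial.X c.1 c.2.1 c.2.2 : MvPolynomial (CoverParam b) ℂ) := by
  intro y
  refine ⟨?_, ?_⟩
  · rw [eval_frame_X]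
    exact ⟨y.2.1, (coverMap hP ⟨y.1, y.2⟩).2⟩
  · have h := eval_frame_X (y := y.1)
    simp only [h]
    rfl

theorem irreducible_coverSpace (hne : Nonempty (CoverSpace b)) : Irreducible (CoverSpace b) := by
  have hD : ∀ t : CoverParam b → ℂ, MvPolynomial.eval t (disc MvPolynomial.X) ≠ 0 ↔ Good t := by
    intro t
    rw [CoverParam.map_disc, eval_comp_X, disc_ne_zero_iff]
  have hX : ∀ t : CoverParam b → ℂ, polyMap MvPolynomial.X t = t := fun t =>
    funext fun c => MvPolynomial.eval_X c
  refine irreducible_of_parametrization (X := CoverSpace b) MvPolynomial.X (disc MvPolynomial.X)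
    (fun t ht => ?_) fun y => ⟨y.1, (hD _).2 y.2, ?_⟩
  · rw [hX]
    exact (hD t).1 ht
  · simp only [hX]
    rfl

/-! ### The action of the symmetric group -/

/-- Renumbering of the eigenvectors. -/
def coverPerm (σ : Equiv.Perm (Fin b)) (y : CoverSpace b) : CoverSpace b :=
  ⟨y.1 ∘ rename σ, y.2.comp_rename σ⟩

theorem coverPerm_inducedBy (σ : Equiv.Perm (Fin b)) :
    InducedBy (X := CoverSpace b) (Z := CoverSpace b) (coverPerm σ)
      fun c : CoverParam b => (MvPolynomial.X (rename σ c) : MvPolynomial (CoverParam b) ℂ) := by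
  intro y
  have h : polyMap (fun c : CoverParam b =>
      (MvPolynomial.X (rename σ c) : MvPolynomial (CoverParam b) ℂ)) y.1 = y.1 ∘ rename σ :=
    funext fun c => MvPolynomial.eval_X _
  refine ⟨?_, ?_⟩
  · rw [h]
    exact y.2.comp_rename σ
  · simp only [h]
    rfl

theorem coverPerm_surjective (σ : Equiv.Perm (Fin b)) : Function.Surjective (coverPerm σ) := by
  intro y
  refine ⟨coverPerm σ⁻¹ y, Subtype.ext (funext fun c => ?_)⟩
  change y.1 (rename σ⁻¹ (rename σ c)) = y.1 c
  cases c <;> simp [rename]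

theorem proj_coverMap_coverPerm (hP : IsDoubled P) (σ : Equiv.Perm (Fin b)) (y : CoverSpace b) :
    P.proj (coverMap hP (coverPerm σ y)) = P.proj (coverMap hP y) := by
  funext j
  change PartialFlag.ofMatrix _ (frame (y.1 ∘ rename σ) (some j)) ((coverPerm σ y).2.1 (some j)) =
    PartialFlag.ofMatrix _ (frame y.1 (some j)) (y.2.1 (some j))
  simp only [frame_some_comp_rename]

theorem sub_coverMap (hP : IsDoubled P) (y : CoverSpace b) (i : Fin r) :
    (coverMap hP y).1.1.sub i = Submodule.span ℂ
      ((vMat y.1).col '' {t | (t : ℕ) < a i} ∪ (wMat y.1).col '' {t | (t : ℕ) < a i}) := by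
  refine le_antisymm (Submodule.span_le.2 ?_) (Submodule.span_le.2 ?_)
  · rintro _ ⟨⟨q, hq⟩, rfl⟩
    refine Submodule.subset_span ?_
    obtain ⟨x, rfl⟩ := (interleave b).surjective q
    have hx := (interleave_lt_iff x (a i)).1 hq
    rcases x with t | t
    · exact Or.inl ⟨t, hx, (flagMatrix_col_inl _ _).symm⟩
    · exact Or.inr ⟨t, hx, (flagMatrix_col_inr _ _).symm⟩
  · rintro _ (⟨t, ht, rfl⟩ | ⟨t, ht, rfl⟩)
    · exact base_mem_sub (y.2.1 none) i 0 ht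
    · exact base_mem_sub (y.2.1 none) i 1 ht

/-- A permutation preserving the standard flag of subsets only reorders the vectors within each
span. -/
theorem coverMap_coverPerm (hP : IsDoubled P) {σ : Equiv.Perm (Fin b)}
    (hσ : (stdFlag a b ha hab).act σ = stdFlag a b ha hab) (y : CoverSpace b) :
    coverMap hP (coverPerm σ y) = coverMap hP y := by
  refine Subtype.ext (Prod.ext (PartialFlag.ext (funext fun i => ?_))
    (proj_coverMap_coverPerm hP σ y))
  have himage : σ '' {t : Fin b | (t : ℕ) < a i} = {t : Fin b | (t : ℕ) < a i} := by
    have h := congrArg (fun T : SubsetFlag a b => (T.1 i : Set (Fin b))) hσ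
    simpa [SubsetFlag.act, stdFlag] using h
  refine (sub_coverMap hP (coverPerm σ y) i).trans ((sub_coverMap hP y i).trans ?_).symm
  conv_lhs => rw [← himage, Set.image_image, Set.image_image]
  rfl

/-- The vectors `v t` and `w t` are independent, so already at one point the spans determine which
indices occur. -/
theorem act_stdFlag_eq_of_sub_eq (hP : IsDoubled P) {σ : Equiv.Perm (Fin b)} {y : CoverSpace b}
    (h : ∀ i, (coverMap hP (coverPerm σ y)).1.1.sub i = (coverMap hP y).1.1.sub i) :
    (stdFlag a b ha hab).act σ = stdFlag a b ha hab := by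
  refine Subtype.ext (funext fun i => Finset.eq_of_subset_of_card_le ?_ ?_)
  · intro s hs
    obtain ⟨t, ht, rfl⟩ := Finset.mem_map.1 hs
    have hmem : (vMat y.1).col (σ t) ∈ (coverMap hP y).1.1.sub i := by
      rw [← h i]
      exact base_mem_sub ((coverPerm σ y).2.1 none) i 0 (mem_stdFlag.1 ht)
    rw [← flagMatrix_col_inl] at hmem
    have hli : LinearIndependent ℂ (flagMatrix y.1).col := Matrix.linearIndependent_cols_of_isUnit
      ((Matrix.isUnit_iff_isUnit_det _).2 (y.2.1 none))
    change σ t ∈ _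
    rw [mem_stdFlag]
    by_contra hlt
    refine hli.notMem_span_image (s := {q | (q : ℕ) < 2 * a i})
      (x := interleave b (Sum.inl (σ t))) (fun hx => hlt ((interleave_lt_iff _ _).1 hx)) ?_
    have hset : (flagMatrix y.1).col '' {q | (q : ℕ) < 2 * a i} =
        Set.range fun l : {l : Fin (2 * b) // (l : ℕ) < 2 * a i} => (flagMatrix y.1).col l.1 :=
      Set.image_eq_range _ _
    rw [hset]
    exact hmem
  · exact (((stdFlag a b ha hab).2.2 i).trans (((stdFlag a b ha hab).act σ).2.2 i).symm).le

end cover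

/-! ### The action on flags of subsets -/

section subsetFlag

variable {r b : ℕ} {a : Fin r → ℕ} {ha : StrictMono a} {hab : ∀ i, a i < b}

/-- Sort [b] by the number of members of `T` that omit an element. As `T` is nested, each `T_i` is
an initial segment for this order. -/
theorem exists_act_stdFlag_eq (T : SubsetFlag a b) :
    ∃ σ : Equiv.Perm (Fin b), (stdFlag a b ha hab).act σ = T := by
  let f : Fin b → ℕ := fun t => (Finset.univ.filter fun i => t ∉ T.1 i).card
  have hf : ∀ {i s t}, f s ≤ f t → t ∈ T.1 i → s ∈ T.1 i := by
    intro i s t hle ht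
    by_contra hs
    have h1 : (Finset.Iic i).card ≤ f s := Finset.card_le_card fun j hj => by
      simp only [Finset.mem_filter, Finset.mem_univ, true_and]
      exact fun hsj => hs (T.2.1 (Finset.mem_Iic.1 hj) hsj)
    have h2 : f t ≤ (Finset.Iio i).card := Finset.card_le_card fun j hj => by
      simp only [Finset.mem_filter, Finset.mem_univ, true_and] at hj
      rw [Finset.mem_Iio]
      by_contra hij
      exact hj (T.2.1 (not_lt.1 hij) ht)
    rw [Fin.card_Iic] at h1
    rw [Fin.card_Iio] at h2
    omega
  refine ⟨Tuple.sort f, Subtype.ext (funext fun i => Finset.eq_of_subset_of_card_le ?_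
    ((T.2.2 i).trans (((stdFlag a b ha hab).act (Tuple.sort f)).2.2 i).symm).le)⟩
  intro s hs
  obtain ⟨t, ht, rfl⟩ := Finset.mem_map.1 hs
  have ht' : (t : ℕ) < a i := mem_stdFlag.1 ht
  change Tuple.sort f t ∈ T.1 i
  by_contra hnot
  -- If the element sorted to place `t` is not in `T_i`, all of `T_i` is sorted to places before
  -- `t`, and these are fewer than `a i`.
  have hsub : (T.1 i).map (Tuple.sort f).symm.toEmbedding ⊆ Finset.Iio t := by
    intro u hu
    obtain ⟨s, hs, rfl⟩ := Finset.mem_map.1 hu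
    rw [Finset.mem_Iio]
    by_contra hlt
    refine hnot (hf ?_ hs)
    have := Tuple.monotone_sort f (not_lt.1 hlt)
    simpa using this
  have := Finset.card_le_card hsub
  rw [Finset.card_map, T.2.2 i, Fin.card_Iio] at this
  omega

theorem act_mul (σ τ : Equiv.Perm (Fin b)) (T : SubsetFlag a b) :
    T.act (σ * τ) = (T.act τ).act σ :=
  Subtype.ext (funext fun i => by
    change (T.1 i).map _ = ((T.1 i).map _).map _
    rw [Finset.map_map]
    rfl)

theorem act_one (T : SubsetFlag a b) : T.act 1 = T :=
  Subtype.ext (funext fun i => by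
    change (T.1 i).map (Equiv.refl (Fin b)).toEmbedding = T.1 i
    rw [Equiv.refl_toEmbedding, Finset.map_refl])

/-- If `σ t ≠ t`, some flag of subsets has a first member containing `t` but not `σ t`: that member
is nonempty and proper because `1 ≤ a i < b`. -/
theorem eq_one_of_act_eq (hr : 0 < r) (ha : StrictMono a) (ha1 : ∀ i, 1 ≤ a i)
    (hab : ∀ i, a i < b) {σ : Equiv.Perm (Fin b)} (h : ∀ T : SubsetFlag a b, T.act σ = T) :
    σ = 1 := by
  by_contra hσ
  obtain ⟨t, ht⟩ : ∃ t, σ t ≠ t := by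
    by_contra! hc
    exact hσ (Equiv.ext hc)
  let i : Fin r := ⟨0, hr⟩
  have hb := hab i
  have h1 := ha1 i
  let first : Fin b := ⟨0, by omega⟩
  let last : Fin b := ⟨b - 1, by omega⟩
  have hne : first ≠ last := by
    simp only [first, last, ne_eq, Fin.mk.injEq]
    omega
  -- The first swap sends `first` to `t`; the second corrects the image of `last` without moving
  -- `t`.
  obtain ⟨g, hg1, hg2⟩ : ∃ g : Equiv.Perm (Fin b), g first = t ∧ g last = σ t := by
    refine ⟨Equiv.swap (Equiv.swap first t last) (σ t) * Equiv.swap first t, ?_, ?_⟩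
    · rw [Equiv.Perm.mul_apply, Equiv.swap_apply_left]
      refine Equiv.swap_apply_of_ne_of_ne (fun h => hne ?_) ht.symm
      rw [← Equiv.swap_apply_left first t] at h
      exact (Equiv.swap first t).injective h
    · rw [Equiv.Perm.mul_apply, Equiv.swap_apply_left]
  have hT := congrArg (fun T : SubsetFlag a b => T.1 i) (h ((stdFlag a b ha hab).act g))
  have hmem : t ∈ ((stdFlag a b ha hab).act g).1 i := by
    rw [← hg1]
    exact Finset.mem_map_of_mem _ (mem_stdFlag.2 h1)
  have hmem' : σ t ∈ ((stdFlag a b ha hab).act g).1 i := by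
    rw [← hT]
    exact Finset.mem_map_of_mem _ hmem
  rw [← hg2] at hmem'
  obtain ⟨s, hs, hs'⟩ := Finset.mem_map.1 hmem'
  have : s = last := g.injective hs'
  rw [this, mem_stdFlag] at hs
  change b - 1 < a i at hs
  omega

end subsetFlag

/-! ### The image of the cover -/

section image

variable {r b : ℕ} {a : Fin r → ℕ} {ha : StrictMono a} {hab : ∀ i, a i < b}
  {P : SchubertProblem (doubledType a ha hab) 4}

theorem linearIndependent_smul_add {V : Type*} [AddCommGroup V] [Module ℂ V] {v w : Fin b → V}
    (h : LinearIndependent ℂ (Sum.elim v w)) (μ : Fin b → ℂ) :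
    LinearIndependent ℂ fun t => μ t • v t + w t := by
  rw [Fintype.linearIndependent_iff] at h ⊢
  intro c hc t
  refine h (Sum.elim (fun t => c t * μ t) c) ?_ (Sum.inr t)
  rw [Fintype.sum_sum_type, ← hc]
  simp [mul_smul, Finset.sum_add_distrib]

/-- The solution is spanned by the eigenvectors indexed by a flag of subsets. After renumbering this
is the standard flag, and the frames of the four flags supply the remaining coordinates. -/
theorem preimage_general_subset_range (hP : IsDoubled P) :
    P.proj ⁻¹' generalTuples b ⊆ Set.range (coverMap hP) := by
  rintro ⟨⟨E, F⟩, hE⟩ hF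
  have hF' : F ∈ generalTuples b := hF
  obtain ⟨v₀, w₀, μ₀, h₀⟩ := exists_eigenFrame_of_general hF'
  obtain ⟨T, hT⟩ := h₀.exists_subsetFlag (hP F)
    (isCompl_of_general hF' (show (0 : Fin 4) ≠ 1 by decide)).disjoint hE
  obtain ⟨σ, hσ⟩ := exists_act_stdFlag_eq (ha := ha) (hab := hab) T
  let v := v₀ ∘ σ
  let w := w₀ ∘ σ
  let μ := μ₀ ∘ σ
  have hvw : LinearIndependent ℂ (Sum.elim v w) := by
    have : Sum.elim v w = Sum.elim v₀ w₀ ∘ Sum.map σ σ := by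
      funext x
      rcases x with x | x <;> rfl
    rw [this]
    exact h₀.linearIndependent.comp _ (Sum.map_injective.2 ⟨σ.injective, σ.injective⟩)
  have hE' : ∀ i (t : Fin b), (t : ℕ) < a i → v t ∈ E.sub i ∧ w t ∈ E.sub i := by
    intro i t ht
    refine hT i (σ t) ?_
    rw [← hσ]
    exact Finset.mem_map_of_mem _ (mem_stdFlag.2 ht)
  choose M hM hMF using fun j => PartialFlag.exists_ofMatrix_eq (F j)
  -- `base` depends only on `v`, `w` and `eig`; the zeros in the other coordinates are placeholders.
  let B : Fin 4 → Matrix (Fin (2 * b)) (Fin b) ℂ := base fun c => match c with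
    | .v p t => v t p
    | .w p t => w t p
    | .eig t => μ t
    | .change _ _ _ => 0
    | .rest _ _ _ => 0
  have hB0 : (B 0).col = v := rfl
  have hB1 : (B 1).col = w := rfl
  have hB2 : (B 2).col = fun t => v t + w t := rfl
  have hB3 : (B 3).col = fun t => μ t • v t + w t := by
    funext t p
    simp [B, base, vMat, wMat, mul_comm]
  have hBli : ∀ j, LinearIndependent ℂ (B j).col := by
    intro j
    fin_cases j
    · change LinearIndependent ℂ (B 0).col
      rw [hB0]
      exact hvw.comp Sum.inl Sum.inl_injective
    · change LinearIndependent ℂ (B 1).col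
      rw [hB1]
      exact hvw.comp Sum.inr Sum.inr_injective
    · change LinearIndependent ℂ (B 2).col
      rw [hB2]
      simpa using linearIndependent_smul_add hvw 1
    · change LinearIndependent ℂ (B 3).col
      rw [hB3]
      exact linearIndependent_smul_add hvw μ
  have hBmem : ∀ j l, (B j).col l ∈ middle F j := by
    intro j l
    fin_cases j
    · exact h₀.mem_zero (σ l)
    · exact h₀.mem_one (σ l)
    · exact h₀.mem_two (σ l)
    · change (B 3).col l ∈ middle F 3
      rw [hB3]
      exact h₀.mem_three (σ l)
  choose H hH using fun j => exists_leftCols_eq (hM j) (hMF j) (hBli j) (hBmem j)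
  let y : CoverParam b → ℂ := fun c => match c with
    | .v p t => v t p
    | .w p t => w t p
    | .eig t => μ t
    | .change j s t => H j s t
    | .rest j p t => rightCols (M j) p t
  have hframe : ∀ j, frame y (some j) = M j := by
    intro j
    have : frame y (some j) = joinCols (B j * H j) (rightCols (M j)) := rfl
    rw [this, ← hH, joinCols_leftCols_rightCols]
  have hG : IsUnit (frame y none).det := by
    rw [← Matrix.isUnit_iff_isUnit_det]
    refine Matrix.linearIndependent_cols_iff_isUnit.1 ?_
    have : (flagMatrix y).col = Sum.elim v w ∘ (interleave b).symm := by
      funext q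
      obtain ⟨x | x, rfl⟩ := (interleave b).surjective q
      · rw [flagMatrix_col_inl]
        simp only [Function.comp, Equiv.symm_apply_apply]
        rfl
      · rw [flagMatrix_col_inr]
        simp only [Function.comp, Equiv.symm_apply_apply]
        rfl
    change LinearIndependent ℂ (flagMatrix y).col
    rw [this]
    exact hvw.comp _ (interleave b).symm.injective
  have hgood : Good y := by
    refine ⟨?_, h₀.injective.comp σ.injective⟩
    rintro (_ | j)
    · exact hG
    · rw [hframe]
      exact hM j
  refine ⟨⟨y, hgood⟩, Subtype.ext (Prod.ext (PartialFlag.ofMatrix_eq_of_mem hG E fun i q hq => ?_)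
    (funext fun j => ?_))⟩
  · obtain ⟨x, rfl⟩ := (interleave b).surjective q
    have hx := (interleave_lt_iff x (a i)).1 hq
    rcases x with t | t
    · rw [show (frame y none).col (interleave b (Sum.inl t)) = v t from flagMatrix_col_inl y t]
      exact (hE' i t hx).1
    · rw [show (frame y none).col (interleave b (Sum.inr t)) = w t from flagMatrix_col_inr y t]
      exact (hE' i t hx).2
  · change PartialFlag.ofMatrix _ (frame y (some j)) (hgood.1 (some j)) = F j
    rw [← hMF j]
    simp only [hframe]

theorem nonempty_coverSpace (hP : IsDoubled P) : Nonempty (CoverSpace b) := by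
  obtain ⟨F, hF⟩ := nonempty_generalTuples b
  obtain ⟨x, rfl⟩ := generalTuples_subset_range hP hF
  obtain ⟨y, -⟩ := preimage_general_subset_range hP hF
  exact ⟨y⟩

/-- The cover as a dominant morphism. -/
def coverMorphism (hP : IsDoubled P) : DominantMorphism (CoverSpace b) P.Incidence :=
  (coverMap_inducedBy hP).dominantMorphism (irreducible_coverSpace (nonempty_coverSpace hP))
    (projMorphism hP).irreducible_source
    (((projMorphism hP).preimage_dense (isOpen_generalTuples b) (dense_generalTuples b)).mono
      (preimage_general_subset_range hP))

/-- The action of a permutation as a dominant morphism. -/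
def permMorphism (hP : IsDoubled P) (σ : Equiv.Perm (Fin b)) :
    DominantMorphism (CoverSpace b) (CoverSpace b) :=
  (coverPerm_inducedBy σ).dominantMorphism (irreducible_coverSpace (nonempty_coverSpace hP))
    (irreducible_coverSpace (nonempty_coverSpace hP)) (coverPerm_surjective σ).denseRange

end image

end

noncomputable section

/-! ## Galois groups from roots of a polynomial -/

section galois

open Polynomial IntermediateField

variable {K L A ι : Type*} [Field K] [Field L] [Field A] [Algebra K L] [Algebra K A]

variable [Fintype ι] {eig : ι → A} {χ : K[X]}

theorem isGalois_adjoin_roots (hinj : Function.Injective eig)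
    (hχ : χ.map (algebraMap K A) = ∏ t, (X - C (eig t))) :
    FiniteDimensional K (adjoin K (Set.range eig)) ∧ IsGalois K (adjoin K (Set.range eig)) := by
  have hsplit : (χ.map (algebraMap K A)).Splits := by
    rw [hχ]
    exact Splits.prod fun t _ => Splits.X_sub_C _
  have hne : χ ≠ 0 := by
    rintro rfl
    rw [Polynomial.map_zero] at hχ
    exact (monic_prod_of_monic _ _ fun t _ => monic_X_sub_C (eig t)).ne_zero hχ.symm
  have hroots : χ.rootSet A = Set.range eig := by
    ext x
    rw [mem_rootSet_of_ne hne, ← eval_map_algebraMap, hχ, eval_prod, Finset.prod_eq_zero_iff]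
    simp [sub_eq_zero, eq_comm]
  have hsep : χ.Separable := by
    rw [← separable_map (algebraMap K A), hχ]
    exact separable_prod_X_sub_C_iff.2 hinj
  have h : χ.IsSplittingField K (adjoin K (χ.rootSet A)) := adjoin_rootSet_isSplittingField hsplit
  rw [hroots] at h
  exact ⟨h.finiteDimensional _ χ, IsGalois.of_separable_splitting_field hsep⟩

variable [Algebra L A] [IsScalarTower K L A] {Y : Type*} [MulAction (Equiv.Perm ι) Y]

/-- `A` need not be algebraic over `K`: the argument takes place in the subfield `M` generated by
the roots. The maps `τ` realize every permutation of the roots, so Gal(M/K) is the full symmetric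
group. Orbit and stabilizer of `y₀` identify the embeddings of `L` with `Y`, and faithfulness makes
`M` the normal closure. -/
theorem exists_gal_equiv [FaithfulSMul (Equiv.Perm ι) Y] (hinj : Function.Injective eig)
    (hχ : χ.map (algebraMap K A) = ∏ t, (X - C (eig t))) (τ : Equiv.Perm ι → A →ₐ[K] A)
    (hτ : ∀ σ t, τ σ (eig t) = eig (σ t)) (y₀ : Y)
    (htrans : ∀ y : Y, ∃ σ : Equiv.Perm ι, σ • y₀ = y)
    (hfix : ∀ σ, (∀ x, τ σ (algebraMap L A x) = algebraMap L A x) ↔ σ • y₀ = y₀)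
    (hL : ∀ x, algebraMap L A x ∈ adjoin K (Set.range eig)) :
    FiniteDimensional K L ∧
      ∃ (e : (normalClosure K L (AlgebraicClosure L) ≃ₐ[K] normalClosure K L (AlgebraicClosure L))
          ≃* Equiv.Perm ι) (ε : (L →ₐ[K] normalClosure K L (AlgebraicClosure L)) ≃ Y),
        ∀ g x, ε (g.toAlgHom.comp x) = e g • ε x := by
  obtain ⟨hfin, hgal⟩ := isGalois_adjoin_roots hinj hχ
  set M := adjoin K (Set.range eig) with hM
  let j : L →ₐ[K] M := (IsScalarTower.toAlgHom K L A).codRestrict M.toSubalgebra hL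
  have hj : ∀ x, algebraMap M A (j x) = algebraMap L A x := fun x => rfl
  have hfinL : FiniteDimensional K L :=
    FiniteDimensional.of_injective j.toLinearMap j.toRingHom.injective
  let root : ι → M := fun t => ⟨eig t, subset_adjoin K _ ⟨t, rfl⟩⟩
  have hext : ∀ g h : M →ₐ[K] M, (∀ t, g (root t) = h (root t)) → g = h := by
    intro g h hgh
    refine algHom_ext_of_eq_adjoin K (S := M) (s := Set.range eig) rfl ?_
    rintro _ ⟨t, rfl⟩
    exact hgh t
  -- `M` is normal over `K`, so every `τ σ` restricts to an automorphism of it.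
  let ψ : Equiv.Perm ι → (M ≃ₐ[K] M) := fun σ => (τ σ).restrictNormal' M
  have hψ : ∀ σ x, algebraMap M A (ψ σ x) = τ σ (algebraMap M A x) := fun σ x =>
    (τ σ).restrictNormal_commutes M x
  have hψr : ∀ σ t, ψ σ (root t) = root (σ t) := fun σ t =>
    Subtype.ext ((hψ σ _).trans (hτ σ t))
  have hrinj : Function.Injective root := fun s t h => hinj (congrArg Subtype.val h)
  -- Multiplicativity of `τ` is not assumed; on `M` it follows because an automorphism is determined
  -- by its values on the roots.
  have hmul : ∀ σ σ', ψ (σ * σ') = ψ σ * ψ σ' := by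
    intro σ σ'
    have := hext (ψ (σ * σ')).toAlgHom (ψ σ * ψ σ').toAlgHom fun t => by
      change ψ (σ * σ') (root t) = ψ σ (ψ σ' (root t))
      rw [hψr, hψr, hψr]
      rfl
    exact AlgEquiv.ext fun x => DFunLike.congr_fun this x
  have hbij : Function.Bijective ψ := by
    refine ⟨fun σ σ' h => Equiv.ext fun t => hrinj ?_, fun g => ?_⟩
    · rw [← hψr, ← hψr, h]
    · have hroot : ∀ t, ∃ s, g (root t) = root s := by
        intro t
        have h1 : aeval (root t) χ = 0 := by
          apply (algebraMap M A).injective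
          rw [map_zero, ← aeval_algebraMap_apply, ← eval_map_algebraMap, hχ, eval_prod]
          exact Finset.prod_eq_zero (Finset.mem_univ t) (by simp [root])
        have h2 : aeval (algebraMap M A (g (root t))) χ = 0 := by
          rw [aeval_algebraMap_apply, aeval_algHom_apply, h1, map_zero, map_zero]
        rw [← eval_map_algebraMap, hχ, eval_prod, Finset.prod_eq_zero_iff] at h2
        obtain ⟨s, -, hs⟩ := h2
        refine ⟨s, Subtype.ext ?_⟩
        rw [eval_sub, eval_X, eval_C, sub_eq_zero] at hs
        exact hs
      choose f hf using hroot
      have hfinj : Function.Injective f := fun s t h => hrinj (g.injective (by rw [hf, hf, h]))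
      refine ⟨Equiv.ofBijective f (Finite.injective_iff_bijective.1 hfinj), ?_⟩
      have := hext (ψ (Equiv.ofBijective f (Finite.injective_iff_bijective.1 hfinj))).toAlgHom
        g.toAlgHom fun t => (hψr _ t).trans (hf t).symm
      exact AlgEquiv.ext fun x => DFunLike.congr_fun this x
  let e₀ : Equiv.Perm ι ≃* (M ≃ₐ[K] M) :=
    MulEquiv.ofBijective (MonoidHom.mk' ψ hmul) hbij
  have hstab : ∀ σ, (∀ x, ψ σ (j x) = j x) ↔ σ • y₀ = y₀ := by
    intro σ
    rw [← hfix]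
    refine forall_congr' fun x => ?_
    rw [← (algebraMap M A).injective.eq_iff, hψ, hj]
  have hone : ψ 1 = 1 := map_one e₀
  have hstab' : ∀ σ σ', (ψ σ).toAlgHom.comp j = (ψ σ').toAlgHom.comp j ↔ σ • y₀ = σ' • y₀ := by
    intro σ σ'
    rw [← inv_smul_eq_iff (g := σ'), ← mul_smul, ← hstab, AlgHom.ext_iff]
    refine forall_congr' fun x => ?_
    change ψ σ (j x) = ψ σ' (j x) ↔ _
    rw [hmul, show ψ σ'⁻¹ = (ψ σ')⁻¹ from map_inv e₀ σ']
    exact ((ψ σ').symm_apply_eq).symm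
  -- Normality extends every embedding of `L` to an automorphism of `M`, so all embeddings are
  -- conjugate to `j`.
  have hsurj : ∀ h : L →ₐ[K] M, ∃ σ, (ψ σ).toAlgHom.comp j = h := by
    intro h
    let := j.toRingHom.toAlgebra
    have : IsScalarTower K L M := IsScalarTower.of_algebraMap_eq fun x => (j.commutes x).symm
    obtain ⟨σ, hσ⟩ := hbij.2
      (AlgEquiv.ofBijective (h.liftNormal M) (AlgHom.normal_bijective K M M _))
    refine ⟨σ, AlgHom.ext fun x => ?_⟩
    change ψ σ (j x) = h x
    rw [hσ]
    exact h.liftNormal_commutes M x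
  choose s hs using hsurj
  let ε₀ : (L →ₐ[K] M) ≃ Y := Equiv.ofBijective (fun h => s h • y₀) <| by
    refine ⟨fun h h' hh => ?_, fun y => ?_⟩
    · rw [← hs h, ← hs h']
      exact (hstab' _ _).2 hh
    · obtain ⟨σ, rfl⟩ := htrans y
      exact ⟨(ψ σ).toAlgHom.comp j, (hstab' _ _).1 (hs _)⟩
  have hε₀ : ∀ σ h, ε₀ ((ψ σ).toAlgHom.comp h) = σ • ε₀ h := by
    intro σ h
    change s _ • y₀ = σ • s h • y₀
    rw [← mul_smul, ← hstab', hs, hmul]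
    conv_lhs => rw [← hs h]
    rfl
  have hclosure : normalClosure K L M = ⊤ := by
    -- An automorphism that fixes the images of all embeddings acts trivially on `Y`, hence is the
    -- identity.
    have hbot : (normalClosure K L M).fixingSubgroup = ⊥ := by
      rw [eq_bot_iff]
      intro g hg
      obtain ⟨σ, rfl⟩ := hbij.2 g
      have : σ = 1 := by
        refine FaithfulSMul.eq_of_smul_eq_smul (α := Y) fun y => ?_
        obtain ⟨h, rfl⟩ := ε₀.surjective y
        rw [← hε₀, one_smul]
        congr 1
        refine AlgHom.ext fun x => ?_
        exact (IntermediateField.mem_fixingSubgroup_iff _ _).1 hg (h x)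
          (h.fieldRange_le_normalClosure ⟨x, rfl⟩)
      rw [this, hone]
      exact Subgroup.mem_bot.2 rfl
    rw [← IsGalois.fixedField_fixingSubgroup (normalClosure K L M), hbot, fixedField_bot]
  have hN : IsNormalClosure K L M := Algebra.IsAlgebraic.isNormalClosure_iff.2 ⟨fun x => by
    have h := Normal.splits (inferInstance : Normal K M) (j x)
    rwa [minpoly.algHom_eq j j.toRingHom.injective] at h, hclosure⟩
  have hN' : IsNormalClosure K L (normalClosure K L (AlgebraicClosure L)) :=
    Algebra.IsAlgebraic.isNormalClosure_normalClosure fun x => IsAlgClosed.splits _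
  let E : M ≃ₐ[K] normalClosure K L (AlgebraicClosure L) := IsNormalClosure.equiv (K := L)
  refine ⟨hfinL, (AlgEquiv.autCongr E.symm).trans e₀.symm, 
    (AlgEquiv.arrowCongr AlgEquiv.refl E.symm).trans ε₀, fun g x => ?_⟩
  refine Eq.trans ?_ (hε₀ (e₀.symm (AlgEquiv.autCongr E.symm g)) (E.symm.toAlgHom.comp x))
  rw [show ψ (e₀.symm (AlgEquiv.autCongr E.symm g)) = AlgEquiv.autCongr E.symm g from
    e₀.apply_symm_apply _]
  refine congrArg ε₀ (AlgHom.ext fun z => ?_)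
  change E.symm (g (x z)) = E.symm (g (E (E.symm (x z))))
  rw [AlgEquiv.apply_symm_apply]

end galois

end

noncomputable section

open VarietyPresentation

attribute [local instance] zariski

/-! ## Towers of function fields -/

namespace VarietyPresentation

set_option linter.unusedSectionVars false

variable {X Y Z : Type} [VarietyPresentation X] [VarietyPresentation Y] [VarietyPresentation Z]

/-- The nonvanishing locus is open and nonempty, so it meets every dense open set. One point is
enough to show that a rational function is nonzero. -/
theorem toRat_ne_zero {U : Set X} (hU : IsOpen U) (hd : Dense U)
    {g : regularRing U} (x : U) (h : regularRing.evalAt x g ≠ 0) : toRat hU hd g ≠ 0 := by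
  intro h0
  rw [← map_zero (toRat hU hd), toRat_eq_toRat_iff] at h0
  obtain ⟨V, hV, hVd, hVg⟩ := eventually_generic.1 h0
  obtain ⟨y, ⟨hy, hne⟩, hyV⟩ := hVd.inter_open_nonempty _ (regularRing.isOpen_ne_zero hU g)
    ⟨x.1, x.2, h⟩
  obtain ⟨_, _, h2⟩ := hVg y hyV
  exact hne h2

namespace DominantMorphism

/-- The element of the function field of the target given by a regular function. -/
def baseRat (π : DominantMorphism Y Z) {U : Set Z} (hU : IsOpen U) (hd : Dense U) :
    regularRing U →+* π.BaseField := toRat hU hd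

/-- The element of the function field of the source given by a regular function. -/
def totalRat (π : DominantMorphism Y Z) {U : Set Y} (hU : IsOpen U) (hd : Dense U) :
    regularRing U →+* π.TotalField := toRat hU hd

theorem totalRat_ne_zero (π : DominantMorphism Y Z) {U : Set Y} (hU : IsOpen U) (hd : Dense U)
    {g : regularRing U} (x : U) (h : regularRing.evalAt x g ≠ 0) : π.totalRat hU hd g ≠ 0 :=
  toRat_ne_zero hU hd x h

theorem totalRat_res (π : DominantMorphism Y Z) {U V : Set Y} (hU : IsOpen U) (hd : Dense U)
    (hV : IsOpen V) (hVd : Dense V) (h : V ⊆ U) (g : regularRing U) :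
    π.totalRat hV hVd (regularRing.res h g) = π.totalRat hU hd g := toRat_res hU hd hV hVd h g

/-- The function field at the top of a tower of dominant morphisms is an extension of the one in
the middle. -/
instance towerTop (ρ : DominantMorphism X Y) (π : DominantMorphism Y Z) :
    Algebra π.TotalField ρ.TotalField :=
  RingHom.toAlgebra (S := ρ.TotalField) (R := π.TotalField) ρ.pullback

/-- The function field at the top of a tower of dominant morphisms is an extension of the one at
the bottom. -/
instance tower (ρ : DominantMorphism X Y) (π : DominantMorphism Y Z) :
    Algebra π.BaseField ρ.TotalField :=
  RingHom.toAlgebra (S := ρ.TotalField) (R := π.BaseField) (ρ.pullback.comp π.pullback)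

instance (ρ : DominantMorphism X Y) (π : DominantMorphism Y Z) :
    IsScalarTower π.BaseField π.TotalField ρ.TotalField :=
  IsScalarTower.of_algebraMap_eq fun _ => rfl

theorem algebraMap_totalRat (ρ : DominantMorphism X Y) (π : DominantMorphism Y Z) {U : Set Y}
    (hU : IsOpen U) (hd : Dense U) (g : regularRing U) :
    algebraMap π.TotalField ρ.TotalField (π.totalRat hU hd g) =
      ρ.totalRat (hU.preimage ρ.continuous_toFun) (ρ.preimage_dense hU hd) (ρ.comapRegular hU g) :=
  ρ.pullback_toRat hU hd g

theorem algebraMap_baseRat (ρ : DominantMorphism X Y) (π : DominantMorphism Y Z) {U : Set Z}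
    (hU : IsOpen U) (hd : Dense U) (g : regularRing U) :
    algebraMap π.BaseField ρ.TotalField (π.baseRat hU hd g) =
      ρ.totalRat ((hU.preimage π.continuous_toFun).preimage ρ.continuous_toFun)
        (ρ.preimage_dense (hU.preimage π.continuous_toFun) (π.preimage_dense hU hd))
        (ρ.comapRegular (hU.preimage π.continuous_toFun) (π.comapRegular hU g)) := by
  exact (congrArg ρ.pullback (π.pullback_toRat hU hd g)).trans
    (ρ.pullback_toRat _ (π.preimage_dense hU hd) (π.comapRegular hU g))

/-- The automorphism of the function field at the top of a tower given by an automorphism of the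
variety at the top over the one at the bottom. -/
def towerHom (ρ : DominantMorphism X Y) (π : DominantMorphism Y Z) (τ : DominantMorphism X X)
    (h : ∀ x, π.toFun (ρ.toFun (τ.toFun x)) = π.toFun (ρ.toFun x)) :
    ρ.TotalField →ₐ[π.BaseField] ρ.TotalField where
  toRingHom := RingHom.comp (β := ρ.TotalField) (RingHom.id _)
    (show ρ.TotalField →+* ρ.TotalField from τ.pullback)
  commutes' φ := by
    obtain ⟨_, f, U, hU, hd, hf, rfl⟩ := φ
    refine Subtype.ext (Filter.Germ.coe_eq.2 (Filter.Eventually.of_forall fun x => ?_))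
    exact congrArg f (h x)

theorem towerHom_totalRat (ρ : DominantMorphism X Y) (π : DominantMorphism Y Z)
    (τ : DominantMorphism X X) (h : ∀ x, π.toFun (ρ.toFun (τ.toFun x)) = π.toFun (ρ.toFun x))
    {U : Set X} (hU : IsOpen U) (hd : Dense U) (g : regularRing U) :
    ρ.towerHom π τ h (ρ.totalRat hU hd g) =
      ρ.totalRat (hU.preimage τ.continuous_toFun) (τ.preimage_dense hU hd) (τ.comapRegular hU g) :=
  τ.pullback_toRat hU hd g

end DominantMorphism

end VarietyPresentation

/-! ## Matrices with eigenvectors over an extension -/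

section eigen

variable {K A ι : Type*} [Field K] [Field A] [Algebra K A] [Fintype ι] [DecidableEq ι]

theorem charpoly_map_eq_prod {φ : Matrix ι ι K} {V : Matrix ι ι A} {eig : ι → A}
    (hV : V.det ≠ 0) (h : φ.map (algebraMap K A) * V = V * Matrix.diagonal eig) :
    φ.charpoly.map (algebraMap K A) = ∏ t, (Polynomial.X - Polynomial.C (eig t)) := by
  have hVu : IsUnit V.det := isUnit_iff_ne_zero.2 hV
  have h1 : φ.map (algebraMap K A) = V * Matrix.diagonal eig * V⁻¹ := by
    rw [← h, Matrix.mul_nonsing_inv_cancel_right _ _ hVu]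
  rw [← Matrix.charpoly_map, h1]
  have h2 := Matrix.charpoly_units_conj (Matrix.nonsingInvUnit V hVu) (Matrix.diagonal eig)
  refine h2.trans ?_
  exact Matrix.charpoly_diagonal eig

/-- Apply an `M`-linear retraction `θ` of `A` onto `M` to the eigenvector whose `p`-th coordinate is
1. The result is again an eigenvector for `eig t` with `p`-th coordinate 1. As the eigenvalues are
distinct, the eigenspace is a line, so the eigenvector equals its image and has coordinates in `M`.
-/
theorem eigenvector_ratio_mem {φ : Matrix ι ι K} {V : Matrix ι ι A} {eig : ι → A}
    (hV : V.det ≠ 0) (h : φ.map (algebraMap K A) * V = V * Matrix.diagonal eig)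
    (hinj : Function.Injective eig) {M : IntermediateField K A} {t : ι} (ht : eig t ∈ M) {p : ι}
    (hp : V p t ≠ 0) (q : ι) : V q t / V p t ∈ M := by
  obtain ⟨θ, hθ⟩ := (Algebra.linearMap M A).exists_leftInverse_of_injective
    (LinearMap.ker_eq_bot.2 (algebraMap M A).injective)
  have hθ' : ∀ m : M, θ m = m := fun m => LinearMap.congr_fun hθ m
  let x : ι → A := fun s => V s t / V p t
  let x' : ι → A := fun s => θ (x s)
  have hx : ∀ s, ∑ u, algebraMap K A (φ s u) * x u = eig t * x s := by
    intro s
    have := congrFun (congrFun h s) t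
    rw [Matrix.mul_diagonal, Matrix.mul_apply] at this
    simp only [x, ← mul_div_assoc, ← Finset.sum_div]
    rw [mul_comm (eig t), ← this]
    rfl
  have hx' : (φ.map (algebraMap K A)).mulVec x' = eig t • x' := by
    funext s
    have h1 := congrArg θ (hx s)
    rw [map_sum] at h1
    have h2 : ∀ u, θ (algebraMap K A (φ s u) * x u) = algebraMap K M (φ s u) * θ (x u) := by
      intro u
      rw [← smul_eq_mul (algebraMap K M (φ s u)), ← map_smul]
      rfl
    have h3 : θ (eig t * x s) = ⟨eig t, ht⟩ * θ (x s) := by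
      rw [← smul_eq_mul (⟨eig t, ht⟩ : M), ← map_smul]
      rfl
    simp only [h2, h3] at h1
    have h4 := congrArg (algebraMap M A) h1
    rw [map_sum] at h4
    exact h4
  have hVu : IsUnit V.det := isUnit_iff_ne_zero.2 hV
  let c := V⁻¹.mulVec x'
  have hc : V.mulVec c = x' := by
    rw [Matrix.mulVec_mulVec, Matrix.mul_nonsing_inv _ hVu, Matrix.one_mulVec]
  -- In the eigenbasis, the equation for `x'` compares `eig s * c s` with `eig t * c s`.
  have hc' : ∀ s, s ≠ t → c s = 0 := by
    have h1 : V.mulVec ((Matrix.diagonal eig).mulVec c) = V.mulVec (eig t • c) := by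
      rw [Matrix.mulVec_mulVec, ← h, ← Matrix.mulVec_mulVec, hc, hx', Matrix.mulVec_smul, hc]
    have h2 := Matrix.mulVec_injective_iff_isUnit.2 ((Matrix.isUnit_iff_isUnit_det _).2 hVu) h1
    intro s hs
    have h3 := congrFun h2 s
    rw [Matrix.mulVec_diagonal, Pi.smul_apply, smul_eq_mul] at h3
    by_contra hne
    exact hs (hinj (mul_right_cancel₀ hne h3))
  have hx'' : ∀ s, x' s = V s t * c t := by
    intro s
    rw [← hc]
    exact Finset.sum_eq_single t (fun u _ hu => by rw [hc' u hu, mul_zero]) (by simp)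
  have hxp : x' p = 1 := by
    have : x p = ((1 : M) : A) := div_self hp
    simp only [x', this, hθ']
    rfl
  have hct : c t = (V p t)⁻¹ := by
    rw [hx''] at hxp
    exact eq_inv_of_mul_eq_one_right hxp
  have := hx'' q
  rw [hct, ← div_eq_mul_inv] at this
  rw [← this]
  exact (θ (x q)).2

/-- The operator `φ` and the isomorphism between the first two subspaces, in terms of the slopes. -/
theorem exists_operator {Z : Fin 4 → Matrix ι ι K} (h30 : (Z 3 - Z 0).det ≠ 0)
    (h12 : (Z 1 - Z 2).det ≠ 0) {V V' W W' : Matrix ι ι A} {eig : ι → A}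
    (h0 : (Z 0).map (algebraMap K A) * V = V') (h1 : (Z 1).map (algebraMap K A) * W = W')
    (h2 : (Z 2).map (algebraMap K A) * (V + W) = V' + W')
    (h3 : (Z 3).map (algebraMap K A) * (V * Matrix.diagonal eig + W) =
      V' * Matrix.diagonal eig + W') :
    ∃ φ N : Matrix ι ι K, φ.map (algebraMap K A) * V = V * Matrix.diagonal eig ∧
      N.map (algebraMap K A) * V = W := by
  have key : ∀ {B : Matrix ι ι K}, B.det ≠ 0 → ∀ {C C' : Matrix ι ι A},
      B.map (algebraMap K A) * C = B.map (algebraMap K A) * C' → C = C' := by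
    intro B hB C C' h
    have hu : IsUnit (B.map (algebraMap K A)).det := by
      rw [isUnit_iff_ne_zero, ← RingHom.mapMatrix_apply, ← RingHom.map_det]
      exact (map_ne_zero _).2 hB
    rw [← Matrix.nonsing_inv_mul_cancel_left _ C hu, h, Matrix.nonsing_inv_mul_cancel_left _ _ hu]
  simp only [← RingHom.mapMatrix_apply] at *
  have hmul : ∀ {B : Matrix ι ι K}, B.det ≠ 0 → ∀ D, B * (B⁻¹ * D) = D := fun hB D =>
    Matrix.mul_nonsing_inv_cancel_left _ _ (isUnit_iff_ne_zero.2 hB)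
  -- The equations of K³ and K⁴ amount to `(Z 1 - Z 2) W = (Z 2 - Z 0) V` and `(Z 3 - Z 0) V
  -- diag(eig) = (Z 1 - Z 3) W`.
  let N := (Z 1 - Z 2)⁻¹ * (Z 2 - Z 0)
  let φ := (Z 3 - Z 0)⁻¹ * ((Z 1 - Z 3) * N)
  have hN : (algebraMap K A).mapMatrix N * V = W := by
    refine key h12 ?_
    rw [← Matrix.mul_assoc, ← map_mul, hmul h12, map_sub, map_sub, Matrix.sub_mul, Matrix.sub_mul,
      h0, h1, sub_eq_sub_iff_add_eq_add, ← Matrix.mul_add, h2, add_comm]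
  refine ⟨φ, N, key h30 ?_, hN⟩
  rw [← Matrix.mul_assoc, ← map_mul, hmul h30, map_mul, Matrix.mul_assoc, hN, map_sub, map_sub,
    Matrix.sub_mul, Matrix.sub_mul, h1, ← Matrix.mul_assoc _ V, ← Matrix.mul_assoc _ V, h0,
    sub_eq_sub_iff_add_eq_add, add_comm, Matrix.mul_assoc, ← h3, Matrix.mul_add]

end eigen

end

noncomputable section

open VarietyPresentation CoverParam

attribute [local instance] zariski

/-! ## The function field of the cover -/

section coverField

set_option linter.unusedSectionVars false

variable {r b : ℕ} {a : Fin r → ℕ} {ha : StrictMono a} {hab : ∀ i, a i < b}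
  {P : SchubertProblem (doubledType a ha hab) 4} (hP : IsDoubled P)

theorem dense_chartTuples (b : ℕ) : Dense (chartTuples (2 * b) 4) :=
  (dense_generalTuples b).mono fun _ h => h.1

/-- The points of the cover over tuples of flags in the affine chart. -/
def coverChart : Set (CoverSpace b) :=
  (coverMorphism hP).toFun ⁻¹' ((projMorphism hP).toFun ⁻¹' chartTuples (2 * b) 4)

theorem isOpen_coverChart : IsOpen (coverChart hP) :=
  ((isOpen_chartTuples _ _).preimage (projMorphism hP).continuous_toFun).preimage
    (coverMorphism hP).continuous_toFun

theorem dense_coverChart : Dense (coverChart hP) :=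
  (coverMorphism hP).preimage_dense
    ((isOpen_chartTuples _ _).preimage (projMorphism hP).continuous_toFun)
    ((projMorphism hP).preimage_dense (isOpen_chartTuples _ _) (dense_chartTuples b))

theorem regularOn_param (U : Set (CoverSpace b)) (c : CoverParam b) :
    RegularOn U fun y : CoverSpace b => y.1 c := fun s _ =>
  ⟨(MvPolynomial.X c : MvPolynomial (CoverParam b) ℂ), 1, by simp, fun t _ _ => by
    rw [map_one, div_one]
    exact (MvPolynomial.eval_X c).symm⟩

/-- The coordinates as regular functions. -/
def param (U : Set (CoverSpace b)) (c : CoverParam b) : regularRing U :=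
  regularRing.of _ (regularOn_param U c)

theorem evalAt_comp_param {U : Set (CoverSpace b)} (y : U) :
    (regularRing.evalAt y : regularRing U → ℂ) ∘ param U = y.1.1 := rfl

/-- The coordinates as rational functions. -/
def paramRat (c : CoverParam b) : (coverMorphism hP).TotalField :=
  (coverMorphism hP).totalRat isOpen_univ dense_univ (param Set.univ c)

theorem totalRat_comp_param {U : Set (CoverSpace b)} (hU : IsOpen U) (hd : Dense U) :
    ((coverMorphism hP).totalRat hU hd : regularRing U → (coverMorphism hP).TotalField) ∘ param U =
      paramRat hP :=
  funext fun c => (coverMorphism hP).totalRat_res isOpen_univ dense_univ hU hd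
    (Set.subset_univ _) (param Set.univ c)

theorem paramRat_ne_zero {c : CoverParam b} {y : CoverSpace b} (h : y.1 c ≠ 0) :
    paramRat hP c ≠ 0 :=
  (coverMorphism hP).totalRat_ne_zero isOpen_univ dense_univ ⟨y, trivial⟩ h

theorem paramRat_eig_injective : Function.Injective fun t : Fin b => paramRat hP (.eig t) := by
  intro s t h
  by_contra hne
  obtain ⟨y⟩ := nonempty_coverSpace hP
  refine (coverMorphism hP).totalRat_ne_zero isOpen_univ dense_univ
    (g := param Set.univ (.eig s) - param Set.univ (.eig t)) ⟨y, trivial⟩ ?_ ?_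
  · rw [map_sub, sub_ne_zero]
    exact fun h' => hne (y.2.2 h')
  · rw [map_sub, sub_eq_zero]
    exact h

/-- The slopes as matrices over the function field of the base. -/
def slopeRat (j : Fin 4) : Matrix (Fin b) (Fin b) (projMorphism hP).BaseField :=
  (slopeFun b j).map ((projMorphism hP).baseRat (isOpen_chartTuples _ _) (dense_chartTuples b))

/-- Pullback of regular functions on the chart of the base to the cover. -/
def chartPullback : regularRing (chartTuples (2 * b) 4) →+* regularRing (coverChart hP) :=
  ((coverMorphism hP).comapRegular
    ((isOpen_chartTuples _ _).preimage (projMorphism hP).continuous_toFun)).comp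
    ((projMorphism hP).comapRegular (isOpen_chartTuples _ _))

theorem algebraMap_baseRat_chart (g : regularRing (chartTuples (2 * b) 4)) :
    algebraMap (projMorphism hP).BaseField (coverMorphism hP).TotalField
      ((projMorphism hP).baseRat (isOpen_chartTuples _ _) (dense_chartTuples b) g) =
      (coverMorphism hP).totalRat (isOpen_coverChart hP) (dense_coverChart hP)
        (chartPullback hP g) :=
  DominantMorphism.algebraMap_baseRat _ _ _ _ g

/-- The upper half of a matrix. -/
def topHalf {R : Type*} (M : Matrix (Fin (2 * b)) (Fin b) R) : Matrix (Fin b) (Fin b) R :=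
  M.submatrix (fun p => halves b (Sum.inl p)) id

/-- The lower half of a matrix. -/
def bottomHalf {R : Type*} (M : Matrix (Fin (2 * b)) (Fin b) R) : Matrix (Fin b) (Fin b) R :=
  M.submatrix (fun p => halves b (Sum.inr p)) id

theorem midSlope_mul_topHalf_base {y : CoverSpace b} (hy : y ∈ coverChart hP) (j : Fin 4) :
    midSlope (P.proj (coverMap hP y)) j * topHalf (base y.1 j) = bottomHalf (base y.1 j) := by
  ext p t
  have h := (linearIndependent_col_of_leftCols_eq (y.2.1 (some j)) (leftCols_joinCols _ _)).2 t
  exact ((mem_middle_iff (F := P.proj (coverMap hP y)) (hy j _)).1 h p).symm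

/-- The lower half is the slope times the upper half, so a kernel vector of the upper half would be
a linear relation between the independent columns of `vMat`. -/
theorem det_topHalf_vMat_ne_zero {y : CoverSpace b} (hy : y ∈ coverChart hP) :
    (topHalf (vMat y.1)).det ≠ 0 := by
  intro h0
  obtain ⟨x, hx, hx0⟩ := Matrix.exists_mulVec_eq_zero_iff.2 h0
  have h := midSlope_mul_topHalf_base hP hy 0
  have h1 : (bottomHalf (vMat y.1)).mulVec x = 0 := by
    change (bottomHalf (base y.1 0)).mulVec x = 0
    rw [← h, ← Matrix.mulVec_mulVec]
    change Matrix.mulVec _ ((topHalf (vMat y.1)).mulVec x) = 0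
    rw [hx0, Matrix.mulVec_zero]
  have h2 : (vMat y.1).mulVec x = 0 :=
    halves_ext (fun q => congrFun hx0 q) fun q => congrFun h1 q
  have hli := (linearIndependent_col_of_leftCols_eq (y.2.1 (some 0)) (leftCols_joinCols _ _)).1
  refine hx (funext fun t => Fintype.linearIndependent_iff.1 hli x ?_ t)
  refine Eq.trans ?_ h2
  funext p
  simp only [Finset.sum_apply, Pi.smul_apply, smul_eq_mul, Matrix.mulVec, dotProduct,
    mul_comm (x _)]
  rfl

/-- The identity holds at every point of the chart, hence for regular functions there, and passes to
the function field. -/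
theorem slopeRat_mul_topHalf_base (j : Fin 4) :
    (slopeRat hP j).map (algebraMap _ (coverMorphism hP).TotalField) *
      topHalf (base (paramRat hP) j) = bottomHalf (base (paramRat hP) j) := by
  have h : (slopeFun b j).map (chartPullback hP) * topHalf (base (param (coverChart hP)) j) =
      bottomHalf (base (param (coverChart hP)) j) := by
    ext1 p t
    refine regularRing.ext_evalAt fun y => ?_
    have h1 := congrFun (congrFun (midSlope_mul_topHalf_base hP y.2 j) p) t
    have h2 : ∀ q t, regularRing.evalAt y (base (param (coverChart hP)) j q t) = base y.1.1 j q t :=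
      fun q t => congrFun (congrFun (base_map (param (coverChart hP)) (regularRing.evalAt y) j) q) t
    rw [Matrix.mul_apply, map_sum]
    refine Eq.trans (Finset.sum_congr rfl fun q _ => ?_) (h1.trans (h2 _ _).symm)
    rw [map_mul]
    exact congrArg₂ _ rfl (h2 _ _)
  have h' := congrArg (fun M => M.map ((coverMorphism hP).totalRat (isOpen_coverChart hP)
    (dense_coverChart hP))) h
  simp only [Matrix.map_mul] at h'
  have h3 := base_map (param (coverChart hP)) ((coverMorphism hP).totalRat (isOpen_coverChart hP)
    (dense_coverChart hP)) j
  rw [totalRat_comp_param] at h3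
  have h4 : (slopeRat hP j).map (algebraMap _ (coverMorphism hP).TotalField) =
      ((slopeFun b j).map (chartPullback hP)).map ((coverMorphism hP).totalRat
        (isOpen_coverChart hP) (dense_coverChart hP)) := by
    ext1 p q
    exact algebraMap_baseRat_chart hP _
  rw [h4, ← h3]
  exact h'

theorem det_topHalf_vMat_paramRat_ne_zero : (topHalf (vMat (paramRat hP))).det ≠ 0 := by
  have : Nonempty (CoverSpace b) := nonempty_coverSpace hP
  obtain ⟨y, hy⟩ := (dense_coverChart hP).nonempty
  have h : (coverMorphism hP).totalRat (isOpen_coverChart hP) (dense_coverChart hP)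
      (topHalf (vMat (param (coverChart hP)))).det = (topHalf (vMat (paramRat hP))).det := by
    rw [RingHom.map_det, ← totalRat_comp_param hP (isOpen_coverChart hP) (dense_coverChart hP)]
    rfl
  rw [← h]
  refine DominantMorphism.totalRat_ne_zero _ _ _ ⟨y, hy⟩ ?_
  rw [RingHom.map_det]
  exact det_topHalf_vMat_ne_zero hP hy

theorem det_slopeRat_sub_ne_zero {i j : Fin 4} (hij : i ≠ j) :
    (slopeRat hP i - slopeRat hP j).det ≠ 0 := by
  obtain ⟨F, hF⟩ := nonempty_generalTuples b
  have h : (projMorphism hP).baseRat (isOpen_chartTuples _ _) (dense_chartTuples b)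
      (slopeFun b i - slopeFun b j).det = (slopeRat hP i - slopeRat hP j).det := by
    rw [RingHom.map_det, map_sub]
    rfl
  rw [← h]
  refine toRat_ne_zero (isOpen_chartTuples _ _) (dense_chartTuples b) ⟨F, hF.1⟩ ?_
  rw [RingHom.map_det, map_sub]
  exact det_sub_ne_zero hF.2 hij

theorem exists_operator_slopeRat :
    ∃ φ N : Matrix (Fin b) (Fin b) (projMorphism hP).BaseField,
      φ.map (algebraMap _ (coverMorphism hP).TotalField) * topHalf (vMat (paramRat hP)) =
        topHalf (vMat (paramRat hP)) * Matrix.diagonal (fun t => paramRat hP (.eig t)) ∧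
      N.map (algebraMap _ (coverMorphism hP).TotalField) * topHalf (vMat (paramRat hP)) =
        topHalf (wMat (paramRat hP)) := by
  refine exists_operator (det_slopeRat_sub_ne_zero hP (by decide))
    (det_slopeRat_sub_ne_zero hP (by decide)) (slopeRat_mul_topHalf_base hP 0)
    (slopeRat_mul_topHalf_base hP 1) (slopeRat_mul_topHalf_base hP 2) ?_
  have h := slopeRat_mul_topHalf_base hP 3
  have htop : topHalf (base (paramRat hP) 3) = topHalf (vMat (paramRat hP)) *
      Matrix.diagonal (fun t => paramRat hP (.eig t)) + topHalf (wMat (paramRat hP)) := by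
    ext p t
    simp [base, topHalf]
  have hbot : bottomHalf (base (paramRat hP) 3) = bottomHalf (vMat (paramRat hP)) *
      Matrix.diagonal (fun t => paramRat hP (.eig t)) + bottomHalf (wMat (paramRat hP)) := by
    ext p t
    simp [base, bottomHalf]
  rw [htop, hbot] at h
  exact h

/-- The field generated by the eigenvalues over the function field of the base. -/
def eigField : IntermediateField (projMorphism hP).BaseField (coverMorphism hP).TotalField :=
  IntermediateField.adjoin _ (Set.range fun t : Fin b => paramRat hP (.eig t))

/-- The scaling of an eigenvector is arbitrary, so only ratios can lie in this field. For the upper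
half of `v` they do by `eigenvector_ratio_mem`; the other halves of `v` and `w` arise by applying
matrices over the base field. -/
theorem ratio_mem_eigField {p t : Fin b}
    (hp : paramRat hP (.v (halves b (Sum.inl p)) t) ≠ 0) (q : Fin (2 * b)) :
    paramRat hP (.v q t) / paramRat hP (.v (halves b (Sum.inl p)) t) ∈ eigField hP ∧
      paramRat hP (.w q t) / paramRat hP (.v (halves b (Sum.inl p)) t) ∈ eigField hP := by
  obtain ⟨φ, N, hφ, hN⟩ := exists_operator_slopeRat hP
  have ht : paramRat hP (.eig t) ∈ eigField hP :=
    IntermediateField.subset_adjoin _ _ ⟨t, rfl⟩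
  have hv : ∀ q, topHalf (vMat (paramRat hP)) q t / paramRat hP (.v (halves b (Sum.inl p)) t) ∈
      eigField hP := eigenvector_ratio_mem (det_topHalf_vMat_paramRat_ne_zero hP) hφ
        (paramRat_eig_injective hP) (M := eigField hP) ht hp
  have hmul : ∀ {C : Matrix (Fin b) (Fin b) (projMorphism hP).BaseField}
      {X X' : Matrix (Fin b) (Fin b) (coverMorphism hP).TotalField},
      C.map (algebraMap _ _) * X = X' →
      (∀ q, X q t / paramRat hP (.v (halves b (Sum.inl p)) t) ∈ eigField hP) →
      ∀ q, X' q t / paramRat hP (.v (halves b (Sum.inl p)) t) ∈ eigField hP := by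
    rintro C X _ rfl hX q
    rw [Matrix.mul_apply, Finset.sum_div]
    refine sum_mem fun s _ => ?_
    rw [mul_div_assoc]
    exact mul_mem ((eigField hP).algebraMap_mem _) (hX s)
  have hv' := hmul (slopeRat_mul_topHalf_base hP 0) hv
  have hw := hmul hN hv
  have hw' := hmul (slopeRat_mul_topHalf_base hP 1) hw
  obtain ⟨x | x, rfl⟩ := (halves b).surjective q
  · exact ⟨hv x, hw x⟩
  · exact ⟨hv' x, hw' x⟩

end coverField

end

noncomputable section

open VarietyPresentation CoverParam

attribute [local instance] zariski

/-! ## Rational functions on the total space in terms of the eigenvalues -/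

namespace CoverParam

variable {b : ℕ} {R S : Type*} [CommRing R] [CommRing S]

/-- Rescaling of the eigenvectors. -/
def scale (y : CoverParam b → R) (u : Fin b → R) : CoverParam b → R
  | v p t => y (v p t) * u t
  | w p t => y (w p t) * u t
  | c => y c

theorem flagMatrix_map (y : CoverParam b → R) (f : R →+* S) :
    (flagMatrix y).map f = flagMatrix (f ∘ y) := frame_map y f none

theorem flagMatrix_scale (y : CoverParam b → R) (u : Fin b → R) :
    flagMatrix (scale y u) = flagMatrix y *
      Matrix.diagonal (Sum.elim u u ∘ (interleave b).symm) := by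
  ext p q
  obtain ⟨x | x, rfl⟩ := (interleave b).surjective q <;>
    simp [flagMatrix, vMat, wMat, scale]

theorem comp_scale (y : CoverParam b → R) (u : Fin b → R) (f : R →+* S) :
    f ∘ scale y u = scale (f ∘ y) (f ∘ u) := by
  funext c
  cases c <;> simp [scale]

end CoverParam

/-! ### Normalized frames with entries in the field of the eigenvalues -/

section normalPoint

set_option linter.unusedSectionVars false

variable {r b : ℕ} {a : Fin r → ℕ} {ha : StrictMono a} {hab : ∀ i, a i < b}
  {P : SchubertProblem (doubledType a ha hab) 4} (hP : IsDoubled P) (p : Fin b → Fin b)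

/-- The points where the eigenvectors can be normalized. -/
def pivotSet : Set (CoverSpace b) :=
  coverChart hP ∩ {y | ∀ t, y.1 (.v (halves b (Sum.inl (p t))) t) ≠ 0}

theorem isOpen_pivotSet : IsOpen (pivotSet hP p) := by
  refine (isOpen_coverChart hP).inter ?_
  rw [Set.ofPred_forall]
  refine isOpen_iInter_of_finite fun t => ?_
  convert regularRing.isOpen_ne_zero isOpen_univ
    (param Set.univ (.v (halves b (Sum.inl (p t))) t)) using 1
  ext y
  exact ⟨fun h => ⟨trivial, h⟩, fun h => h.2⟩

/-- The inverse of a coordinate that is used to normalize an eigenvector. -/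
def pivotInv (t : Fin b) : regularRing (pivotSet hP p) :=
  regularRing.of _ ((regularOn_param (pivotSet hP p) (.v (halves b (Sum.inl (p t))) t)).inv
    fun _ hy => hy.2 t)

theorem param_mul_pivotInv (t : Fin b) :
    param (pivotSet hP p) (.v (halves b (Sum.inl (p t))) t) * pivotInv hP p t = 1 :=
  regularRing.ext_evalAt fun y => mul_inv_cancel₀ (y.2.2 t)

/-- Normalized frames of the flags, as regular functions. -/
def normalPoint : Option (Fin 4) × Fin (2 * b) × Fin (2 * b) → regularRing (pivotSet hP p)
  | (none, q, l) => flagMatrix (scale (param (pivotSet hP p)) (pivotInv hP p)) q l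
  | (some j, q, l) => regularRing.res Set.inter_subset_left (chartPullback hP
      (coordFun j ⟨(l : ℕ) + 1, Nat.succ_lt_succ l.2⟩ l (Nat.lt_succ_self _) q))

theorem evalAt_normalPoint_none (y : pivotSet hP p) :
    (Matrix.of fun q l => regularRing.evalAt y (normalPoint hP p (none, q, l))) =
      flagMatrix y.1.1 * Matrix.diagonal (Sum.elim (regularRing.evalAt y ∘ pivotInv hP p)
        (regularRing.evalAt y ∘ pivotInv hP p) ∘ (interleave b).symm) := by
  rw [← flagMatrix_scale, ← evalAt_comp_param, ← comp_scale, ← flagMatrix_map]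
  rfl

theorem evalAt_normalPoint_some (y : pivotSet hP p) (j : Fin 4) :
    (Matrix.of fun q l => regularRing.evalAt y (normalPoint hP p (some j, q, l))) =
      (P.proj (coverMap hP y.1) j).normalFrame := rfl

/-- Rescaling the columns does not change the partial flag, and the unitriangular frames give the
same complete flags. So these frames represent the same point of the total space. -/
theorem point_normalPoint (y : pivotSet hP p) :
    ∃ h : (fun c => regularRing.evalAt y (normalPoint hP p c)) ∈ frames (X := P.Incidence),
      point ⟨_, h⟩ = coverMap hP y.1 := by
  have hu : ∀ t, regularRing.evalAt y (pivotInv hP p t) ≠ 0 := fun t => inv_ne_zero (y.2.2 t)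
  have hchart : ∀ j i, (P.proj (coverMap hP y.1) j).Chart i := y.2.1
  have hc : ∀ o, IsUnit (Matrix.of fun q l => regularRing.evalAt y (normalPoint hP p (o, q, l))).det
  | none => by
    rw [evalAt_normalPoint_none, Matrix.det_mul, Matrix.det_diagonal, isUnit_iff_ne_zero]
    refine mul_ne_zero (y.1.2.1 none).ne_zero (Finset.prod_ne_zero_iff.2 fun q _ => ?_)
    rw [Function.comp]
    rcases (interleave b).symm q with t | t
    · exact hu t
    · exact hu t
  | some j => by
    rw [evalAt_normalPoint_some]
    exact PartialFlag.isUnit_det_normalFrame (hchart j)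
  have heq : SchubertProblem.pointOfMatrices (D := doubledType a ha hab)
      (fun c => regularRing.evalAt y (normalPoint hP p c)) hc = (coverMap hP y.1).1 := by
    refine Prod.ext (PartialFlag.ofMatrix_eq_of_mem (hc none) _ fun i l hl => ?_)
      (funext fun j => ?_)
    · have hcol :
          (Matrix.of fun q l => regularRing.evalAt y (normalPoint hP p (none, q, l))).col l =
          (Sum.elim (regularRing.evalAt y ∘ pivotInv hP p) (regularRing.evalAt y ∘ pivotInv hP p) ∘
            (interleave b).symm) l • (flagMatrix y.1.1).col l := by
        rw [evalAt_normalPoint_none]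
        ext q
        simp [mul_comm]
      rw [hcol]
      exact Submodule.smul_mem _ _ (PartialFlag.col_mem_ofMatrix (y.1.2.1 none) hl)
    · exact PartialFlag.ofMatrix_normalFrame (hchart j)
  exact ⟨⟨hc, by rw [heq]; exact (coverMap hP y.1).2⟩, Subtype.ext heq⟩

theorem totalRat_normalPoint_mem (hd : Dense (pivotSet hP p))
    (c : Option (Fin 4) × Fin (2 * b) × Fin (2 * b)) :
    (coverMorphism hP).totalRat (isOpen_pivotSet hP p) hd (normalPoint hP p c) ∈ eigField hP := by
  have : Nonempty (CoverSpace b) := nonempty_coverSpace hP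
  obtain ⟨y, hy⟩ := hd.nonempty
  have hne : ∀ t, paramRat hP (.v (halves b (Sum.inl (p t))) t) ≠ 0 := fun t =>
    paramRat_ne_zero hP (hy.2 t)
  obtain ⟨_ | j, q, l⟩ := c
  · have hinv : (coverMorphism hP).totalRat (isOpen_pivotSet hP p) hd ∘ pivotInv hP p =
        fun t => (paramRat hP (.v (halves b (Sum.inl (p t))) t))⁻¹ := by
      funext t
      refine eq_inv_of_mul_eq_one_right ?_
      rw [← map_one ((coverMorphism hP).totalRat (isOpen_pivotSet hP p) hd),
        ← param_mul_pivotInv hP p t, map_mul, ← totalRat_comp_param hP (isOpen_pivotSet hP p) hd]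
      rfl
    have h := congrFun (congrFun (flagMatrix_map (scale (param (pivotSet hP p)) (pivotInv hP p))
      ((coverMorphism hP).totalRat (isOpen_pivotSet hP p) hd)) q) l
    rw [comp_scale, totalRat_comp_param, hinv] at h
    change (coverMorphism hP).totalRat (isOpen_pivotSet hP p) hd (flagMatrix _ q l) ∈ _
    refine (congrArg (· ∈ eigField hP) h).mpr ?_
    obtain ⟨t | t, rfl⟩ := (interleave b).surjective l
    · have := (ratio_mem_eigField hP (hne t) q).1
      rw [div_eq_mul_inv] at this
      simpa [flagMatrix, vMat, scale] using this
    · have := (ratio_mem_eigField hP (hne t) q).2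
      rw [div_eq_mul_inv] at this
      simpa [flagMatrix, wMat, scale] using this
  · have h := (coverMorphism hP).totalRat_res (isOpen_coverChart hP) (dense_coverChart hP)
      (isOpen_pivotSet hP p) hd Set.inter_subset_left (chartPullback hP
      (coordFun j ⟨(l : ℕ) + 1, Nat.succ_lt_succ l.2⟩ l (Nat.lt_succ_self _) q))
    rw [← algebraMap_baseRat_chart] at h
    refine (congrArg (· ∈ eigField hP) h).mpr ?_
    exact (eigField hP).algebraMap_mem _

/-- Substitution of the normalized frames into a polynomial. -/
def evalNormal (f : MvPolynomial (Option (Fin 4) × Fin (2 * b) × Fin (2 * b)) ℂ) :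
    regularRing (pivotSet hP p) :=
  f.eval₂ (regularRing.const _) (normalPoint hP p)

theorem evalAt_evalNormal (y : pivotSet hP p)
    (f : MvPolynomial (Option (Fin 4) × Fin (2 * b) × Fin (2 * b)) ℂ) :
    regularRing.evalAt y (evalNormal hP p f) =
      MvPolynomial.eval (fun c => regularRing.evalAt y (normalPoint hP p c)) f := by
  rw [evalNormal, MvPolynomial.eval₂_comp_left]
  rfl

/-- The entries of the normalized frames lie in `eigField`, and the coefficients are constants of
the base field. -/
theorem totalRat_evalNormal_mem (hd : Dense (pivotSet hP p))
    (f : MvPolynomial (Option (Fin 4) × Fin (2 * b) × Fin (2 * b)) ℂ) :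
    (coverMorphism hP).totalRat (isOpen_pivotSet hP p) hd (evalNormal hP p f) ∈ eigField hP := by
  rw [evalNormal, MvPolynomial.eval₂_comp_left]
  suffices hcoeff : ∀ c : ℂ, (coverMorphism hP).totalRat (isOpen_pivotSet hP p) hd
      (regularRing.const _ c) ∈ (eigField hP).toSubfield.toSubring from
    MvPolynomial.eval₂_mem (s := (eigField hP).toSubfield.toSubring)
      (f := ((coverMorphism hP).totalRat (isOpen_pivotSet hP p) hd).comp (regularRing.const _))
      (fun m _ => hcoeff (f.coeff m)) fun c => totalRat_normalPoint_mem hP p hd c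
  intro c
  have h : ((coverMorphism hP).totalRat (isOpen_pivotSet hP p) hd)
      (regularRing.const _ c) = algebraMap _ _ ((projMorphism hP).baseRat isOpen_univ
        dense_univ (regularRing.const _ c)) := by
    rw [DominantMorphism.algebraMap_baseRat]
    exact (coverMorphism hP).totalRat_res isOpen_univ dense_univ _ _ (Set.subset_univ _)
      (regularRing.const _ c)
  refine (congrArg (· ∈ eigField hP) h).mpr ?_
  exact (eigField hP).algebraMap_mem _

/-- Locally a rational function on the total space is a quotient of polynomials in the entries of
any frame of the point. Substituting the normalized frames writes its pullback as a quotient of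
elements of `eigField`. -/
theorem algebraMap_mem_eigField (x : (projMorphism hP).TotalField) :
    algebraMap _ (coverMorphism hP).TotalField x ∈ eigField hP := by
  obtain ⟨U, hU, hd, g, rfl⟩ := exists_toRat_eq x
  have : Nonempty (CoverSpace b) := nonempty_coverSpace hP
  have hUo := hU.preimage (coverMorphism hP).continuous_toFun
  have hUd := (coverMorphism hP).preimage_dense hU hd
  obtain ⟨y, hyU, hyC⟩ := (dense_coverChart hP).inter_open_nonempty _ hUo hUd.nonempty
  -- The upper half of `vMat` is invertible, so each column has a nonzero entry by which it can be
  -- normalized near `y`.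
  have hp : ∀ t, ∃ p, y.1 (.v (halves b (Sum.inl p)) t) ≠ 0 := by
    intro t
    by_contra! h
    exact det_topHalf_vMat_ne_zero hP hyC (Matrix.det_eq_zero_of_column_eq_zero t h)
  choose p hp using hp
  have hy : y ∈ pivotSet hP p := ⟨hyC, hp⟩
  have := (coverMorphism hP).irreducible_source
  have hpd : Dense (pivotSet hP p) := (isOpen_pivotSet hP p).dense ⟨y, hy⟩
  obtain ⟨hs, hpt⟩ := point_normalPoint hP p ⟨y, hy⟩
  obtain ⟨A, B, hB, hAB⟩ := regularRing.regularOn g ⟨_, hs⟩ (by rw [hpt]; exact hyU)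
  -- The extra factor `B` makes the identity hold also where `B` vanishes, where the local quotient
  -- says nothing.
  have key : regularRing.res Set.inter_subset_right ((coverMorphism hP).comapRegular hU g) *
      regularRing.res Set.inter_subset_left (evalNormal hP p B * evalNormal hP p B) =
      regularRing.res (V := pivotSet hP p ∩ (coverMorphism hP).toFun ⁻¹' U)
        Set.inter_subset_left (evalNormal hP p A * evalNormal hP p B) := by
    refine regularRing.ext_evalAt fun z => ?_
    rw [map_mul, regularRing.evalAt_res, regularRing.evalAt_res, regularRing.evalAt_res, map_mul,
      map_mul, evalAt_evalNormal, evalAt_evalNormal, DominantMorphism.evalAt_comapRegular]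
    obtain ⟨hs', hpt'⟩ := point_normalPoint hP p ⟨z.1, z.2.1⟩
    by_cases h0 : MvPolynomial.eval
        (fun c => regularRing.evalAt ⟨z.1, z.2.1⟩ (normalPoint hP p c)) B = 0
    · rw [h0]
      ring
    · have h1 := hAB ⟨_, hs'⟩ (by rw [hpt']; exact z.2.2) h0
      rw [hpt'] at h1
      have h2 := (zeroExt_apply g.1 (x := coverMap hP z.1) z.2.2).symm.trans h1
      refine (congrArg (· * _) h2).trans ?_
      field_simp
  have hVo := (isOpen_pivotSet hP p).inter hUo
  have hVd := hpd.inter_of_isOpen_right hUd hUo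
  have key' := congrArg ((coverMorphism hP).totalRat hVo hVd) key
  rw [map_mul, DominantMorphism.totalRat_res _ hUo hUd,
    DominantMorphism.totalRat_res _ (isOpen_pivotSet hP p) hpd,
    DominantMorphism.totalRat_res _ (isOpen_pivotSet hP p) hpd, map_mul, map_mul] at key'
  have hBne : (coverMorphism hP).totalRat (isOpen_pivotSet hP p) hpd (evalNormal hP p B) ≠ 0 := by
    refine DominantMorphism.totalRat_ne_zero _ _ _ ⟨y, hy⟩ ?_
    rw [evalAt_evalNormal]
    exact hB
  have hx : algebraMap (projMorphism hP).TotalField (coverMorphism hP).TotalField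
      (toRat hU hd g) =
      (coverMorphism hP).totalRat hUo hUd ((coverMorphism hP).comapRegular hU g) :=
    (coverMorphism hP).algebraMap_totalRat (projMorphism hP) hU hd g
  rw [hx]
  have hdiv : (coverMorphism hP).totalRat hUo hUd ((coverMorphism hP).comapRegular hU g) =
      (coverMorphism hP).totalRat (isOpen_pivotSet hP p) hpd (evalNormal hP p A) /
      (coverMorphism hP).totalRat (isOpen_pivotSet hP p) hpd (evalNormal hP p B) := by
    rw [eq_div_iff hBne]
    refine mul_right_cancel₀ hBne ?_
    rw [mul_assoc]
    exact key'
  rw [hdiv]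
  exact div_mem (totalRat_evalNormal_mem hP p hpd A) (totalRat_evalNormal_mem hP p hpd B)

end normalPoint

end

noncomputable section

open VarietyPresentation CoverParam

attribute [local instance] zariski

/-! ## The action of the symmetric group on the function field of the cover -/

section permAction

set_option linter.unusedSectionVars false

variable {r b : ℕ} {a : Fin r → ℕ} {ha : StrictMono a} {hab : ∀ i, a i < b}
  {P : SchubertProblem (doubledType a ha hab) 4} (hP : IsDoubled P)

/-- The automorphism of the function field of the cover given by a permutation. -/
def permHom (σ : Equiv.Perm (Fin b)) :
    (coverMorphism hP).TotalField →ₐ[(projMorphism hP).BaseField] (coverMorphism hP).TotalField :=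
  (coverMorphism hP).towerHom (projMorphism hP) (permMorphism hP σ)
    (proj_coverMap_coverPerm hP σ)

theorem permHom_paramRat_eig (σ : Equiv.Perm (Fin b)) (t : Fin b) :
    permHom hP σ (paramRat hP (.eig t)) = paramRat hP (.eig (σ t)) :=
  (coverMorphism hP).towerHom_totalRat (projMorphism hP) (permMorphism hP σ) _ isOpen_univ
    dense_univ (param Set.univ (.eig t))

theorem isFrame_incidence (P : SchubertProblem (doubledType a ha hab) 4) :
    IsFrame (fun x : P.Incidence => x.1.1) (Matrix.of fun p q => (MvPolynomial.X (none, p, q) :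
      MvPolynomial (Option (Fin 4) × Fin (2 * b) × Fin (2 * b)) ℂ)) := by
  intro c
  have h : (Matrix.of fun p q => (MvPolynomial.X (none, p, q) :
      MvPolynomial (Option (Fin 4) × Fin (2 * b) × Fin (2 * b)) ℂ)).map (MvPolynomial.eval c.1) =
      Matrix.of fun p q => c.1 (none, p, q) := by
    ext p q
    simp
  refine ⟨by rw [h]; exact c.2.1 none, ?_⟩
  simp only [h]
  rfl

/-- The points of the total space whose flag of solutions lies in the first affine chart. -/
def incidenceChart (P : SchubertProblem (doubledType a ha hab) 4) : Set P.Incidence :=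
  {x | ∀ i, x.1.1.Chart i}

theorem isOpen_incidenceChart (P : SchubertProblem (doubledType a ha hab) 4) :
    IsOpen (incidenceChart P) := by
  rw [incidenceChart, Set.ofPred_forall]
  exact isOpen_iInter_of_finite fun i => (isFrame_incidence P).isOpen_chart i

/-- By irreducibility one point is enough, and it is found where the product of two nonzero
polynomials does not vanish: the one defining the cover and the product of the leading minors. -/
theorem dense_incidenceChart (hP : IsDoubled P) : Dense (incidenceChart P) := by
  have := (projMorphism hP).irreducible_source
  refine (isOpen_incidenceChart P).dense ?_
  obtain ⟨y₀⟩ := nonempty_coverSpace hP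
  have hdisc : (disc MvPolynomial.X : MvPolynomial (CoverParam b) ℂ) ≠ 0 := by
    refine ne_zero_of_eval (t := y₀.1) ?_
    rw [map_disc, eval_comp_X, disc_ne_zero_iff]
    exact y₀.2
  have hminor : ∀ (y : CoverParam b → ℂ) (d : ℕ), MvPolynomial.eval y
      ((flagMatrix MvPolynomial.X : Matrix _ _ (MvPolynomial (CoverParam b) ℂ)).leading d).det =
      ((flagMatrix y).leading d).det := by
    intro y d
    have h := flagMatrix_map (MvPolynomial.X : CoverParam b → MvPolynomial (CoverParam b) ℂ)
      (MvPolynomial.eval y)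
    rw [eval_comp_X] at h
    rw [RingHom.map_det, ← h]
    rfl
  -- This choice makes the flag frame the identity matrix, which shows that the minors are nonzero
  -- polynomials. It need not be a point of the cover.
  let y₁ : CoverParam b → ℂ := fun c => match c with
    | .v p t => (1 : Matrix _ _ ℂ) p (interleave b (Sum.inl t))
    | .w p t => (1 : Matrix _ _ ℂ) p (interleave b (Sum.inr t))
    | _ => 0
  have hy₁ : flagMatrix y₁ = 1 := by
    ext p q
    obtain ⟨x | x, rfl⟩ := (interleave b).surjective q <;> simp [flagMatrix, vMat, wMat, y₁]
  have hminors : ∏ i, ((flagMatrix MvPolynomial.X :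
      Matrix _ _ (MvPolynomial (CoverParam b) ℂ)).leading (2 * a i)).det ≠ 0 := by
    refine Finset.prod_ne_zero_iff.2 fun i _ => ne_zero_of_eval (t := y₁) ?_
    rw [hminor, hy₁]
    have : (1 : Matrix (Fin (2 * b)) (Fin (2 * b)) ℂ).leading (2 * a i) = 1 :=
      Matrix.submatrix_one _ Subtype.val_injective
    rw [this, Matrix.det_one]
    exact one_ne_zero
  obtain ⟨y, hy⟩ := exists_eval_ne_zero (mul_ne_zero hdisc hminors)
  rw [map_mul, map_disc, eval_comp_X, map_prod] at hy
  have hgood : Good y := (disc_ne_zero_iff y).1 (left_ne_zero_of_mul hy)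
  refine ⟨coverMap hP ⟨y, hgood⟩, fun i => ?_⟩
  have h := Finset.prod_ne_zero_iff.1 (right_ne_zero_of_mul hy) i (Finset.mem_univ _)
  rw [hminor] at h
  exact (PartialFlag.chart_ofMatrix_iff (D := doubledType a ha hab) _ (hgood.1 none) i).2 h

/-- If all functions pulled back from the total space are fixed, so are the chart coordinates of the
solution; then renumbering fixes the solution at a general point, hence the standard flag.
Conversely, the stabilizer of the standard flag acts over the total space. -/
theorem permHom_fixes_iff (σ : Equiv.Perm (Fin b)) :
    (∀ x : (projMorphism hP).TotalField, permHom hP σ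
      (algebraMap _ (coverMorphism hP).TotalField x) = algebraMap _ _ x) ↔
      (stdFlag a b ha hab).act σ = stdFlag a b ha hab := by
  constructor
  · intro h
    have hO := isOpen_incidenceChart P
    have hD := dense_incidenceChart hP
    let coord (i : Fin r) (l : {l : Fin (2 * b) // (l : ℕ) < 2 * a i}) (p : Fin (2 * b)) :
        regularRing (incidenceChart P) :=
      regularRing.of (fun x : P.Incidence => x.1.1.coordVec i l.1 p)
        (((isFrame_incidence P).regularOn_coordVec i l.2 p).mono fun _ hx => hx i)
    have hev : ∀ (i : Fin r) (l : {l : Fin (2 * b) // (l : ℕ) < 2 * a i}) (p : Fin (2 * b)),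
        ∀ᶠ y in generic (CoverSpace b),
        (coverMap hP (coverPerm σ y)).1.1.coordVec i l.1 p =
          (coverMap hP y).1.1.coordVec i l.1 p := by
      intro i l p
      have h1 := h ((projMorphism hP).totalRat hO hD (coord i l p))
      rw [DominantMorphism.algebraMap_totalRat] at h1
      have h2 := (toRat_eq_toRat_iff _ _ _ _).1 (((coverMorphism hP).towerHom_totalRat
        (projMorphism hP) (permMorphism hP σ) (proj_coverMap_coverPerm hP σ) _ _ _).symm.trans h1)
      filter_upwards [h2] with y ⟨_, _, hy⟩
      exact hy
    have hev' := (Filter.eventually_all.2 fun i => Filter.eventually_all.2 fun l =>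
      Filter.eventually_all.2 fun p => hev i l p)
    have hO' := hO.preimage (coverMorphism hP).continuous_toFun
    have hD' := (coverMorphism hP).preimage_dense hO hD
    have : Nonempty (CoverSpace b) := nonempty_coverSpace hP
    have := generic_neBot (X := CoverSpace b)
    -- There are finitely many coordinates, so a single point satisfies all the equalities, with
    -- both its solution and the renumbered one in the chart.
    obtain ⟨y, hy, hy1, hy2⟩ := (hev'.and ((eventually_generic_mem hO' hD').and
      (eventually_generic_mem (hO'.preimage (permMorphism hP σ).continuous_toFun)
        ((permMorphism hP σ).preimage_dense hO' hD')))).exists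
    exact act_stdFlag_eq_of_sub_eq hP fun i => (hy2 i).sub_eq (hy1 i) fun l hl =>
      funext fun p => hy i ⟨l, hl⟩ p
  · intro h x
    obtain ⟨_, f, U, hU, hd, hf, rfl⟩ := x
    refine Subtype.ext (Filter.Germ.coe_eq.2 (Filter.Eventually.of_forall fun y => ?_))
    exact congrArg f (coverMap_coverPerm hP h y)

/-- The action of the symmetric group on flags of subsets. -/
instance subsetFlagAction {r b : ℕ} (a : Fin r → ℕ) :
    MulAction (Equiv.Perm (Fin b)) (SubsetFlag a b) where
  smul σ T := T.act σ
  one_smul := act_one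
  mul_smul := act_mul

theorem exists_gal_equiv_perm (hP : IsDoubled P) (hr : 0 < r) (ha1 : ∀ i, 1 ≤ a i) :
    ∃ π : BranchedCover P.Incidence (FlagTuple (2 * b) 4), π.toFun = P.proj ∧
      ∃ (e : π.Gal ≃* Equiv.Perm (Fin b)) (ε : π.Sheets ≃ SubsetFlag a b),
        ∀ (σ : π.Gal) (x : π.Sheets), ε (π.act σ x) = (ε x).act (e σ) := by
  obtain ⟨φ, -, hφ, -⟩ := exists_operator_slopeRat hP
  have : FaithfulSMul (Equiv.Perm (Fin b)) (SubsetFlag a b) := ⟨fun {σ τ} h => by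
    rw [← inv_mul_eq_one]
    refine (eq_one_of_act_eq hr ha ha1 hab fun T => ?_)
    change (σ⁻¹ * τ) • T = T
    rw [mul_smul, ← h T, inv_smul_smul]⟩
  obtain ⟨hfin, e, ε, h⟩ := exists_gal_equiv (L := (projMorphism hP).TotalField)
    (paramRat_eig_injective hP) (charpoly_map_eq_prod (det_topHalf_vMat_paramRat_ne_zero hP) hφ)
    (permHom hP) (permHom_paramRat_eig hP) (stdFlag a b ha hab) exists_act_stdFlag_eq
    (permHom_fixes_iff hP) (algebraMap_mem_eigField hP)
  exact ⟨⟨projMorphism hP, hfin⟩, rfl, e, ε, h⟩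

end permAction

end

theorem theorem5p1 (r b : ℕ) (hr : 0 < r) (a : Fin r → ℕ) (ha : StrictMono a)
    (ha1 : ∀ i, 1 ≤ a i) (hab : ∀ i, a i < b) :
    ∃ P : SchubertProblem (doubledType a ha hab) 4,
      -- the problem asks for the flags whose members meet four `b`-planes as prescribed
      (∀ (F : FlagTuple (2 * b) 4) (E : PartialFlag (doubledType a ha hab)),
        E ∈ P.solutions F ↔
          ∀ (i : Fin r) (j : Fin 4), a i ≤ Module.finrank ℂ ↥(E.sub i ⊓ middle F j)) ∧
      -- the solutions for general flags
      (∃ U : Set (FlagTuple (2 * b) 4),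
        IsOpen[VarietyPresentation.zariski (FlagTuple (2 * b) 4)] U ∧ U.Nonempty ∧
        ∀ F ∈ U, (∀ i j, i ≠ j → IsCompl (middle F i) (middle F j)) ∧
          ∃ f₃ f₄ : middle F 0 ≃ₗ[ℂ] middle F 1,
            IsGraphOf f₃ (middle F 2) ∧ IsGraphOf f₄ (middle F 3) ∧
            -- solutions correspond to flags stable under `φ = f₄⁻¹ ∘ f₃`
            (∃ Φ : StableFlag a (f₃.trans f₄.symm) ≃ P.solutions F,
              ∀ L i, (Φ L).1.sub i = (L.1 i).map (middle F 0).subtype ⊔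
                ((L.1 i).map f₃.toLinearMap).map (middle F 1).subtype) ∧
            -- `φ` has distinct eigenvalues, and stable flags are spanned by eigenvectors
            ∃ (v : Module.Basis (Fin b) ℂ (middle F 0)) (μ : Fin b → ℂ),
              Function.Injective μ ∧ (∀ t, f₄.symm (f₃ (v t)) = μ t • v t) ∧
              ∃ Ψ : SubsetFlag a b ≃ StableFlag a (f₃.trans f₄.symm),
                ∀ T i, (Ψ T).1 i = Submodule.span ℂ (v '' (T.1 i : Set (Fin b)))) ∧
      -- the incidence variety is a branched cover with Galois group `S_b` on flags of subsets
      ∃ π : VarietyPresentation.BranchedCover P.Incidence (FlagTuple (2 * b) 4),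
        π.toFun = P.proj ∧
        ∃ (e : π.Gal ≃* Equiv.Perm (Fin b)) (ε : π.Sheets ≃ SubsetFlag a b),
          ∀ (σ : π.Gal) (x : π.Sheets), ε (π.act σ x) = (ε x).act (e σ) := by
  refine ⟨DoubledSchubert.problem b ha hab, DoubledSchubert.mem_solutions_iff ha hab,
    ⟨generalTuples b, isOpen_generalTuples b, nonempty_generalTuples b, fun F hF =>
      ⟨fun i j hij => isCompl_of_general hF hij, ?_⟩⟩,
    exists_gal_equiv_perm (DoubledSchubert.mem_solutions_iff ha hab) hr ha1⟩
  obtain ⟨v, w, μ, h⟩ := exists_eigenFrame_of_general hF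
  obtain ⟨f₃, f₄, h₃, h₄, Φ, B, Ψ, hΦ, hB, hΨ, -⟩ :=
    h.solutions (DoubledSchubert.mem_solutions_iff ha hab F)
      (isCompl_of_general hF (show (0 : Fin 4) ≠ 1 by decide)).disjoint
  exact ⟨f₃, f₄, h₃, h₄, ⟨Φ, hΦ⟩, B, μ, h.injective, hB, Ψ, hΨ⟩
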